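/- Setting. $m\ge 1$ clients have objectives $f_j:\mathbb R^d\to\mathbb R$; $f=\frac1m\sum_{j=1}^m f_j$ has a minimizer $w^*$. Assume: (i) each $f_j$ is differentiable and $\|\nabla f_j(u)-\nabla f_j(v)\|\le L\|u-v\|$ for all $u,v$ ($L>0$); (ii) client $j$ can draw stochastic gradients $\tilde g_j(w)$ with $\mathbb E\,\tilde g_j(w)=\nabla f_j(w)$ and $\mathbb E\|\tilde g_j(w)-\nabla f_j(w)\|^2\le\sigma^2$ for every $w$ (the laws of the samples may differ between clients); (iii) $Q$ is a random compression operator with $\mathbb E\,Q(x)=x$ and $\mathbb E\|Q(x)-x\|^2\le q\|x\|^2$ for every $x$ ($q\ge 0$); (iv) for all $x_1,\dots,x_m\in\mathbb R^d$, $\mathbb E\big\|\frac1m\sum_j Q(x_j)\big\|^2-\mathbb E\big\|Q\big(\frac1m\sum_j x_j\big)\big\|^2\le G_q$, where different clients use independent randomness in $Q$. FedCOMGATE with parameters $R,\tau,\eta,\gamma$ starts at $w^{(0)}$ with $\delta_j^{(0)}=0$. In round $r=0,\dots,R-1$ each client sets $w_j^{(0,r)}=w^{(r)}$, makes $\tau$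 local steps $w_j^{(c+1,r)}=w_j^{(c,r)}-\eta\big(\tilde g_j(w_j^{(c,r)})-\delta_j^{(r)}\big)$ with fresh samples, and sends $\Delta_{j}^{(r)}=Q\big((w^{(r)}-w_j^{(\tau,r)})/\eta\big)$; with $\Delta^{(r)}=\frac1m\sum_j\Delta_{j}^{(r)}$ one sets $w^{(r+1)}=w^{(r)}-\eta\gamma\Delta^{(r)}$ and $\delta_j^{(r+1)}=\delta_j^{(r)}+\frac1\tau(\Delta_{j}^{(r)}-\Delta^{(r)})$. All samples and all uses of $Q$ are independent. Let $F_0$ and $H$ be bounds with $f(w^{(0)})-f(w^*)\le F_0$ and $\frac1m\sum_j\|\nabla f_j(w^{(0)})-\nabla f(w^{(0)})\|^2\le H$. In each case below the guarantee holds for all $0<\varepsilon\le\varepsilon_0$, where $\varepsilon_0>0$ may depend on $m,q,G_q$ and on the arguments of the constants $C_1,C_2>0$, but not on $d$, the problem instance or $\gamma$. Nonconvex. There are $C_1,C_2$ depending only on $L,\sigma,F_0,H$ such that with $R=\lceil C_1(q+1)/\varepsilon\rceil$, $\tau=\lceil C_2/(m\varepsilon)\rceil$, any $\gamma\ge m$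 and $\eta=\frac1{L\gamma}\sqrt{\frac{m}{R\tau(q+1)}}$, $$\mathbb E\Big[\frac1R\sum_{r=0}^{R-1}\|\nabla f(w^{(r)})\|^2\Big]\le\varepsilon .$$ PL or strongly convex. There are an absolute constant $C_1$, and $C_2$ depending only on $L,\mu,\sigma,F_0,H$, such that if $f$ satisfies $\frac12\|\nabla f(w)\|^2\ge\mu(f(w)-f(w^*))$ for all $w$ or is $\mu$-strongly convex ($\mu>0$, $\kappa=L/\mu$), then with $R=\lceil C_1(q+1)\kappa\log(1/\varepsilon)\rceil$, $\tau=\lceil C_2/(m\varepsilon)\rceil$, any $\gamma\ge\sqrt{m\tau}$, and either $\eta=\frac1{2L(q/m+1)\tau\gamma}$ or $\eta=\frac1{2L(q+1)\tau\gamma}$, $$\mathbb E\big[f(w^{(R)})-f(w^*)\big]\le\varepsilon .$$ Convex. There are an absolute constant $C_1$, and $C_2$ depending only on $L,\sigma,H$ and a bound $B\ge\max(\|w^{(0)}\|,\|w^*\|)$, such that if $f$ is convex, then with $R=\big\lceil C_1\frac{L(1+q)}{\varepsilon}\log(1/\varepsilon)\big\rceil$, $\tau=\lceil C_2/(m\varepsilon^2)\rceil$,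 any $\gamma\ge\sqrt{m\tau}$ and $\eta=\frac1{2L(q+1)\tau\gamma}$, $$\mathbb E\big[f(w^{(R)})-f(w^*)\big]\le\varepsilon ,$$ both when the algorithm is run on the $f_j$ themselves and when it is run on the regularized objectives $f_j+\frac{\phi}{2}\|\cdot\|^2$ with $\phi=1/\sqrt{m\tau}$ (with stochastic gradients $\tilde g_j(w)+\phi w$). -/

import Mathlib

open MeasureTheory ProbabilityTheory

universe u v w

noncomputable section

/-- The parameter space `ℝ^d` with the Euclidean norm. -/
abbrev Vec (d : ℕ) : Type := EuclideanSpace ℝ (Fin d)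

/-- The data of a federated optimization problem with `m` clients: local objectives, local data
distributions on a sample space `Ξ` (a point of `Ξ` is what one stochastic gradient evaluation
draws, e.g. a whole mini-batch), stochastic gradients, and a randomized compression operator `Q`,
presented as a map `comp x s` of its input `x` and of a random seed `s` with law `compLaw`. -/
structure FedSetup (d m : ℕ) (Ξ : Type u) (S : Type v)
    [MeasurableSpace Ξ] [MeasurableSpace S] where
  /-- local objective `f_j` -/
  loss : Fin m → Vec d → ℝ
  /-- law of the sample that client `j` draws for one stochastic gradient -/
  dataLaw : Fin m → Measure Ξ
  /-- stochastic gradient of `f_j` at a point, for a given sample -/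
  stochGrad : Fin m → Vec d → Ξ → Vec d
  /-- law of the seed of the compressor -/
  compLaw : Measure S
  /-- the compression operator -/
  comp : Vec d → S → Vec d

namespace FedSetup

variable {d m : ℕ} {Ξ : Type u} {S : Type v} [MeasurableSpace Ξ] [MeasurableSpace S]

/-- The global objective `f = (1/m) ∑ j, f_j`. -/
def globalLoss (F : FedSetup d m Ξ S) (x : Vec d) : ℝ :=
  (m : ℝ)⁻¹ * ∑ j, F.loss j x

/-- The local objectives are differentiable and `L`-smooth. -/
def Smooth (F : FedSetup d m Ξ S) (L : ℝ) : Prop :=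
  ∀ j, Differentiable ℝ (F.loss j) ∧
    ∀ x y, ‖gradient (F.loss j) x - gradient (F.loss j) y‖ ≤ L * ‖x - y‖

/-- The stochastic gradients are unbiased for the local gradients, with variance at most `σ²`. -/
structure BoundedVariance (F : FedSetup d m Ξ S) (σ : ℝ) : Prop where
  prob : ∀ j, IsProbabilityMeasure (F.dataLaw j)
  measurable : ∀ j, Measurable (Function.uncurry (F.stochGrad j))
  integrable : ∀ j x, Integrable (F.stochGrad j x) (F.dataLaw j)
  unbiased : ∀ j x, ∫ z, F.stochGrad j x z ∂(F.dataLaw j) = gradient (F.loss j) x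
  sq_integrable : ∀ j x,
    Integrable (fun z => ‖F.stochGrad j x z - gradient (F.loss j) x‖ ^ 2) (F.dataLaw j)
  variance_le : ∀ j x,
    ∫ z, ‖F.stochGrad j x z - gradient (F.loss j) x‖ ^ 2 ∂(F.dataLaw j) ≤ σ ^ 2

/-- The compressor is unbiased, with variance at most `q ‖x‖²`. -/
structure UnbiasedCompressor (F : FedSetup d m Ξ S) (q : ℝ) : Prop where
  prob : IsProbabilityMeasure F.compLaw
  measurable : Measurable (Function.uncurry F.comp)
  integrable : ∀ x, Integrable (F.comp x) F.compLaw
  unbiased : ∀ x, ∫ s, F.comp x s ∂F.compLaw = x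
  sq_integrable : ∀ x, Integrable (fun s => ‖F.comp x s - x‖ ^ 2) F.compLaw
  variance_le : ∀ x, ∫ s, ‖F.comp x s - x‖ ^ 2 ∂F.compLaw ≤ q * ‖x‖ ^ 2

/-- The compression discrepancy is at most `Gq`:
`E ‖(1/m) ∑ j, Q(x_j)‖² - E ‖Q((1/m) ∑ j, x_j)‖² ≤ Gq` for all inputs `x_1, …, x_m`, where the
`m` clients compress with independent seeds. -/
def CompressionGap (F : FedSetup d m Ξ S) (Gq : ℝ) : Prop :=
  ∀ x : Fin m → Vec d,
    (∫ s : Fin m → S, ‖(m : ℝ)⁻¹ • ∑ j, F.comp (x j) (s j)‖ ^ 2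
        ∂(Measure.pi fun _ => F.compLaw))
      - ∫ s, ‖F.comp ((m : ℝ)⁻¹ • ∑ j, x j) s‖ ^ 2 ∂F.compLaw ≤ Gq

/-- The standing assumptions on the objectives, stochastic gradients and compressor. -/
structure Standing (F : FedSetup d m Ξ S) (L σ q Gq : ℝ) : Prop where
  smooth : F.Smooth L
  boundedVariance : F.BoundedVariance σ
  unbiasedCompressor : F.UnbiasedCompressor q
  compressionGap : F.CompressionGap Gq

/-- The dissimilarity `(1/m) ∑ j, ‖∇f_j(x) - ∇f(x)‖²` of the local gradients at `x`. -/
def dissimilarity (F : FedSetup d m Ξ S) (x : Vec d) : ℝ :=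
  (m : ℝ)⁻¹ * ∑ j, ‖gradient (F.loss j) x - gradient F.globalLoss x‖ ^ 2

/-- The `μ`-Polyak–Łojasiewicz condition on the global objective, with minimizer `xs`. -/
def PL (F : FedSetup d m Ξ S) (μ : ℝ) (xs : Vec d) : Prop :=
  ∀ x, μ * (F.globalLoss x - F.globalLoss xs) ≤ 1 / 2 * ‖gradient F.globalLoss x‖ ^ 2

/-- `μ`-strong convexity of the global objective. -/
def StrongConvex (F : FedSetup d m Ξ S) (μ : ℝ) : Prop :=
  ∀ x y, F.globalLoss y + inner ℝ (gradient F.globalLoss y) (x - y) + μ / 2 * ‖x - y‖ ^ 2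
    ≤ F.globalLoss x

/-- The problem with every local objective replaced by `f_j + (φ/2) ‖·‖²`. -/
def regularize (F : FedSetup d m Ξ S) (φ : ℝ) : FedSetup d m Ξ S where
  loss j x := F.loss j x + φ / 2 * ‖x‖ ^ 2
  dataLaw := F.dataLaw
  stochGrad j x z := F.stochGrad j x z + φ • x
  compLaw := F.compLaw
  comp := F.comp

/-- The local models `w_j^{(c,r)}`, `c = 0, 1, …`, of client `j` in one round that starts at the
global model `x` with correction vector `δ`, where `z c` is the sample drawn in local step `c`. -/
def localModel (F : FedSetup d m Ξ S) (η : ℝ) (j : Fin m) (x δ : Vec d) (z : ℕ → Ξ) : ℕ → Vec d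
  | 0 => x
  | c + 1 =>
    F.localModel η j x δ z c - η • (F.stochGrad j (F.localModel η j x δ z c) (z c) - δ)

/-- The message `Δ_{j,q} = Q((w - w_j^{(τ)}) / η)` that client `j` sends to the server. -/
def message (F : FedSetup d m Ξ S) (τ : ℕ) (η : ℝ) (j : Fin m) (x δ : Vec d) (z : ℕ → Ξ)
    (s : S) : Vec d :=
  F.comp (η⁻¹ • (x - F.localModel η j x δ z τ)) s

/-- The average `Δ_q` of the messages of all the clients. -/
def avgMessage (F : FedSetup d m Ξ S) (τ : ℕ) (η : ℝ) (x : Vec d) (δ : Fin m → Vec d)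
    (z : Fin m → ℕ → Ξ) (s : Fin m → S) : Vec d :=
  (m : ℝ)⁻¹ • ∑ j, F.message τ η j x (δ j) (z j) (s j)

/-- The global model `w^{(r)}` and the correction vectors `δ_j^{(r)}` of FedCOMGATE after `r`
rounds, started at `w^{(0)} = x₀` and `δ_j^{(0)} = 0`. Here `z j r c` is the sample that client
`j` draws in local step `c` of round `r`, and `s j r` the seed of its compressor in round `r`. -/
def fedcomgate (F : FedSetup d m Ξ S) (τ : ℕ) (η γ : ℝ) (x₀ : Vec d)
    (z : Fin m → ℕ → ℕ → Ξ) (s : Fin m → ℕ → S) : ℕ → Vec d × (Fin m → Vec d)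
  | 0 => (x₀, fun _ => 0)
  | r + 1 =>
    let x := (F.fedcomgate τ η γ x₀ z s r).1
    let δ := (F.fedcomgate τ η γ x₀ z s r).2
    let D := F.avgMessage τ η x δ (fun j => z j r) (fun j => s j r)
    (x - (η * γ) • D,
      fun j => δ j + (τ : ℝ)⁻¹ • (F.message τ η j x (δ j) (z j r) (s j r) - D))

/-- The random global model `w^{(r)}` of FedCOMGATE, for random samples `z` and seeds `s`. -/
def globalModel (F : FedSetup d m Ξ S) (τ : ℕ) (η γ : ℝ) (x₀ : Vec d) {Ω : Type w}
    (z : Fin m → ℕ → ℕ → Ω → Ξ) (s : Fin m → ℕ → Ω → S) (r : ℕ) (ω : Ω) : Vec d :=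
  (F.fedcomgate τ η γ x₀ (fun j k c => z j k c ω) (fun j k => s j k ω) r).1

/-- All samples and all compressor seeds are mutually independent, with the prescribed laws. -/
structure Sampling (F : FedSetup d m Ξ S) {Ω : Type w} [MeasurableSpace Ω] (P : Measure Ω)
    (z : Fin m → ℕ → ℕ → Ω → Ξ) (s : Fin m → ℕ → Ω → S) : Prop where
  measurable_sample : ∀ j r c, Measurable (z j r c)
  measurable_seed : ∀ j r, Measurable (s j r)
  law_sample : ∀ j r c, P.map (z j r c) = F.dataLaw j
  law_seed : ∀ j r, P.map (s j r) = F.compLaw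
  indep_samples : iIndepFun (fun (i : Fin m × ℕ × ℕ) => z i.1 i.2.1 i.2.2) P
  indep_seeds : iIndepFun (fun (i : Fin m × ℕ) => s i.1 i.2) P
  indep_samples_seeds : IndepFun (fun ω (i : Fin m × ℕ × ℕ) => z i.1 i.2.1 i.2.2 ω)
    (fun ω (i : Fin m × ℕ) => s i.1 i.2 ω) P

end FedSetup

end

open MeasureTheory ProbabilityTheory

noncomputable section

/-! The analysis takes place in the Hilbert space `L²` of square-integrable random vectors. There,
second moments are squared norms, and unbiasedness of a fresh sample or seed becomes orthogonality
to every square-integrable vector determined by the past. One round of the algorithm becomes a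
deterministic configuration of vectors (`Round`), and all inequalities are proved for such
configurations.

Write `s = η γ τ`, `A = 6 (η τ L)²`, `g` for the gradient of the global objective at the current
model and `T` for `trackErr`. Unrolling the local steps shows that a client's message divided by `τ`
is its own gradient at `x`, minus `δ_j`, plus a drift (the gradient moved during the local steps)
plus averaged noise. This has two consequences. Since the corrections average to zero, the server
makes a perturbed gradient step of length `s` (`Round.objective_le`). And the old `δ_j` cancels in
the new one, which becomes the gradient dissimilarity at `x` up to errors; so `T` is forgotten after
one round except through the drift, whose mean square is at most `A (‖g‖² + T + σ²/τ)`
(`Round.trackErr_le`). The step `s` does not depend on `γ`, whereas a large `γ` makes `A ≤ 1/(1000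
m)`. Hence the potential `f - f* + 8 A s T` decreases up to noise (`potential_step`).

For two or more clients the compression gap bounds the variance of `Q` itself by `m² Gq`
(`comp_variance_le_gap`). This error enters divided by `τ²`, so it is of higher order in the
accuracy than the gradient noise `σ²/(m τ)`, in which the factor `1/m` comes from orthogonality
across clients.

The three cases differ in how the recursion is used. In the nonconvex case the potential is
telescoped. Under PL it contracts; the constants in `R` make the contraction factor at most `ε²`,
and the spare `ε` absorbs the initial potential. In the convex case a second potential, built on the
squared distance to the minimizer, stays below a constant `D` for `R` rounds, and convexity then
turns `‖g‖²` into at least `(f - f*)²/D`, which gives decay like `1/r`. The factor `log (1/ε)` in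
`R` eventually exceeds a multiple of `D`, which is why an absolute `C₁` suffices. Regularization
costs at most a bias `(φ/2) ‖w*‖² ≤ ε/2`. -/

namespace FedComgate

open scoped ENNReal

/-! ### Averages over the clients -/

section Mean

variable {m : ℕ} {E : Type*} [AddCommGroup E] [Module ℝ E]

/-- The average of a family indexed by the clients. -/
def mean (v : Fin m → E) : E := (m : ℝ)⁻¹ • ∑ j, v j

theorem mean_add (v w : Fin m → E) : mean (fun j => v j + w j) = mean v + mean w := by
  simp [mean, Finset.sum_add_distrib]

theorem mean_sub (v w : Fin m → E) : mean (fun j => v j - w j) = mean v - mean w := by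
  simp [mean, Finset.sum_sub_distrib, smul_sub]

theorem mean_smul (a : ℝ) (v : Fin m → E) : mean (fun j => a • v j) = a • mean v := by
  rw [mean, mean, ← Finset.smul_sum, smul_comm]

theorem mean_mul (a : ℝ) (v : Fin m → ℝ) : mean (fun j => a * v j) = a * mean v :=
  mean_smul a v

theorem mean_const (hm : 0 < m) (x : E) : mean (fun _ : Fin m => x) = x := by
  have : (m : ℝ) ≠ 0 := by positivity
  simp [mean, ← Nat.cast_smul_eq_nsmul ℝ, smul_smul, this]

theorem mean_nonneg {a : Fin m → ℝ} (h : ∀ j, 0 ≤ a j) : 0 ≤ mean a :=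
  smul_nonneg (by positivity) (Finset.sum_nonneg fun j _ => h j)

theorem mean_mono {a b : Fin m → ℝ} (h : ∀ j, a j ≤ b j) : mean a ≤ mean b :=
  smul_le_smul_of_nonneg_left (Finset.sum_le_sum fun j _ => h j) (by positivity)

end Mean

/-! ### One round as a configuration of vectors in a Hilbert space -/

section Hilbert

variable {H : Type*} [NormedAddCommGroup H] [InnerProductSpace ℝ H] {m : ℕ}

local notation "⟪" x "," y "⟫" => inner ℝ x y

theorem inner_mean (v : Fin m → H) (y : H) : ⟪mean v, y⟫ = mean fun j => ⟪v j, y⟫ := by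
  simp [mean, real_inner_smul_left, sum_inner]

theorem mean_norm_sub_mean_sq (hm : 0 < m) (v : Fin m → H) :
    mean (fun j => ‖v j - mean v‖ ^ 2) = mean (fun j => ‖v j‖ ^ 2) - ‖mean v‖ ^ 2 := by
  have h : ∀ j, ‖v j - mean v‖ ^ 2 = ‖v j‖ ^ 2 - 2 * ⟪v j, mean v⟫ + ‖mean v‖ ^ 2 :=
    fun j => norm_sub_sq_real _ _
  simp only [h, mean_add, mean_sub, mean_mul, mean_const hm, ← inner_mean,
    real_inner_self_eq_norm_sq]
  ring

theorem norm_mean_sq_le (hm : 0 < m) (v : Fin m → H) :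
    ‖mean v‖ ^ 2 ≤ mean fun j => ‖v j‖ ^ 2 := by
  have := mean_norm_sub_mean_sq hm v
  have h2 : 0 ≤ mean fun j => ‖v j - mean v‖ ^ 2 := mean_nonneg fun j => by positivity
  linarith

theorem mean_norm_sub_mean_sq_le (hm : 0 < m) (v : Fin m → H) :
    mean (fun j => ‖v j - mean v‖ ^ 2) ≤ mean fun j => ‖v j‖ ^ 2 := by
  have := mean_norm_sub_mean_sq hm v
  nlinarith [sq_nonneg ‖mean v‖]

theorem norm_sum_sq_le {E : Type*} [SeminormedAddCommGroup E] {ι : Type*} (s : Finset ι)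
    (v : ι → E) :
    ‖∑ i ∈ s, v i‖ ^ 2 ≤ s.card * ∑ i ∈ s, ‖v i‖ ^ 2 := by
  calc ‖∑ i ∈ s, v i‖ ^ 2 ≤ (∑ i ∈ s, ‖v i‖) ^ 2 := by
        gcongr
        exact norm_sum_le _ _
    _ ≤ _ := sq_sum_le_card_mul_sum_sq

theorem norm_sum_sq_of_orthogonal {ι : Type*} (s : Finset ι) (v : ι → H)
    (h : ∀ i ∈ s, ∀ j ∈ s, i ≠ j → ⟪v i, v j⟫ = 0) :
    ‖∑ i ∈ s, v i‖ ^ 2 = ∑ i ∈ s, ‖v i‖ ^ 2 := by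
  rw [← real_inner_self_eq_norm_sq, sum_inner]
  refine Finset.sum_congr rfl fun i hi => ?_
  rw [inner_sum, Finset.sum_eq_single i (fun j hj hji => h i hi j hj hji.symm)
    (fun hi' => absurd hi hi'), real_inner_self_eq_norm_sq]

theorem norm_add_three_sq_le {E : Type*} [SeminormedAddCommGroup E] (a b c : E) :
    ‖a + b + c‖ ^ 2 ≤ 3 * (‖a‖ ^ 2 + ‖b‖ ^ 2 + ‖c‖ ^ 2) := by
  have := norm_sum_sq_le Finset.univ ![a, b, c]
  simpa [Fin.sum_univ_succ, add_assoc] using this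

theorem norm_add_four_sq_le {E : Type*} [SeminormedAddCommGroup E] (a b c d : E) :
    ‖a + b + c + d‖ ^ 2 ≤ 4 * (‖a‖ ^ 2 + ‖b‖ ^ 2 + ‖c‖ ^ 2 + ‖d‖ ^ 2) := by
  have := norm_sum_sq_le Finset.univ ![a, b, c, d]
  simpa [Fin.sum_univ_succ, add_assoc] using this

theorem inner_le_weighted (a b : H) {t : ℝ} (ht : 0 < t) :
    2 * ⟪a, b⟫ ≤ t * ‖a‖ ^ 2 + t⁻¹ * ‖b‖ ^ 2 := by
  have h1 := real_inner_le_norm a b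
  have h2 : 0 ≤ t⁻¹ * (t * ‖a‖ - ‖b‖) ^ 2 := by positivity
  have h3 : t⁻¹ * (t * ‖a‖ - ‖b‖) ^ 2 = t * ‖a‖ ^ 2 + t⁻¹ * ‖b‖ ^ 2 - 2 * (‖a‖ * ‖b‖) := by
    field_simp
    ring
  linarith

/-- One round of FedCOMGATE seen in the Hilbert space of square-integrable random vectors: from the
model `x` and the corrections `δ` to `x'` and `δ'`, with local models `W`, gradient noise `n` and
compression noise `k`. -/
structure Round (G : Fin m → H → H) (τ : ℕ) (η γ σ q K : ℝ) (xs x x' : H) (δ δ' : Fin m → H)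
    (W n : Fin m → ℕ → H) (k : Fin m → H) : Prop where
  init : ∀ j, W j 0 = x
  step : ∀ j c, W j (c + 1) = W j c - η • (G j (W j c) + n j c - δ j)
  model : x' = x - (η * γ) • mean fun j => η⁻¹ • (x - W j τ) + k j
  corr : ∀ j, δ' j = δ j + (τ : ℝ)⁻¹ • ((η⁻¹ • (x - W j τ) + k j) -
    mean fun j => η⁻¹ • (x - W j τ) + k j)
  mean_corr : mean δ = 0
  noise_le : ∀ j c, ‖n j c‖ ^ 2 ≤ σ ^ 2
  noise_orthogonal : ∀ j c j' c', (j, c) ≠ (j', c') → ⟪n j c, n j' c'⟫ = 0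
  noise_grad : ∀ j c, ⟪n j c, mean fun i => G i x⟫ = 0
  noise_dist : ∀ j c, ⟪n j c, x - xs⟫ = 0
  comp_grad : ∀ j, ⟪k j, mean fun i => G i x⟫ = 0
  comp_dist : ∀ j, ⟪k j, x - xs⟫ = 0
  comp_msg : ⟪mean k, mean fun j => η⁻¹ • (x - W j τ)⟫ = 0
  comp_mean_le : ‖mean k‖ ^ 2 ≤ q / m * ‖mean fun j => η⁻¹ • (x - W j τ)‖ ^ 2 + K
  comp_dev_le : mean (fun j => ‖k j - mean k‖ ^ 2) ≤ K

/-- The mean squared error of the corrections as estimates of the gradient dissimilarities. -/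
def trackErr (G : Fin m → H → H) (x : H) (δ : Fin m → H) : ℝ :=
  mean fun j => ‖G j x - mean (fun i => G i x) - δ j‖ ^ 2

theorem trackErr_nonneg (G : Fin m → H → H) (x : H) (δ : Fin m → H) : 0 ≤ trackErr G x δ :=
  mean_nonneg fun j => by positivity

namespace Round

variable {G : Fin m → H → H} {τ : ℕ} {η γ σ q K L : ℝ} {xs x x' : H} {δ δ' : Fin m → H}
  {W n : Fin m → ℕ → H} {k : Fin m → H}

/-- The correction is constant within a round, so the local recursion sums explicitly. Comparing
each gradient with the one at the start of the round isolates the drift. -/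
theorem local_sub (h : Round G τ η γ σ q K xs x x' δ δ' W n k) (j : Fin m) (c : ℕ) :
    x - W j c = η • ((c : ℝ) • (G j x - δ j) +
      ∑ i ∈ Finset.range c, (G j (W j i) - G j x) + ∑ i ∈ Finset.range c, n j i) := by
  induction c with
  | zero => simp [h.init]
  | succ c ih =>
    rw [h.step, Finset.sum_range_succ, Finset.sum_range_succ]
    have : x - (W j c - η • (G j (W j c) + n j c - δ j))
        = (x - W j c) + η • (G j (W j c) + n j c - δ j) := by abel
    rw [this, ih]
    push_cast
    module

theorem norm_noise_sum_sq_le (h : Round G τ η γ σ q K xs x x' δ δ' W n k) (j : Fin m) (c : ℕ) :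
    ‖∑ i ∈ Finset.range c, n j i‖ ^ 2 ≤ c * σ ^ 2 := by
  rw [norm_sum_sq_of_orthogonal]
  · calc _ ≤ ∑ i ∈ Finset.range c, σ ^ 2 := Finset.sum_le_sum fun i _ => h.noise_le j i
      _ = _ := by simp
  · intro i _ i' _ hne
    exact h.noise_orthogonal _ _ _ _ (by simpa using hne)

/-- Noise is orthogonal across clients as well as across steps. This gives the factor `1/m`, and
hence the linear speed-up in the number of clients. -/
theorem norm_mean_noise_sum_sq_le (h : Round G τ η γ σ q K xs x x' δ δ' W n k) (c : ℕ) :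
    ‖mean fun j => ∑ i ∈ Finset.range c, n j i‖ ^ 2 ≤ c * σ ^ 2 / m := by
  have h1 : ‖∑ p ∈ Finset.univ ×ˢ Finset.range c, n p.1 p.2‖ ^ 2 ≤ m * (c * σ ^ 2) := by
    rw [norm_sum_sq_of_orthogonal _ (fun p : Fin m × ℕ => n p.1 p.2)
      (fun p _ p' _ hne => h.noise_orthogonal _ _ _ _ hne)]
    calc _ ≤ ∑ p ∈ (Finset.univ : Finset (Fin m)) ×ˢ Finset.range c, σ ^ 2 :=
          Finset.sum_le_sum fun p _ => h.noise_le p.1 p.2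
      _ = _ := by simp [mul_assoc]
  rw [Finset.sum_product] at h1
  rw [mean, norm_smul, mul_pow]
  rcases Nat.eq_zero_or_pos m with hm | hm
  · subst hm; simp
  have hm' : (0 : ℝ) < m := by exact_mod_cast hm
  calc _ ≤ ‖(m : ℝ)⁻¹‖ ^ 2 * (m * (c * σ ^ 2)) := by gcongr
    _ = _ := by
      rw [norm_inv, Real.norm_natCast]
      field_simp

/-- A self-bounding estimate: Lipschitz continuity bounds each distance by the sum `S` of all of
them, and after summation `S` returns with coefficient `3 (η τ L)² ≤ 1/2`, which is absorbed on the
left. -/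
theorem sum_dist_sq_le (h : Round G τ η γ σ q K xs x x' δ δ' W n k)
    (hG : ∀ j y z, ‖G j y - G j z‖ ≤ L * ‖y - z‖) (hA : 6 * (η * τ * L) ^ 2 ≤ 1) (j : Fin m) :
    ∑ c ∈ Finset.range τ, ‖W j c - x‖ ^ 2
      ≤ 6 * η ^ 2 * (τ ^ 3 * ‖G j x - δ j‖ ^ 2 + τ ^ 2 * σ ^ 2) := by
  set S := ∑ c ∈ Finset.range τ, ‖W j c - x‖ ^ 2 with hS
  have hS0 : 0 ≤ S := Finset.sum_nonneg fun c _ => by positivity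
  have key : ∀ c ∈ Finset.range τ, ‖W j c - x‖ ^ 2
      ≤ 3 * η ^ 2 * (τ ^ 2 * ‖G j x - δ j‖ ^ 2 + τ * (L ^ 2 * S) + τ * σ ^ 2) := by
    intro c hc
    have hcτ : c ≤ τ := (Finset.mem_range.1 hc).le
    have hcτ' : (c : ℝ) ≤ τ := by exact_mod_cast hcτ
    have h2 : ‖∑ i ∈ Finset.range c, (G j (W j i) - G j x)‖ ^ 2 ≤ τ * (L ^ 2 * S) := by
      calc _ ≤ _ := norm_sum_sq_le _ _
        _ ≤ τ * ∑ i ∈ Finset.range τ, L ^ 2 * ‖W j i - x‖ ^ 2 := by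
          rw [Finset.card_range]
          gcongr
          calc _ ≤ ∑ i ∈ Finset.range τ, ‖G j (W j i) - G j x‖ ^ 2 :=
                Finset.sum_le_sum_of_subset_of_nonneg (Finset.range_mono hcτ)
                  fun _ _ _ => by positivity
            _ ≤ _ := Finset.sum_le_sum fun i _ => by
              rw [← mul_pow]
              have := hG j (W j i) x
              gcongr
        _ = _ := by rw [← Finset.mul_sum]
    have h3 := h.norm_noise_sum_sq_le j c
    rw [norm_sub_rev, h.local_sub, norm_smul, mul_pow, Real.norm_eq_abs, sq_abs]
    have h4 := norm_add_three_sq_le ((c : ℝ) • (G j x - δ j))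
      (∑ i ∈ Finset.range c, (G j (W j i) - G j x)) (∑ i ∈ Finset.range c, n j i)
    have h5 : ‖(c : ℝ) • (G j x - δ j)‖ ^ 2 ≤ τ ^ 2 * ‖G j x - δ j‖ ^ 2 := by
      rw [norm_smul, mul_pow, Real.norm_natCast]
      gcongr
    have h6 : (c : ℝ) * σ ^ 2 ≤ τ * σ ^ 2 := by gcongr
    calc _ ≤ η ^ 2 * (3 * (τ ^ 2 * ‖G j x - δ j‖ ^ 2 + τ * (L ^ 2 * S) + τ * σ ^ 2)) := by
          gcongr
          linarith
      _ = _ := by ring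
  have h7 := Finset.sum_le_sum key
  rw [← hS, Finset.sum_const, Finset.card_range, nsmul_eq_mul] at h7
  have h8 : 6 * (η * τ * L) ^ 2 * S ≤ 1 * S := by gcongr
  nlinarith

/-- The average over the local steps of the change of the local gradient since the round start. -/
def drift (G : Fin m → H → H) (τ : ℕ) (x : H) (W : Fin m → ℕ → H) (j : Fin m) : H :=
  (τ : ℝ)⁻¹ • ∑ c ∈ Finset.range τ, (G j (W j c) - G j x)

/-- The average over the local steps of the gradient noise of a client. -/
def noiseAvg (τ : ℕ) (n : Fin m → ℕ → H) (j : Fin m) : H :=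
  (τ : ℝ)⁻¹ • ∑ c ∈ Finset.range τ, n j c

theorem norm_drift_sq_le (h : Round G τ η γ σ q K xs x x' δ δ' W n k) (hτ : 0 < τ)
    (hG : ∀ j y z, ‖G j y - G j z‖ ≤ L * ‖y - z‖) (hA : 6 * (η * τ * L) ^ 2 ≤ 1) (j : Fin m) :
    ‖drift G τ x W j‖ ^ 2 ≤ 6 * (η * τ * L) ^ 2 * (‖G j x - δ j‖ ^ 2 + σ ^ 2 / τ) := by
  have hτ' : (0 : ℝ) < τ := by exact_mod_cast hτ
  have h1 := h.sum_dist_sq_le hG hA j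
  rw [drift, norm_smul, mul_pow, norm_inv, Real.norm_natCast]
  calc _ ≤ ((τ : ℝ)⁻¹) ^ 2 * (τ * (L ^ 2 * ∑ c ∈ Finset.range τ, ‖W j c - x‖ ^ 2)) := by
        gcongr
        calc _ ≤ _ := norm_sum_sq_le _ _
          _ ≤ _ := by
            rw [Finset.card_range, Finset.mul_sum _ _ (L ^ 2)]
            refine mul_le_mul_of_nonneg_left (Finset.sum_le_sum fun i _ => ?_) hτ'.le
            rw [← mul_pow]
            have := hG j (W j i) x
            gcongr
    _ ≤ ((τ : ℝ)⁻¹) ^ 2 * (τ * (L ^ 2 *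
          (6 * η ^ 2 * (τ ^ 3 * ‖G j x - δ j‖ ^ 2 + τ ^ 2 * σ ^ 2)))) := by gcongr
    _ = _ := by
      field_simp

/-- The corrections average to zero, so the vectors `G j x - δ j` have the global gradient as their
mean, and their deviations from it are exactly the tracking errors. -/
theorem mean_grad_sub_corr_sq (h : Round G τ η γ σ q K xs x x' δ δ' W n k) (hm : 0 < m) :
    mean (fun j => ‖G j x - δ j‖ ^ 2) = ‖mean fun i => G i x‖ ^ 2 + trackErr G x δ := by
  have h1 := mean_norm_sub_mean_sq hm (fun j => G j x - δ j)
  rw [mean_sub, h.mean_corr, sub_zero] at h1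
  have h2 : ∀ j, G j x - δ j - (mean fun i => G i x) = G j x - mean (fun i => G i x) - δ j :=
    fun j => by abel
  simp only [h2] at h1
  rw [trackErr]
  linarith

/-- A bound on the mean squared drift of the local gradients in a round. -/
def driftBound (τ : ℕ) (η σ L g T : ℝ) : ℝ := 6 * (η * τ * L) ^ 2 * (g + T + σ ^ 2 / τ)

theorem mean_drift_sq_le (h : Round G τ η γ σ q K xs x x' δ δ' W n k) (hm : 0 < m) (hτ : 0 < τ)
    (hG : ∀ j y z, ‖G j y - G j z‖ ≤ L * ‖y - z‖) (hA : 6 * (η * τ * L) ^ 2 ≤ 1) :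
    mean (fun j => ‖drift G τ x W j‖ ^ 2)
      ≤ driftBound τ η σ L (‖mean fun i => G i x‖ ^ 2) (trackErr G x δ) := by
  refine (mean_mono (h.norm_drift_sq_le hτ hG hA)).trans_eq ?_
  rw [mean_mul, mean_add, mean_const hm, h.mean_grad_sub_corr_sq hm, driftBound]

theorem msg_eq (h : Round G τ η γ σ q K xs x x' δ δ' W n k) (hτ : 0 < τ) (hη : η ≠ 0)
    (j : Fin m) :
    η⁻¹ • (x - W j τ) = (τ : ℝ) • (G j x - δ j + drift G τ x W j + noiseAvg τ n j) := by
  have hτ' : (τ : ℝ) ≠ 0 := by positivity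
  rw [h.local_sub, smul_smul, inv_mul_cancel₀ hη, one_smul, drift, noiseAvg]
  simp only [smul_add, smul_smul, mul_inv_cancel₀ hτ', one_smul]

theorem mean_msg_eq (h : Round G τ η γ σ q K xs x x' δ δ' W n k) (hτ : 0 < τ) (hη : η ≠ 0) :
    (mean fun j => η⁻¹ • (x - W j τ))
      = (τ : ℝ) • ((mean fun j => G j x) + mean (drift G τ x W) + mean (noiseAvg τ n)) := by
  simp only [h.msg_eq hτ hη]
  rw [mean_smul, mean_add, mean_add, mean_sub, h.mean_corr, sub_zero]

theorem norm_noiseAvg_sq_le (h : Round G τ η γ σ q K xs x x' δ δ' W n k) (hτ : 0 < τ)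
    (j : Fin m) : ‖noiseAvg τ n j‖ ^ 2 ≤ σ ^ 2 / τ := by
  have hτ' : (0 : ℝ) < τ := by exact_mod_cast hτ
  rw [noiseAvg, norm_smul, mul_pow, norm_inv, Real.norm_natCast]
  calc _ ≤ ((τ : ℝ)⁻¹) ^ 2 * (τ * σ ^ 2) := by
        gcongr
        exact h.norm_noise_sum_sq_le j τ
    _ = _ := by field_simp

theorem norm_mean_noiseAvg_sq_le (h : Round G τ η γ σ q K xs x x' δ δ' W n k) (hτ : 0 < τ) :
    ‖mean (noiseAvg τ n)‖ ^ 2 ≤ σ ^ 2 / (m * τ) := by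
  have hτ' : (0 : ℝ) < τ := by exact_mod_cast hτ
  have h1 := h.norm_mean_noise_sum_sq_le τ
  have h2 : mean (noiseAvg τ n) = (τ : ℝ)⁻¹ • mean fun j => ∑ i ∈ Finset.range τ, n j i :=
    mean_smul _ _
  rw [h2, norm_smul, mul_pow, norm_inv, Real.norm_natCast]
  calc _ ≤ ((τ : ℝ)⁻¹) ^ 2 * (τ * σ ^ 2 / m) := by gcongr
    _ = _ := by field_simp

theorem inner_mean_noiseAvg {y : H} (hy : ∀ j c, ⟪n j c, y⟫ = 0) :
    ⟪mean (noiseAvg τ n), y⟫ = 0 := by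
  have : ∀ j, ⟪noiseAvg τ n j, y⟫ = 0 := fun j => by
    simp [noiseAvg, real_inner_smul_left, sum_inner, hy]
  rw [inner_mean]
  simp [this, mean]

theorem inner_mean_comp {y : H} (hy : ∀ j, ⟪k j, y⟫ = 0) : ⟪mean k, y⟫ = 0 := by
  rw [inner_mean]
  simp [hy, mean]

/-- The displacement of the model in a round. -/
theorem model_eq (h : Round G τ η γ σ q K xs x x' δ δ' W n k) (hτ : 0 < τ) (hη : η ≠ 0) :
    x' = x - (η * γ * τ) • ((mean fun j => G j x) + mean (drift G τ x W) + mean (noiseAvg τ n)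
      + (τ : ℝ)⁻¹ • mean k) := by
  have hτ' : (τ : ℝ) ≠ 0 := by positivity
  rw [h.model, mean_add, h.mean_msg_eq hτ hη, smul_add _ _ ((τ : ℝ)⁻¹ • mean k), smul_smul,
    mul_assoc _ (τ : ℝ) (τ : ℝ)⁻¹, mul_inv_cancel₀ hτ', mul_one, mul_smul (η * γ), ← smul_add]

/-- The squared length of the averaged message, in units of local steps. -/
theorem norm_msg_sq_le (h : Round G τ η γ σ q K xs x x' δ δ' W n k) (hm : 0 < m) (hτ : 0 < τ)
    (hη : η ≠ 0) (hq : 0 ≤ q)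
    (hG : ∀ j y z, ‖G j y - G j z‖ ≤ L * ‖y - z‖) (hA : 6 * (η * τ * L) ^ 2 ≤ 1) :
    ‖(mean fun j => G j x) + mean (drift G τ x W) + mean (noiseAvg τ n) + (τ : ℝ)⁻¹ • mean k‖ ^ 2
      ≤ (1 + q / m) * (3 / 2 * (‖mean fun j => G j x‖ ^ 2 + σ ^ 2 / (m * τ))
        + 3 * driftBound τ η σ L (‖mean fun i => G i x‖ ^ 2) (trackErr G x δ)) + K / τ ^ 2 := by
  have hτ' : (0 : ℝ) < τ := by exact_mod_cast hτ
  set g := mean fun j => G j x with hg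
  set D := mean (drift G τ x W) with hD
  set N := mean (noiseAvg τ n) with hN
  have hD2 : ‖D‖ ^ 2 ≤ driftBound τ η σ L (‖g‖ ^ 2) (trackErr G x δ) :=
    (norm_mean_sq_le hm _).trans (h.mean_drift_sq_le hm hτ hG hA)
  have hN2 : ‖N‖ ^ 2 ≤ σ ^ 2 / (m * τ) := h.norm_mean_noiseAvg_sq_le hτ
  have hgN : ⟪g, N⟫ = 0 := by
    rw [real_inner_comm]
    exact inner_mean_noiseAvg h.noise_grad
  have hmsg := h.mean_msg_eq hτ hη
  -- The compression error is orthogonal to the uncompressed averaged message, so its variance is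
  -- simply added and produces the factor `1 + q / m`.
  have hk : ⟪mean k, g + D + N⟫ = 0 := by
    have := h.comp_msg
    rw [hmsg, real_inner_smul_right] at this
    exact (mul_eq_zero.1 this).resolve_left hτ'.ne'
  have hk2 : ‖(τ : ℝ)⁻¹ • mean k‖ ^ 2 ≤ q / m * ‖g + D + N‖ ^ 2 + K / τ ^ 2 := by
    have := h.comp_mean_le
    rw [hmsg, norm_smul, Real.norm_natCast] at this
    rw [norm_smul, mul_pow, norm_inv, Real.norm_natCast]
    calc _ ≤ ((τ : ℝ)⁻¹) ^ 2 * (q / m * (τ * ‖g + D + N‖) ^ 2 + K) := by gcongr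
      _ = _ := by field_simp
  -- The noise is orthogonal to `g` but not to the drift, which depends on it. Young's inequality
  -- with weight `1 / 2` separates `D` from `g + N` at the price of the factors `3 / 2` and `3`.
  have e1 : ‖g + D + N‖ ^ 2 ≤ 3 / 2 * (‖g‖ ^ 2 + ‖N‖ ^ 2) + 3 * ‖D‖ ^ 2 := by
    have e2 : g + D + N = (g + N) + D := by abel
    rw [e2, norm_add_sq_real, norm_add_sq_real g N, hgN]
    have e3 := inner_le_weighted (g + N) D (t := 1 / 2) (by norm_num)
    rw [norm_add_sq_real g N, hgN] at e3
    norm_num at e3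
    linarith
  rw [norm_add_sq_real, real_inner_smul_right, real_inner_comm, hk]
  have hqm : 0 ≤ q / m := by positivity
  have e4 : (1 + q / m) * ‖g + D + N‖ ^ 2
      ≤ (1 + q / m) * (3 / 2 * (‖g‖ ^ 2 + σ ^ 2 / (m * τ))
        + 3 * driftBound τ η σ L (‖g‖ ^ 2) (trackErr G x δ)) := by
    gcongr
    linarith
  linarith

section Conclusions

variable (h : Round G τ η γ σ q K xs x x' δ δ' W n k) (hm : 0 < m) (hτ : 0 < τ)
    (hη : η ≠ 0) (hq : 0 ≤ q) (hK : 0 ≤ K) (hL : 0 < L) (hs : 0 ≤ η * γ * τ)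
    (hLs : L * (η * γ * τ) * (1 + q / m) ≤ 3 / 5)
    (hG : ∀ j y z, ‖G j y - G j z‖ ≤ L * ‖y - z‖) (hA : 6 * (η * τ * L) ^ 2 ≤ 1)

include h hm hτ hη hq hK hL hs hLs hG hA

/-- Insert the displacement into the quadratic upper bound. Noise and compression error are
orthogonal to `g` and enter only at second order. Of the gain `s ‖g‖²`, the drift takes a quarter
and the second-order term takes `9 / 20`, because `L s (1 + q / m) ≤ 3 / 5`; the rest is `3 / 10`.
-/
theorem objective_le {f : H → ℝ}
    (hf : ∀ y z, f z ≤ f y + ⟪mean fun j => G j y, z - y⟫ + L / 2 * ‖z - y‖ ^ 2) :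
    f x' ≤ f x - 3 / 10 * (η * γ * τ) * ‖mean fun j => G j x‖ ^ 2
      + 2 * (η * γ * τ) * driftBound τ η σ L (‖mean fun i => G i x‖ ^ 2) (trackErr G x δ)
      + η * γ * τ * (σ ^ 2 / (m * τ) + K / τ ^ 2) := by
  have hX := h.norm_msg_sq_le hm hτ hη hq hG hA
  have hx := h.model_eq hτ hη
  have hD2 : ‖mean (drift G τ x W)‖ ^ 2
      ≤ driftBound τ η σ L (‖mean fun i => G i x‖ ^ 2) (trackErr G x δ) :=
    (norm_mean_sq_le hm _).trans (h.mean_drift_sq_le hm hτ hG hA)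
  have hgN := inner_mean_noiseAvg (τ := τ) h.noise_grad
  have hgk := inner_mean_comp h.comp_grad
  have hf' := hf x x'
  set s := η * γ * τ
  set g := mean fun j => G j x
  set D := mean (drift G τ x W)
  set N := mean (noiseAvg τ n)
  set P := driftBound τ η σ L (‖g‖ ^ 2) (trackErr G x δ)
  have hν : 0 ≤ σ ^ 2 / (m * τ) := by positivity
  have hk0 : 0 ≤ K / τ ^ 2 := by positivity
  have hP : 0 ≤ P := (sq_nonneg _).trans hD2
  have hLs' : L * s ≤ 3 / 5 := by
    have : 0 ≤ q / m := by positivity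
    nlinarith [mul_nonneg hL.le hs]
  have e1 : x' - x = -(s • (g + D + N + (τ : ℝ)⁻¹ • mean k)) := by rw [hx]; abel
  rw [e1, norm_neg, norm_smul, Real.norm_eq_abs, mul_pow, sq_abs, inner_neg_right,
    real_inner_smul_right, inner_add_right, inner_add_right, inner_add_right,
    real_inner_smul_right, real_inner_comm N, real_inner_comm (mean k), hgN, hgk,
    real_inner_self_eq_norm_sq] at hf'
  have e2 := inner_le_weighted g (-D) (t := 1 / 2) (by norm_num)
  rw [inner_neg_right, norm_neg] at e2
  norm_num at e2
  have e3 : L / 2 * (s ^ 2 * ‖g + D + N + (τ : ℝ)⁻¹ • mean k‖ ^ 2)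
      ≤ s * (9 / 20 * ‖g‖ ^ 2 + 9 / 20 * (σ ^ 2 / (m * τ)) + 9 / 10 * P
        + 3 / 10 * (K / τ ^ 2)) := by
    calc _ ≤ L / 2 * (s ^ 2 * ((1 + q / m) * (3 / 2 * (‖g‖ ^ 2 + σ ^ 2 / (m * τ))
          + 3 * P) + K / τ ^ 2)) := by gcongr
      _ = s / 2 * ((L * s * (1 + q / m)) * (3 / 2 * (‖g‖ ^ 2 + σ ^ 2 / (m * τ)) + 3 * P)
          + L * s * (K / τ ^ 2)) := by ring
      _ ≤ s / 2 * (3 / 5 * (3 / 2 * (‖g‖ ^ 2 + σ ^ 2 / (m * τ)) + 3 * P)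
          + 3 / 5 * (K / τ ^ 2)) := by gcongr
      _ = _ := by ring
  have e4 : s * -⟪g, D⟫ ≤ s * (1 / 4 * ‖g‖ ^ 2 + P) := by
    gcongr
    linarith
  nlinarith [mul_nonneg hs hP, mul_nonneg hs hν, mul_nonneg hs hk0]

/-- The mechanism of gradient tracking: a message contains `-δ j`, so updating the correction with
it replaces `δ j` by the dissimilarity at `x` plus averaging errors. The new tracking error is the
centred version of four terms: the change of the gradient from `x` to `x'`, the drift, the noise and
the compression deviation. The old error survives only inside the drift bound. -/
theorem trackErr_le :
    trackErr G x' δ' ≤ 4 * ‖mean fun j => G j x‖ ^ 2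
      + 12 * driftBound τ η σ L (‖mean fun i => G i x‖ ^ 2) (trackErr G x δ)
      + 8 * (σ ^ 2 / τ + K / τ ^ 2) := by
  have hτ' : (0 : ℝ) < τ := by exact_mod_cast hτ
  have hm' : (1 : ℝ) ≤ m := by exact_mod_cast hm
  have hX := h.norm_msg_sq_le hm hτ hη hq hG hA
  have hx := h.model_eq hτ hη
  have hDj := h.mean_drift_sq_le hm hτ hG hA
  have hNj := h.norm_noiseAvg_sq_le hτ
  set s := η * γ * τ
  set g := mean fun j => G j x with hg
  set D := mean (drift G τ x W) with hD
  set N := mean (noiseAvg τ n) with hN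
  set P := driftBound τ η σ L (‖g‖ ^ 2) (trackErr G x δ)
  have hν : 0 ≤ σ ^ 2 / (m * τ) := by positivity
  have hντ : σ ^ 2 / (m * τ) ≤ σ ^ 2 / τ := by
    gcongr
    nlinarith
  have hk0 : 0 ≤ K / τ ^ 2 := by positivity
  have hP : 0 ≤ P := (mean_nonneg fun j => by positivity).trans hDj
  have hLs' : L * s ≤ 3 / 5 := by
    have : 0 ≤ q / m := by positivity
    nlinarith [mul_nonneg hL.le hs]
  have hLs0 : 0 ≤ L * s := by positivity
  have e1 : x' - x = -(s • (g + D + N + (τ : ℝ)⁻¹ • mean k)) := by rw [hx]; abel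
  have e2 : L ^ 2 * ‖x' - x‖ ^ 2 ≤ 9 / 25 * (3 / 2 * (‖g‖ ^ 2 + σ ^ 2 / (m * τ)) + 3 * P)
      + 9 / 25 * (K / τ ^ 2) := by
    rw [e1, norm_neg, norm_smul, Real.norm_eq_abs, mul_pow, sq_abs]
    calc _ ≤ L ^ 2 * (s ^ 2 * ((1 + q / m) * (3 / 2 * (‖g‖ ^ 2 + σ ^ 2 / (m * τ))
          + 3 * P) + K / τ ^ 2)) := by gcongr
      _ = (L * s) * ((L * s * (1 + q / m)) * (3 / 2 * (‖g‖ ^ 2 + σ ^ 2 / (m * τ)) + 3 * P))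
          + (L * s) * (L * s) * (K / τ ^ 2) := by ring
      _ ≤ 3 / 5 * (3 / 5 * (3 / 2 * (‖g‖ ^ 2 + σ ^ 2 / (m * τ)) + 3 * P))
          + 3 / 5 * (3 / 5) * (K / τ ^ 2) := by gcongr
      _ = _ := by ring
  let a : Fin m → H := fun j => (G j x' - G j x) + (-drift G τ x W j) + (-noiseAvg τ n j)
    + (-((τ : ℝ)⁻¹ • (k j - mean k)))
  have hmk : mean (fun j => k j - mean k) = 0 := by
    rw [mean_sub, mean_const hm, sub_self]
  have ha : mean a = mean (fun j => G j x') - g - D - N := by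
    have : a = fun j => G j x' - G j x - drift G τ x W j - noiseAvg τ n j
        - (τ : ℝ)⁻¹ • (k j - mean k) := by
      funext j
      simp only [a]
      abel
    rw [this, mean_sub, mean_smul, hmk, mean_sub, mean_sub, mean_sub, smul_zero, sub_zero]
  -- Here `δ j` cancels. The remaining expression is a deviation from a mean, so centring can only
  -- decrease its mean square.
  have e3 : ∀ j, G j x' - mean (fun i => G i x') - δ' j = a j - mean a := by
    intro j
    rw [ha, h.corr, h.msg_eq hτ hη, mean_add, h.mean_msg_eq hτ hη]
    simp only [a, smul_sub, smul_add, smul_smul, inv_mul_cancel₀ hτ'.ne', one_smul, ← hg, ← hD,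
      ← hN]
    abel
  have e4 : trackErr G x' δ' ≤ mean fun j => ‖a j‖ ^ 2 := by
    simp only [trackErr, e3]
    exact mean_norm_sub_mean_sq_le hm a
  have e5 : ∀ j, ‖a j‖ ^ 2 ≤ 4 * (L ^ 2 * ‖x' - x‖ ^ 2 + ‖drift G τ x W j‖ ^ 2 + σ ^ 2 / τ
      + ((τ : ℝ)⁻¹) ^ 2 * ‖k j - mean k‖ ^ 2) := by
    intro j
    refine (norm_add_four_sq_le _ _ _ _).trans ?_
    rw [norm_neg, norm_neg, norm_neg, norm_smul, mul_pow, norm_inv, Real.norm_natCast, ← mul_pow L]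
    have h1 := hG j x' x
    have h2 := hNj j
    gcongr
  have e6 := e4.trans (mean_mono e5)
  rw [mean_mul, mean_add, mean_add, mean_add, mean_const hm, mean_const hm, mean_mul] at e6
  have e7 : ((τ : ℝ)⁻¹) ^ 2 * mean (fun j => ‖k j - mean k‖ ^ 2) ≤ K / τ ^ 2 := by
    calc _ ≤ ((τ : ℝ)⁻¹) ^ 2 * K := by
          gcongr
          exact h.comp_dev_le
      _ = _ := by field_simp
  linarith [sq_nonneg ‖g‖]

/-- Expanding the square leaves the cross term between the drift and `x - xs`, which has no
favourable sign. The Young weight `b` is left free: a large `b` keeps the growth factor `1 + s / b`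
close to one, at the price of a larger weight on the drift. -/
theorem dist_sq_le {b : ℝ} (hb : 0 < b) :
    ‖x' - xs‖ ^ 2 ≤ (1 + η * γ * τ / b) * ‖x - xs‖ ^ 2
      - 2 * (η * γ * τ) * ⟪mean fun j => G j x, x - xs⟫
      + η * γ * τ / L * (9 / 10 * ‖mean fun j => G j x‖ ^ 2)
      + η * γ * τ * (b + 2 / L)
        * driftBound τ η σ L (‖mean fun i => G i x‖ ^ 2) (trackErr G x δ)
      + η * γ * τ / L * (σ ^ 2 / (m * τ) + K / τ ^ 2) := by
  have hX := h.norm_msg_sq_le hm hτ hη hq hG hA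
  have hx := h.model_eq hτ hη
  have hD2 : ‖mean (drift G τ x W)‖ ^ 2
      ≤ driftBound τ η σ L (‖mean fun i => G i x‖ ^ 2) (trackErr G x δ) :=
    (norm_mean_sq_le hm _).trans (h.mean_drift_sq_le hm hτ hG hA)
  have hgN := inner_mean_noiseAvg (τ := τ) h.noise_dist
  have hgk := inner_mean_comp h.comp_dist
  set s := η * γ * τ
  set g := mean fun j => G j x
  set D := mean (drift G τ x W)
  set N := mean (noiseAvg τ n)
  set P := driftBound τ η σ L (‖g‖ ^ 2) (trackErr G x δ)
  have hν : 0 ≤ σ ^ 2 / (m * τ) := by positivity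
  have hk0 : 0 ≤ K / τ ^ 2 := by positivity
  have hP : 0 ≤ P := (sq_nonneg _).trans hD2
  have hLs' : L * s ≤ 3 / 5 := by
    have : 0 ≤ q / m := by positivity
    nlinarith [mul_nonneg hL.le hs]
  have e1 : x' - xs = (x - xs) - s • (g + D + N + (τ : ℝ)⁻¹ • mean k) := by rw [hx]; abel
  rw [e1, norm_sub_sq_real, norm_smul, Real.norm_eq_abs, mul_pow, sq_abs, real_inner_smul_right,
    real_inner_comm, inner_add_left, inner_add_left, inner_add_left, real_inner_smul_left,
    hgN, hgk]
  have e2 := inner_le_weighted (-D) (x - xs) hb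
  rw [inner_neg_left, norm_neg] at e2
  have e4 : s * (2 * -⟪D, x - xs⟫) ≤ s * (b * P + b⁻¹ * ‖x - xs‖ ^ 2) := by
    refine mul_le_mul_of_nonneg_left ?_ hs
    have : b * ‖D‖ ^ 2 ≤ b * P := by gcongr
    linarith
  have e3 : s ^ 2 * ‖g + D + N + (τ : ℝ)⁻¹ • mean k‖ ^ 2
      ≤ s / L * (9 / 10 * ‖g‖ ^ 2 + 9 / 10 * (σ ^ 2 / (m * τ)) + 9 / 5 * P
        + 3 / 5 * (K / τ ^ 2)) := by
    calc _ ≤ s ^ 2 * ((1 + q / m) * (3 / 2 * (‖g‖ ^ 2 + σ ^ 2 / (m * τ))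
          + 3 * P) + K / τ ^ 2) := by gcongr
      _ = s / L * ((L * s * (1 + q / m)) * (3 / 2 * (‖g‖ ^ 2 + σ ^ 2 / (m * τ)) + 3 * P)
          + L * s * (K / τ ^ 2)) := by
        field_simp
      _ ≤ s / L * (3 / 5 * (3 / 2 * (‖g‖ ^ 2 + σ ^ 2 / (m * τ)) + 3 * P)
          + 3 / 5 * (K / τ ^ 2)) := by gcongr
      _ = _ := by ring
  have hsL : 0 ≤ s / L := by positivity
  have e5 : s * (b + 2 / L) * P = s * (b * P) + 2 * (s / L * P) := by ring
  have e6 : s / b * ‖x - xs‖ ^ 2 = s * (b⁻¹ * ‖x - xs‖ ^ 2) := by ring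
  rw [e5, add_mul, e6]
  nlinarith [mul_nonneg hsL hP, mul_nonneg hsL hν, mul_nonneg hsL hk0]

end Conclusions

end Round

end Hilbert

/-! ### Scalar recursions -/

section Recursions

/-- One round of decrease of the potential `F + 8 A s T`. -/
theorem potential_step {F F' g T T' s A ν ζ k : ℝ} (hs : 0 ≤ s) (hg : 0 ≤ g) (hT : 0 ≤ T)
    (hA : 0 ≤ A) (hA' : A ≤ 1 / 1000) (hζ : 0 ≤ ζ) (hAζ : A * ζ ≤ ν / 1000) (hk : 0 ≤ k)
    (hF : F' ≤ F - 3 / 10 * s * g + 2 * s * (A * (g + T + ζ)) + s * (ν + k))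
    (hT' : T' ≤ 4 * g + 12 * (A * (g + T + ζ)) + 8 * (ζ + k)) :
    F' + 8 * A * s * T' ≤ F - s / 4 * g + 3 * A * s * T + 2 * s * (ν + k) := by
  have h1 : 8 * A * s * T' ≤ 8 * A * s * (4 * g + 12 * (A * (g + T + ζ)) + 8 * (ζ + k)) := by
    gcongr
  have h2 : A * g ≤ 1 / 1000 * g := by gcongr
  have h3 : A * k ≤ 1 / 1000 * k := by gcongr
  have h4 : 0 ≤ A * g := by positivity
  have h5 : 0 ≤ A * ζ := by positivity
  have h6 : 0 ≤ A * T := by positivity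
  have h7 : A * (A * g) ≤ 1 / 1000 * (A * g) := by gcongr
  have h8 : A * (A * ζ) ≤ 1 / 1000 * (A * ζ) := by gcongr
  have h9 : A * (A * T) ≤ 1 / 1000 * (A * T) := by gcongr
  have h10 : s * (-3 / 10 * g + 2 * (A * (g + T + ζ)) + (ν + k)
      + 8 * A * (4 * g + 12 * (A * (g + T + ζ)) + 8 * (ζ + k)))
      ≤ s * (-1 / 4 * g + 3 * A * T + 2 * (ν + k)) := by
    refine mul_le_mul_of_nonneg_left ?_ hs
    ring_nf at *
    linarith
  linarith

theorem sum_le_of_step {Φ g : ℕ → ℝ} {a p : ℝ} (hΦ : ∀ r, 0 ≤ Φ r)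
    (h : ∀ r, Φ (r + 1) ≤ Φ r - a * g r + p) (R : ℕ) :
    a * ∑ r ∈ Finset.range R, g r ≤ Φ 0 + R * p := by
  have key : ∀ R : ℕ, Φ R + a * ∑ r ∈ Finset.range R, g r ≤ Φ 0 + R * p := by
    intro R
    induction R with
    | zero => simp
    | succ R ih =>
      rw [Finset.sum_range_succ, mul_add]
      push_cast
      linarith [h R]
  linarith [key R, hΦ R]

theorem le_of_contraction {Φ : ℕ → ℝ} {x p : ℝ} (hx : 0 < x) (hx1 : x ≤ 1)
    (h : ∀ r, Φ (r + 1) ≤ (1 - x) * Φ r + p) (hp : 0 ≤ p) (R : ℕ) :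
    Φ R ≤ (1 - x) ^ R * Φ 0 + p / x := by
  induction R with
  | zero => simp; positivity
  | succ R ih =>
    calc Φ (R + 1) ≤ (1 - x) * Φ R + p := h R
      _ ≤ (1 - x) * ((1 - x) ^ R * Φ 0 + p / x) + p := by
        gcongr
      _ = _ := by
        field_simp
        ring

/-- Over at most `R` rounds the growth factors multiply to at most `exp (1 / 2)`, which is less than
`2` since `e < 4`. -/
theorem le_of_growth {Ψ : ℕ → ℝ} {x p : ℝ} (hx : 0 ≤ x) (hp : 0 ≤ p) (h0 : 0 ≤ Ψ 0)
    (h : ∀ r, Ψ (r + 1) ≤ (1 + x) * Ψ r + p) (R : ℕ) (hR : R * x ≤ 1 / 2) {r : ℕ} (hr : r ≤ R) :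
    Ψ r ≤ 2 * (Ψ 0 + R * p) := by
  have key : ∀ r : ℕ, Ψ r ≤ (1 + x) ^ r * (Ψ 0 + r * p) := by
    intro r
    induction r with
    | zero => simp
    | succ r ih =>
      have h1 : 1 ≤ (1 + x) ^ (r + 1) := one_le_pow₀ (by linarith)
      calc Ψ (r + 1) ≤ (1 + x) * Ψ r + p := h r
        _ ≤ (1 + x) * ((1 + x) ^ r * (Ψ 0 + r * p)) + (1 + x) ^ (r + 1) * p := by
          gcongr
          nlinarith
        _ = _ := by
          push_cast
          ring
  have h2 : (1 + x) ^ r ≤ 2 := by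
    calc (1 + x) ^ r ≤ (1 + x) ^ R := pow_le_pow_right₀ (by linarith) hr
      _ ≤ Real.exp x ^ R := by
        gcongr
        linarith [Real.add_one_le_exp x]
      _ = Real.exp (R * x) := by rw [← Real.exp_nat_mul]
      _ ≤ Real.exp (1 / 2) := by gcongr
      _ ≤ 2 := by
        have h3 : Real.exp (1 / 2) ^ 2 = Real.exp 1 := by
          rw [← Real.exp_nat_mul]
          norm_num
        have h4 := Real.exp_one_lt_d9
        nlinarith [Real.exp_pos (1 / 2)]
  have h5 : (r : ℝ) ≤ R := by exact_mod_cast hr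
  calc Ψ r ≤ (1 + x) ^ r * (Ψ 0 + r * p) := key r
    _ ≤ 2 * (Ψ 0 + R * p) := by gcongr

/-- While `a r > θ`, half of the quadratic decrease pays for `p`, and the other half gives `a (r +
1) ≤ a r - c (a r)²`, whose solutions decay like `1 / (c r)`. Once `a r ≤ θ`, a step adds at most `p
≤ θ`. Thus the alternative in `key` is invariant, and `R` is large enough for both branches to end
below `2 θ`. -/
theorem le_of_quadratic_step {a : ℕ → ℝ} {c p θ : ℝ} (hc : 0 < c) (ha : ∀ r, 0 ≤ a r)
    (hθ : 0 < θ) (hpθ : p ≤ θ) (hp : p ≤ c * θ ^ 2) {R : ℕ}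
    (h : ∀ r < R, a (r + 1) ≤ a r - 2 * c * a r ^ 2 + p) (hR : 1 ≤ 2 * θ * (c * R)) :
    a R ≤ 2 * θ := by
  have key : ∀ r ≤ R, a r ≤ 2 * θ ∨ a r * (c * r) ≤ 1 := by
    intro r
    induction r with
    | zero => intro _; right; simp
    | succ r ih =>
      intro hr
      have hs := h r (Nat.lt_of_succ_le hr)
      have hr0 : (0 : ℝ) ≤ r := by positivity
      have ha0 := ha r
      by_cases h1 : a r ≤ θ
      · left
        nlinarith [sq_nonneg (a r)]
      push Not at h1
      have h2 : a (r + 1) ≤ a r - c * a r ^ 2 := by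
        have : c * θ ^ 2 ≤ c * a r ^ 2 := by gcongr
        linarith
      rcases ih (by omega) with h3 | h3
      · left
        nlinarith [sq_nonneg (a r)]
      right
      push_cast
      set y := c * a r with hy
      have hy0 : 0 ≤ y := by positivity
      have h4 : y * r ≤ 1 := by linarith
      calc a (r + 1) * (c * (r + 1)) ≤ (a r - c * a r ^ 2) * (c * (r + 1)) := by gcongr
        _ = (y - y ^ 2) * (r + 1) := by rw [hy]; ring
        _ ≤ 1 := by
          by_cases h5 : y * (r + 1) ≤ 1
          · nlinarith [sq_nonneg y]
          -- Now `y (r + 1) > 1`, and the left side is `y r + y (1 - y (r + 1)) ≤ 1`.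
          · push Not at h5
            nlinarith
  rcases key R le_rfl with h1 | h1
  · exact h1
  · have hcR : 0 < c * R := by
      by_contra hcon
      push Not at hcon
      nlinarith
    by_contra hcon
    push Not at hcon
    nlinarith

/-- One round of near-decrease of the potential `V + 8 s a T`, where `a = A (b + 2 / L)`. -/
theorem dist_potential_step {V V' F g T T' s A a b L ν ζ k : ℝ} (hs : 0 ≤ s) (hL : 0 < L)
    (hF : 0 ≤ F) (hg : 0 ≤ g) (hgF : g ≤ 2 * L * F) (hT : 0 ≤ T)
    (hA' : A ≤ 1 / 1000) (ha : 0 ≤ a) (haL : a ≤ 1 / (1000 * L)) (hζ : 0 ≤ ζ) (hνζ : ν ≤ ζ)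
    (hk : 0 ≤ k) (hb : 0 < b)
    (hV : V' ≤ (1 + s / b) * V - 2 * s * F + s / L * (9 / 10 * g) + s * a * (g + T + ζ)
      + s / L * (ν + k))
    (hT' : T' ≤ 4 * g + 12 * (A * (g + T + ζ)) + 8 * (ζ + k)) :
    V' + 8 * s * a * T' ≤ (1 + s / b) * (V + 8 * s * a * T) + 2 * s / L * (ζ + k) := by
  have h1 : 8 * s * a * T' ≤ 8 * s * a * (4 * g + 12 * (1 / 1000 * (g + T + ζ)) + 8 * (ζ + k)) := by
    have : A * (g + T + ζ) ≤ 1 / 1000 * (g + T + ζ) := by gcongr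
    have : T' ≤ 4 * g + 12 * (1 / 1000 * (g + T + ζ)) + 8 * (ζ + k) := by linarith
    gcongr
  -- The gain `-2 s F` pays for all terms in `g`: by `g ≤ 2 L F` the second-order term costs `9/5 s
  -- F`, and the drift and tracking terms together cost less than `1/10 s F`.
  have h2 : s / L * (9 / 10 * g) ≤ s * (9 / 5 * F) := by
    calc _ ≤ s / L * (9 / 10 * (2 * L * F)) := by gcongr
      _ = _ := by
        field_simp
        ring
  have hsL : 0 ≤ s / L := by positivity
  have h3 : s * a * g ≤ 1 / 500 * (s * F) := by
    calc _ ≤ s * (1 / (1000 * L)) * (2 * L * F) := by gcongr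
      _ = _ := by
        field_simp
        ring
  have h4 : s * a * (ζ + k) ≤ 1 / 1000 * (s / L * (ζ + k)) := by
    calc _ ≤ s * (1 / (1000 * L)) * (ζ + k) := by gcongr
      _ = _ := by
        field_simp
  have h5 : 0 ≤ s * a * T := by positivity
  have h6 : 0 ≤ s * F := by positivity
  have h7 : 0 ≤ s * a * k := by positivity
  have h8 : 0 ≤ s / b * (s * a * T) := by positivity
  have h9 : s / L * (ν + k) ≤ s / L * (ζ + k) := by gcongr
  have h10 : 0 ≤ s / L * (ζ + k) := by positivity
  have h11 : 2 * s / L * (ζ + k) = 2 * (s / L * (ζ + k)) := by ring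
  rw [h11]
  ring_nf at *
  linarith

/-- One round of decrease in the convex case. -/
theorem quadratic_step {F F' g V T T' s A D L p : ℝ} (hs : 0 ≤ s) (hL : 0 < L) (hD : 0 < D)
    (hsL : L * s ≤ 3 / 5) (hg : 0 ≤ g) (hT : 0 ≤ T) (hA : 0 ≤ A)
    (hFV : F ^ 2 ≤ g * V) (hVD : V ≤ D) (hTD : 16 * s * A * T ≤ L * D)
    (h : F' + 8 * A * s * T' ≤ F - s / 4 * g + 3 * A * s * T + p) :
    F' + 8 * A * s * T' ≤ F + 8 * A * s * T - 2 * (s / (32 * D)) * (F + 8 * A * s * T) ^ 2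
      + p := by
  set t := 8 * A * s * T with ht
  have ht0 : 0 ≤ t := by positivity
  -- The square of the potential splits into `F²`, paid for by `g ≥ F² / D`, and `t²`. The latter is
  -- linear in `t` up to a constant because `s t ≤ (3/10) D`, and the drop of the tracking part from
  -- `t` to `(3/8) t` pays for it.
  have h1 : 2 * (s / (32 * D)) * (F + t) ^ 2 ≤ s / 4 * g + 5 / 8 * t := by
    have h2 : F ^ 2 / D ≤ g := by
      rw [div_le_iff₀ hD]
      exact hFV.trans (by gcongr)
    have h3 : t ≤ L * D / 2 := by rw [ht]; linarith
    have h4 : s * t ≤ 3 / 10 * D := by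
      calc s * t ≤ s * (L * D / 2) := by gcongr
        _ = L * s * D / 2 := by ring
        _ ≤ 3 / 5 * D / 2 := by gcongr
        _ = _ := by ring
    have h5 : s * t ^ 2 / D ≤ 3 / 10 * t := by
      rw [div_le_iff₀ hD]
      nlinarith
    calc 2 * (s / (32 * D)) * (F + t) ^ 2 ≤ 2 * (s / (32 * D)) * (2 * (F ^ 2 + t ^ 2)) := by
          gcongr
          nlinarith [sq_nonneg (F - t)]
      _ = s / 8 * (F ^ 2 / D) + 1 / 8 * (s * t ^ 2 / D) := by
        field_simp
        ring
      _ ≤ s / 8 * g + 1 / 8 * (3 / 10 * t) := by gcongr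
      _ ≤ _ := by nlinarith
  have h6 : 3 * A * s * T = 3 / 8 * t := by rw [ht]; ring
  linarith

end Recursions

/-! ### Guarantees for a sequence of rounds -/

section Runs

variable {H : Type*} [NormedAddCommGroup H] [InnerProductSpace ℝ H] {m : ℕ}

local notation "⟪" x "," y "⟫" => inner ℝ x y

variable {G : Fin m → H → H} {τ : ℕ} {η γ σ q K L : ℝ} {xs : H} {x : ℕ → H}
  {δ : ℕ → Fin m → H} {W n : ℕ → Fin m → ℕ → H} {k : ℕ → Fin m → H}
  (h : ∀ r, Round G τ η γ σ q K xs (x r) (x (r + 1)) (δ r) (δ (r + 1)) (W r) (n r) (k r))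
  (hm : 0 < m) (hτ : 0 < τ) (hη : 0 < η) (hγ : 0 < γ) (hq : 0 ≤ q) (hK : 0 ≤ K) (hL : 0 < L)
  (hLs : L * (η * γ * τ) * (1 + q / m) ≤ 3 / 5)
  (hG : ∀ j y z, ‖G j y - G j z‖ ≤ L * ‖y - z‖) (hA : 6 * (η * τ * L) ^ 2 ≤ 1 / (1000 * m))
  {f : H → ℝ} {fs : ℝ}
  (hf : ∀ y z, f z ≤ f y + ⟪mean fun j => G j y, z - y⟫ + L / 2 * ‖z - y‖ ^ 2)
  (hfs : ∀ y, fs ≤ f y)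

include hm hA in
theorem coeff_le : 6 * (η * τ * L) ^ 2 ≤ 1 / 1000 := by
  have hm' : (1 : ℝ) ≤ m := by exact_mod_cast hm
  refine hA.trans ?_
  gcongr
  linarith

include hL hq hLs hη hγ in
theorem step_le : L * (η * γ * τ) ≤ 3 / 5 := by
  have h1 : 0 ≤ q / m := by positivity
  have h2 : 0 ≤ L * (η * γ * τ) := by positivity
  nlinarith

include h hm hτ hη hγ hq hK hL hLs hG hA hf in
theorem potential_run_step (r : ℕ) :
    f (x (r + 1)) - fs
        + 8 * (6 * (η * τ * L) ^ 2) * (η * γ * τ) * trackErr G (x (r + 1)) (δ (r + 1))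
      ≤ f (x r) - fs - η * γ * τ / 4 * ‖mean fun j => G j (x r)‖ ^ 2
        + 3 * (6 * (η * τ * L) ^ 2) * (η * γ * τ) * trackErr G (x r) (δ r)
        + 2 * (η * γ * τ) * (σ ^ 2 / (m * τ) + K / τ ^ 2) := by
  have hA1 := coeff_le hm hA
  have hs : 0 ≤ η * γ * τ := by positivity
  have hm' : (0 : ℝ) < m := by exact_mod_cast hm
  have h1 := (h r).objective_le hm hτ hη.ne' hq hK hL hs hLs hG (hA1.trans (by norm_num)) hf
  have h2 := (h r).trackErr_le hm hτ hη.ne' hq hK hL hs hLs hG (hA1.trans (by norm_num))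
  rw [Round.driftBound] at h1 h2
  refine potential_step hs (by positivity) (trackErr_nonneg _ _ _) (by positivity) hA1
    (ζ := σ ^ 2 / τ) (by positivity) ?_ (by positivity) (by linarith) h2
  -- The tracking error sees the noise of single clients, `σ² / τ`, without the gain from averaging.
  -- The factor `1 / m` in `hA` restores it, so that heterogeneous noise does not spoil the
  -- speed-up.
  calc _ ≤ 1 / (1000 * m) * (σ ^ 2 / τ) := by gcongr
    _ = _ := by field_simp

include h hm hτ hη hγ hq hK hL hLs hG hA hf hfs in
theorem mean_grad_sq_le_of_run (hδ : δ 0 = 0) {R : ℕ} (hR : 0 < R) {B : ℝ}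
    (hB : trackErr G (x 0) 0 ≤ B) :
    1 / (R : ℝ) * ∑ r ∈ Finset.range R, ‖mean fun j => G j (x r)‖ ^ 2
      ≤ 4 * (f (x 0) - fs) / (η * γ * τ * R) + B / (10 * R)
        + 8 * (σ ^ 2 / (m * τ) + K / τ ^ 2) := by
  have hs : 0 < η * γ * τ := by positivity
  have hR' : (0 : ℝ) < R := by exact_mod_cast hR
  have hA1 := coeff_le hm hA
  have hT := fun r => trackErr_nonneg G (x r) (δ r)
  have h1 := sum_le_of_step (Φ := fun r => f (x r) - fs
      + 8 * (6 * (η * τ * L) ^ 2) * (η * γ * τ) * trackErr G (x r) (δ r))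
    (g := fun r => ‖mean fun j => G j (x r)‖ ^ 2) (a := η * γ * τ / 4)
    (p := 2 * (η * γ * τ) * (σ ^ 2 / (m * τ) + K / τ ^ 2))
    (fun r => by
      have := hfs (x r)
      have := hT r
      have : 0 ≤ f (x r) - fs := by linarith
      positivity)
    (fun r => by
      have h2 := potential_run_step h hm hτ hη hγ hq hK hL hLs hG hA (fs := fs) hf r
      have h3 : 0 ≤ 6 * (η * τ * L) ^ 2 * (η * γ * τ) * trackErr G (x r) (δ r) := by
        have := hT r
        positivity
      linarith) R
  simp only [hδ] at h1
  have hB0 : 0 ≤ B := (trackErr_nonneg _ _ _).trans hB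
  have h4 : 8 * (6 * (η * τ * L) ^ 2) * (η * γ * τ) * trackErr G (x 0) 0
      ≤ 8 * (1 / 1000) * (η * γ * τ) * B := by
    have := trackErr_nonneg G (x 0) 0
    gcongr
  generalize η * γ * τ = s at *
  generalize σ ^ 2 / (m * τ) + K / τ ^ 2 = p at *
  generalize ∑ r ∈ Finset.range R, ‖mean fun j => G j (x r)‖ ^ 2 = S at *
  have h5 : s / 4 * S ≤ f (x 0) - fs + s * B / 125 + R * (2 * s * p) := by linarith
  have h6 : 1 / (R : ℝ) * S = 4 / (s * R) * (s / 4 * S) := by field_simp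
  rw [h6]
  calc _ ≤ 4 / (s * R) * (f (x 0) - fs + s * B / 125 + R * (2 * s * p)) := by gcongr
    _ = 4 * (f (x 0) - fs) / (s * R) + 4 * B / (125 * R) + 8 * p := by
      field_simp
      ring
    _ ≤ _ := by
      have : 4 * B / (125 * R) ≤ B / (10 * R) := by
        rw [div_le_div_iff₀ (by positivity) (by positivity)]
        nlinarith [mul_nonneg hB0 hR'.le]
      linarith

include h hm hτ hη hγ hq hK hL hLs hG hA hf hfs in
theorem objective_le_of_run_PL (hδ : δ 0 = 0) {μ : ℝ} (hμ : 0 < μ) (hμL : μ ≤ L)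
    (hPL : ∀ y, μ * (f y - fs) ≤ 1 / 2 * ‖mean fun j => G j y‖ ^ 2) {B : ℝ}
    (hB : trackErr G (x 0) 0 ≤ B) (R : ℕ) :
    f (x R) - fs ≤ Real.exp (-(R * (η * γ * τ * μ / 2))) * (f (x 0) - fs + B / L)
      + 4 / μ * (σ ^ 2 / (m * τ) + K / τ ^ 2) := by
  have hs : 0 < η * γ * τ := by positivity
  have hA1 := coeff_le hm hA
  have hT := fun r => trackErr_nonneg G (x r) (δ r)
  have hLs' := step_le (m := m) hη hγ hq hL hLs
  have hsμ : η * γ * τ * μ ≤ 3 / 5 := by nlinarith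
  -- PL gives `(s / 4) ‖g‖² ≥ (s μ / 2) (f - fs)`, so the objective part contracts by `1 - s μ / 2`.
  -- The tracking part drops to `3/8` of itself, which is better since `s μ ≤ 3/5`.
  have h1 := le_of_contraction (Φ := fun r => f (x r) - fs
      + 8 * (6 * (η * τ * L) ^ 2) * (η * γ * τ) * trackErr G (x r) (δ r))
    (x := η * γ * τ * μ / 2) (p := 2 * (η * γ * τ) * (σ ^ 2 / (m * τ) + K / τ ^ 2))
    (by positivity) (by linarith)
    (fun r => by
      have h2 := potential_run_step h hm hτ hη hγ hq hK hL hLs hG hA (fs := fs) hf r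
      have h3 : 0 ≤ 6 * (η * τ * L) ^ 2 * (η * γ * τ) * trackErr G (x r) (δ r) := by
        have := hT r
        positivity
      have h4 : η * γ * τ * (μ * (f (x r) - fs))
          ≤ η * γ * τ * (1 / 2 * ‖mean fun j => G j (x r)‖ ^ 2) :=
        mul_le_mul_of_nonneg_left (hPL (x r)) hs.le
      have h5 : η * γ * τ * μ * (6 * (η * τ * L) ^ 2 * (η * γ * τ) * trackErr G (x r) (δ r))
          ≤ 3 / 5 * (6 * (η * τ * L) ^ 2 * (η * γ * τ) * trackErr G (x r) (δ r)) := by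
        gcongr
      linarith) (by positivity) R
  simp only [hδ] at h1
  have hB0 : 0 ≤ B := (trackErr_nonneg _ _ _).trans hB
  have h4 : 8 * (6 * (η * τ * L) ^ 2) * (η * γ * τ) * trackErr G (x 0) 0 ≤ B / L := by
    have := trackErr_nonneg G (x 0) 0
    calc _ ≤ 8 * (1 / 1000) * (η * γ * τ) * B := by gcongr
      _ = 8 * (1 / 1000) * (L * (η * γ * τ)) * B / L := by field_simp
      _ ≤ 8 * (1 / 1000) * (3 / 5) * B / L := by gcongr
      _ ≤ B / L := by
        gcongr
        linarith
  have h5 : (1 - η * γ * τ * μ / 2) ^ R ≤ Real.exp (-(R * (η * γ * τ * μ / 2))) := by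
    rw [← mul_neg, Real.exp_nat_mul]
    gcongr
    · linarith
    · linarith [Real.add_one_le_exp (-(η * γ * τ * μ / 2))]
  have h6 : 2 * (η * γ * τ) * (σ ^ 2 / (m * τ) + K / τ ^ 2) / (η * γ * τ * μ / 2)
      = 4 / μ * (σ ^ 2 / (m * τ) + K / τ ^ 2) := by
    field_simp
    ring
  rw [h6] at h1
  have h7 : 0 ≤ 8 * (6 * (η * τ * L) ^ 2) * (η * γ * τ) * trackErr G (x R) (δ R) := by
    have := hT R
    positivity
  have h8 : (1 - η * γ * τ * μ / 2) ^ R * (f (x 0) - fs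
      + 8 * (6 * (η * τ * L) ^ 2) * (η * γ * τ) * trackErr G (x 0) 0)
      ≤ Real.exp (-(R * (η * γ * τ * μ / 2))) * (f (x 0) - fs + B / L) := by
    have := hfs (x 0)
    have : 0 ≤ f (x 0) - fs := by linarith
    have := trackErr_nonneg G (x 0) 0
    gcongr
  linarith

-- Two potentials run in parallel. The distance potential has a large weight on the tracking error,
-- grows by at most `1 + s / b` per round plus noise, and so stays below `D`. This bound makes
-- `‖g‖²` at least `(f - fs)² / D`, and the objective potential then obeys the quadratic recursion.
include h hm hτ hη hγ hq hK hL hLs hG hA hf hfs in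
theorem objective_le_of_run_convex (hδ : δ 0 = 0)
    (hconv : ∀ y, f y - fs ≤ ⟪mean fun j => G j y, y - xs⟫)
    (hgrad : ∀ y, ‖mean fun j => G j y‖ ^ 2 ≤ 2 * L * (f y - fs))
    {B D θ b : ℝ}
    (hB : trackErr G (x 0) 0 ≤ B) (hb : 0 < b)
    (hbA : 6 * (η * τ * L) ^ 2 * (b + 2 / L) ≤ 1 / (1000 * L)) {R : ℕ}
    (hRb : R * (η * γ * τ / b) ≤ 1 / 2) (hD : 0 < D)
    (hD' : 2 * (‖x 0 - xs‖ ^ 2 + B / L ^ 2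
      + R * (2 * (η * γ * τ) / L * (σ ^ 2 / τ + K / τ ^ 2))) ≤ D)
    (hθ : 0 < θ) (hp : 2 * (η * γ * τ) * (σ ^ 2 / (m * τ) + K / τ ^ 2) ≤ θ)
    (hpD : 64 * D * (σ ^ 2 / (m * τ) + K / τ ^ 2) ≤ θ ^ 2) (hR : 16 * D ≤ θ * (η * γ * τ * R)) :
    f (x R) - fs ≤ 2 * θ := by
  have hs : 0 < η * γ * τ := by positivity
  have hA1 := coeff_le hm hA
  have hT := fun r => trackErr_nonneg G (x r) (δ r)
  have hF := fun r => sub_nonneg.2 (hfs (x r))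
  have hLs' := step_le (m := m) hη hγ hq hL hLs
  have hm' : (1 : ℝ) ≤ m := by exact_mod_cast hm
  have hB0 : 0 ≤ B := (trackErr_nonneg _ _ _).trans hB
  have hφ : ∀ r, f (x (r + 1)) - fs
        + 8 * (6 * (η * τ * L) ^ 2) * (η * γ * τ) * trackErr G (x (r + 1)) (δ (r + 1))
      ≤ _ :=
    potential_run_step h hm hτ hη hγ hq hK hL hLs hG hA (fs := fs) hf
  have hA0 : 0 ≤ 6 * (η * τ * L) ^ 2 := by positivity
  have hψ : ∀ r, ‖x (r + 1) - xs‖ ^ 2 + 8 * (η * γ * τ) * (6 * (η * τ * L) ^ 2 * (b + 2 / L))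
        * trackErr G (x (r + 1)) (δ (r + 1))
      ≤ (1 + η * γ * τ / b) * (‖x r - xs‖ ^ 2
        + 8 * (η * γ * τ) * (6 * (η * τ * L) ^ 2 * (b + 2 / L)) * trackErr G (x r) (δ r))
        + 2 * (η * γ * τ) / L * (σ ^ 2 / τ + K / τ ^ 2) := by
    intro r
    have h1 := (h r).dist_sq_le hm hτ hη.ne' hq hK hL hs.le hLs hG (hA1.trans (by norm_num)) hb
    have h2 := (h r).trackErr_le hm hτ hη.ne' hq hK hL hs.le hLs hG (hA1.trans (by norm_num))
    rw [Round.driftBound] at h1 h2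
    refine dist_potential_step hs.le hL (hF r) (by positivity) (hgrad (x r)) (hT r) hA1
      (by positivity) hbA (by positivity) (ν := σ ^ 2 / (m * τ)) ?_ (by positivity) hb ?_ h2
    · gcongr
      exact le_mul_of_one_le_left (by positivity) hm'
    · have h3 : 2 * (η * γ * τ) * (f (x r) - fs)
          ≤ 2 * (η * γ * τ) * ⟪mean fun j => G j (x r), x r - xs⟫ := by
        gcongr
        exact hconv (x r)
      linarith
  have hΨ : ∀ r ≤ R, ‖x r - xs‖ ^ 2
      + 8 * (η * γ * τ) * (6 * (η * τ * L) ^ 2 * (b + 2 / L)) * trackErr G (x r) (δ r) ≤ D := by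
    intro r hr
    have h0 : 0 ≤ ‖x 0 - xs‖ ^ 2
        + 8 * (η * γ * τ) * (6 * (η * τ * L) ^ 2 * (b + 2 / L)) * trackErr G (x 0) (δ 0) := by
      have := hT 0
      positivity
    refine (le_of_growth (Ψ := fun r => ‖x r - xs‖ ^ 2
      + 8 * (η * γ * τ) * (6 * (η * τ * L) ^ 2 * (b + 2 / L)) * trackErr G (x r) (δ r))
      (by positivity) (by positivity) h0 hψ R hRb hr).trans (le_trans ?_ hD')
    simp only [hδ]
    gcongr
    have := trackErr_nonneg G (x 0) 0
    calc _ ≤ 8 * (η * γ * τ) * (1 / (1000 * L)) * B := by gcongr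
      _ = 8 * (L * (η * γ * τ)) * (1 / 1000) * (B / L ^ 2) := by field_simp
      _ ≤ 8 * (3 / 5) * (1 / 1000) * (B / L ^ 2) := by gcongr
      _ ≤ B / L ^ 2 := by
        have : 0 ≤ B / L ^ 2 := by positivity
        linarith
  have h3 := le_of_quadratic_step (a := fun r => f (x r) - fs
      + 8 * (6 * (η * τ * L) ^ 2) * (η * γ * τ) * trackErr G (x r) (δ r))
    -- With this `c`, the hypothesis `hpD` says that the noise per round is at most `c θ²`, and `hR`
    -- says that `1 ≤ 2 θ c R`.
    (c := η * γ * τ / (32 * D)) (p := 2 * (η * γ * τ) * (σ ^ 2 / (m * τ) + K / τ ^ 2)) (θ := θ)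
    (by positivity)
    (fun r => by
      have := hT r
      have := hF r
      positivity) hθ hp
    (by
      rw [div_mul_eq_mul_div, le_div_iff₀ (by positivity)]
      calc _ = η * γ * τ * (64 * D * (σ ^ 2 / (m * τ) + K / τ ^ 2)) := by ring
        _ ≤ _ := by gcongr)
    (R := R)
    (fun r hr => by
      have hΨr := hΨ r hr.le
      have hTr := hT r
      refine quadratic_step hs.le hL hD hLs' (g := ‖mean fun j => G j (x r)‖ ^ 2)
        (V := ‖x r - xs‖ ^ 2) (by positivity) hTr hA0 ?_ ?_ ?_ (hφ r)
      · rw [← mul_pow]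
        have h4 := real_inner_le_norm (mean fun j => G j (x r)) (x r - xs)
        have h5 := hconv (x r)
        have := hF r
        gcongr
        linarith
      · have : 0 ≤ 8 * (η * γ * τ) * (6 * (η * τ * L) ^ 2 * (b + 2 / L))
          * trackErr G (x r) (δ r) := by positivity
        linarith
      -- The summand `2 / L` in the weight `b + 2 / L` suffices to extract the bound on the tracking
      -- error from the bound `D` on the distance potential.
      · have h6 : 16 * (η * γ * τ) * (6 * (η * τ * L) ^ 2) * trackErr G (x r) (δ r)
            = L * (8 * (η * γ * τ) * (6 * (η * τ * L) ^ 2 * (2 / L))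
              * trackErr G (x r) (δ r)) := by
          field_simp
          ring
        rw [h6]
        have h7 : 8 * (η * γ * τ) * (6 * (η * τ * L) ^ 2 * (2 / L)) * trackErr G (x r) (δ r)
            ≤ 8 * (η * γ * τ) * (6 * (η * τ * L) ^ 2 * (b + 2 / L))
              * trackErr G (x r) (δ r) := by
          gcongr
          linarith
        have h8 : 0 ≤ ‖x r - xs‖ ^ 2 := by positivity
        gcongr
        linarith)
    (by
      rw [div_mul_eq_mul_div, mul_div_assoc', le_div_iff₀ (by positivity)]
      linarith)
  have h9 : 0 ≤ 8 * (6 * (η * τ * L) ^ 2) * (η * γ * τ) * trackErr G (x R) (δ R) := by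
    have := hT R
    positivity
  linarith

end Runs

/-! ### Second moments as norms in `L²` -/

section SquareIntegrable

variable {Ω E : Type*} {mΩ : MeasurableSpace Ω} {P : Measure Ω} [NormedAddCommGroup E]

theorem eLpNorm_two_sq (f : Ω → E) : eLpNorm f 2 P ^ 2 = ∫⁻ ω, ‖f ω‖ₑ ^ 2 ∂P := by
  rw [eLpNorm_eq_lintegral_rpow_enorm_toReal two_ne_zero ENNReal.ofNat_ne_top,
    ← ENNReal.rpow_natCast,
    ← ENNReal.rpow_mul]
  simp

theorem memLp_two_of_lintegral_lt_top {f : Ω → E} (hf : AEStronglyMeasurable f P)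
    (h : ∫⁻ ω, ‖f ω‖ₑ ^ 2 ∂P < ∞) : MemLp f 2 P := by
  refine ⟨hf, ?_⟩
  rw [← eLpNorm_two_sq] at h
  by_contra hcon
  rw [not_lt, top_le_iff] at hcon
  simp [hcon] at h

theorem lintegral_enorm_sq_lt_top {f : Ω → E} (hf : MemLp f 2 P) :
    ∫⁻ ω, ‖f ω‖ₑ ^ 2 ∂P < ∞ := by
  rw [← eLpNorm_two_sq]
  exact ENNReal.pow_lt_top hf.2

theorem norm_toLp_sq_le {f : Ω → E} (hf : MemLp f 2 P) {C : ℝ} (hC : 0 ≤ C)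
    (h : ∫⁻ ω, ‖f ω‖ₑ ^ 2 ∂P ≤ ENNReal.ofReal C) : ‖hf.toLp f‖ ^ 2 ≤ C := by
  rw [Lp.norm_toLp, ← ENNReal.toReal_pow, eLpNorm_two_sq]
  exact ENNReal.toReal_le_of_le_ofReal hC h

theorem norm_toLp_sq {f : Ω → E} (hf : MemLp f 2 P) :
    ‖hf.toLp f‖ ^ 2 = ∫ ω, ‖f ω‖ ^ 2 ∂P := by
  have h1 : AEStronglyMeasurable (fun ω => ‖f ω‖ ^ 2) P := hf.1.norm.pow 2
  rw [Lp.norm_toLp, ← ENNReal.toReal_pow, eLpNorm_two_sq,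
    integral_eq_lintegral_of_nonneg_ae (Filter.Eventually.of_forall fun ω => by positivity) h1]
  congr 1
  refine lintegral_congr fun ω => ?_
  rw [ENNReal.ofReal_pow (norm_nonneg _), ofReal_norm]

theorem lintegral_enorm_sq_eq {f : Ω → E} (hf : MemLp f 2 P) :
    ∫⁻ ω, ‖f ω‖ₑ ^ 2 ∂P = ENNReal.ofReal (‖hf.toLp f‖ ^ 2) := by
  rw [Lp.norm_toLp, ← ENNReal.toReal_pow, eLpNorm_two_sq, ENNReal.ofReal_toReal]
  exact (lintegral_enorm_sq_lt_top hf).ne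

theorem toLp_sum {ι : Type*} (s : Finset ι) {f : ι → Ω → E} (hf : ∀ i, MemLp (f i) 2 P)
    (h : MemLp (fun ω => ∑ i ∈ s, f i ω) 2 P) :
    h.toLp _ = ∑ i ∈ s, (hf i).toLp (f i) := by
  ext1
  have h1 : ∀ᵐ ω ∂P, ∀ i ∈ s, ((hf i).toLp (f i) : Ω → E) ω = f i ω :=
    (Filter.eventually_all_finset s).2 fun i _ => (hf i).coeFn_toLp
  filter_upwards [h.coeFn_toLp, h1, Lp.coeFn_fun_finsetSum s fun i => (hf i).toLp (f i)]
    with ω e1 e2 e3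
  rw [e1, e3]
  exact (Finset.sum_congr rfl fun i hi => e2 i hi).symm

theorem inner_toLp [InnerProductSpace ℝ E] {f g : Ω → E} (hf : MemLp f 2 P) (hg : MemLp g 2 P) :
    inner ℝ (hf.toLp f) (hg.toLp g) = ∫ ω, inner ℝ (f ω) (g ω) ∂P := by
  rw [L2.inner_def]
  refine integral_congr_ae ?_
  filter_upwards [hf.coeFn_toLp, hg.coeFn_toLp] with ω h1 h2
  rw [h1, h2]

theorem integrable_inner_of_memLp [InnerProductSpace ℝ E] {f g : Ω → E} (hf : MemLp f 2 P)
    (hg : MemLp g 2 P) : Integrable (fun ω => inner ℝ (f ω) (g ω)) P := by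
  refine (L2.integrable_inner (𝕜 := ℝ) (hf.toLp f) (hg.toLp g)).congr ?_
  filter_upwards [hf.coeFn_toLp, hg.coeFn_toLp] with ω h1 h2
  rw [h1, h2]

theorem lintegral_enorm_sq_le_of_integral {f : Ω → E}
    (hf : Integrable (fun ω => ‖f ω‖ ^ 2) P) {C : ℝ} (h : ∫ ω, ‖f ω‖ ^ 2 ∂P ≤ C) :
    ∫⁻ ω, ‖f ω‖ₑ ^ 2 ∂P ≤ ENNReal.ofReal C := by
  calc ∫⁻ ω, ‖f ω‖ₑ ^ 2 ∂P = ∫⁻ ω, ENNReal.ofReal (‖f ω‖ ^ 2) ∂P := by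
        refine lintegral_congr fun ω => ?_
        rw [ENNReal.ofReal_pow (norm_nonneg _), ofReal_norm]
    _ = ENNReal.ofReal (∫ ω, ‖f ω‖ ^ 2 ∂P) :=
        (ofReal_integral_eq_lintegral_ofReal hf
          (Filter.Eventually.of_forall fun ω => by positivity)).symm
    _ ≤ _ := ENNReal.ofReal_le_ofReal h

end SquareIntegrable

/-! ### Fresh randomness: freezing the past -/

section Fresh

variable {Ω α β E : Type*} {𝓐 mΩ : MeasurableSpace Ω} {P : Measure Ω} [IsProbabilityMeasure P]
  [MeasurableSpace α] [MeasurableSpace β] {Z : Ω → β} {ν : Measure β}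

theorem map_prodMk_eq_of_indep (h𝓐 : 𝓐 ≤ mΩ) (hZ : Measurable Z) (hν : P.map Z = ν)
    (hind : Indep 𝓐 (MeasurableSpace.comap Z inferInstance) P) {X : Ω → α}
    (hX : Measurable[𝓐] X) : P.map (fun ω => (X ω, Z ω)) = (P.map X).prod ν := by
  have h1 : IndepFun X Z P := by
    rw [IndepFun_iff_Indep]
    exact indep_of_indep_of_le_left hind (measurable_iff_comap_le.1 hX)
  rw [← hν]
  exact (indepFun_iff_map_prod_eq_prod_map_map (hX.mono h𝓐 le_rfl).aemeasurable
    hZ.aemeasurable).1 h1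

/-- The joint law of past and fresh variable is a product, so Tonelli allows the past to be frozen.
Working with `∫⁻` transfers the variance bounds to random inputs before any integrability along the
run is known. -/
theorem lintegral_comp_of_indep (h𝓐 : 𝓐 ≤ mΩ) (hZ : Measurable Z) (hν : P.map Z = ν)
    (hind : Indep 𝓐 (MeasurableSpace.comap Z inferInstance) P) {X : Ω → α}
    (hX : Measurable[𝓐] X) {φ : α → β → ℝ≥0∞} (hφ : Measurable (Function.uncurry φ)) :
    ∫⁻ ω, φ (X ω) (Z ω) ∂P = ∫⁻ ω, ∫⁻ b, φ (X ω) b ∂ν ∂P := by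
  have hX' : Measurable X := hX.mono h𝓐 le_rfl
  have : IsProbabilityMeasure ν := hν ▸ Measure.isProbabilityMeasure_map hZ.aemeasurable
  have h1 := lintegral_map (μ := P) hφ (hX'.prodMk hZ)
  rw [map_prodMk_eq_of_indep h𝓐 hZ hν hind hX, lintegral_prod _ hφ.aemeasurable,
    lintegral_map hφ.lintegral_prod_right' hX'] at h1
  exact h1.symm

variable [NormedAddCommGroup E] [MeasurableSpace E] [BorelSpace E] [SecondCountableTopology E]
  [InnerProductSpace ℝ E] [CompleteSpace E]

/-- The source of every orthogonality relation. The pair `(X, Y)` is independent of `Z`, so by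
Fubini `Z` is integrated first with `X` and `Y` frozen, and that inner integral vanishes because `h
a` has mean zero. This replaces an argument with conditional expectations. -/
theorem inner_eq_zero_of_indep (h𝓐 : 𝓐 ≤ mΩ) (hZ : Measurable Z) (hν : P.map Z = ν)
    (hind : Indep 𝓐 (MeasurableSpace.comap Z inferInstance) P) {X : Ω → α}
    (hX : Measurable[𝓐] X) {h : α → β → E} (hh : Measurable (Function.uncurry h))
    (hint : ∀ a, Integrable (h a) ν) (hmean : ∀ a, ∫ b, h a b ∂ν = 0)
    {Y : Ω → E} (hY : Measurable[𝓐] Y) (hY2 : MemLp Y 2 P)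
    (hN : MemLp (fun ω => h (X ω) (Z ω)) 2 P) :
    inner ℝ (hN.toLp _) (hY2.toLp _) = 0 := by
  have hXY : Measurable[𝓐] fun ω => (X ω, Y ω) := hX.prodMk hY
  have hXY' : Measurable fun ω => (X ω, Y ω) := hXY.mono h𝓐 le_rfl
  have : IsProbabilityMeasure ν := hν ▸ Measure.isProbabilityMeasure_map hZ.aemeasurable
  have hmap := map_prodMk_eq_of_indep h𝓐 hZ hν hind hXY
  let φ : (α × E) × β → ℝ := fun p => inner ℝ (h p.1.1 p.2) p.1.2
  have hφ : Measurable φ :=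
    (hh.comp ((measurable_fst.comp measurable_fst).prodMk measurable_snd)).inner
      (measurable_snd.comp measurable_fst)
  have hint' : Integrable φ ((P.map fun ω => (X ω, Y ω)).prod ν) := by
    rw [← hmap, integrable_map_measure hφ.aestronglyMeasurable (hXY'.prodMk hZ).aemeasurable]
    exact integrable_inner_of_memLp hN hY2
  rw [inner_toLp]
  have h1 := integral_map (hXY'.prodMk hZ).aemeasurable (μ := P) (f := φ) hφ.aestronglyMeasurable
  rw [hmap, integral_prod _ hint'] at h1
  refine h1.symm.trans ?_
  have h2 : ∀ p : α × E, ∫ b, φ (p, b) ∂ν = 0 := fun p => by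
    have h3 := integral_inner (𝕜 := ℝ) (hint p.1) p.2
    simp only [φ]
    simp_rw [real_inner_comm p.2]
    rw [h3, hmean, inner_zero_right]
  simp [h2]

end Fresh

/-! ### The sources of randomness and their histories -/

section Independence

variable {d m : ℕ} {Ξ : Type u} {S : Type v} {Ω : Type w} [MeasurableSpace Ξ] [MeasurableSpace S]

/-- The sources of randomness: the samples, indexed by client, round and local step, and the
compressor seeds, indexed by client and round. -/
abbrev Source (m : ℕ) : Type := (Fin m × ℕ × ℕ) ⊕ (Fin m × ℕ)

/-- The σ-algebra generated by one source. -/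
abbrev sourceAlg (z : Fin m → ℕ → ℕ → Ω → Ξ) (s : Fin m → ℕ → Ω → S) :
    Source m → MeasurableSpace Ω
  | .inl a => MeasurableSpace.comap (z a.1 a.2.1 a.2.2) inferInstance
  | .inr b => MeasurableSpace.comap (s b.1 b.2) inferInstance

/-- The σ-algebra generated by a set of sources. -/
abbrev history (z : Fin m → ℕ → ℕ → Ω → Ξ) (s : Fin m → ℕ → Ω → S) (A : Set (Source m)) :
    MeasurableSpace Ω := ⨆ i ∈ A, sourceAlg z s i

variable {z : Fin m → ℕ → ℕ → Ω → Ξ} {s : Fin m → ℕ → Ω → S}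

theorem sourceAlg_le_history {A : Set (Source m)} {i : Source m} (hi : i ∈ A) :
    sourceAlg z s i ≤ history z s A := le_iSup₂_of_le i hi le_rfl

theorem measurable_sample_history {A : Set (Source m)} {j : Fin m} {r c : ℕ}
    (hi : .inl (j, r, c) ∈ A) : Measurable[history z s A] (z j r c) :=
  measurable_iff_comap_le.2 (sourceAlg_le_history hi)

theorem measurable_seed_history {A : Set (Source m)} {j : Fin m} {r : ℕ}
    (hi : .inr (j, r) ∈ A) : Measurable[history z s A] (s j r) :=
  measurable_iff_comap_le.2 (sourceAlg_le_history hi)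

variable [mΩ : MeasurableSpace Ω] {F : FedSetup d m Ξ S} {P : Measure Ω}

theorem sourceAlg_le (hS : F.Sampling P z s) (i : Source m) : sourceAlg z s i ≤ mΩ := by
  rcases i with a | b
  · exact (hS.measurable_sample _ _ _).comap_le
  · exact (hS.measurable_seed _ _).comap_le

theorem history_le (hS : F.Sampling P z s) (A : Set (Source m)) : history z s A ≤ mΩ :=
  iSup₂_le fun i _ => sourceAlg_le hS i

theorem comap_eval_le {Ω ι β : Type*} [MeasurableSpace β] (g : Ω → ι → β) (i : ι) :
    MeasurableSpace.comap (fun ω => g ω i) inferInstance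
      ≤ MeasurableSpace.comap g inferInstance := by
  have h : (fun ω => g ω i) = (fun h : ι → β => h i) ∘ g := rfl
  rw [h, ← MeasurableSpace.comap_comp]
  exact MeasurableSpace.comap_mono (measurable_pi_apply i).comap_le

/-- Independence among samples, among seeds, and between the two families merge into one: a finite
intersection of events splits into a sample part and a seed part, each measurable for its own
family. -/
theorem iIndep_sourceAlg (hS : F.Sampling P z s) : iIndep (sourceAlg z s) P := by
  rw [iIndep_iff]
  intro t f hf
  have h1 : ⋂ i ∈ t, f i = (⋂ a ∈ t.toLeft, f (.inl a)) ∩ ⋂ b ∈ t.toRight, f (.inr b) := by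
    ext ω
    simp [Sum.forall]
  have h2 : MeasurableSet[MeasurableSpace.comap
      (fun ω (i : Fin m × ℕ × ℕ) => z i.1 i.2.1 i.2.2 ω) inferInstance]
      (⋂ a ∈ t.toLeft, f (.inl a)) := by
    refine Finset.measurableSet_biInter _ fun a ha => ?_
    exact comap_eval_le (fun ω (i : Fin m × ℕ × ℕ) => z i.1 i.2.1 i.2.2 ω) a _
      (hf (.inl a) (Finset.mem_toLeft.1 ha))
  have h4 : MeasurableSet[MeasurableSpace.comap
      (fun ω (i : Fin m × ℕ) => s i.1 i.2 ω) inferInstance] (⋂ b ∈ t.toRight, f (.inr b)) := by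
    refine Finset.measurableSet_biInter _ fun b hb => ?_
    exact comap_eval_le (fun ω (i : Fin m × ℕ) => s i.1 i.2 ω) b _
      (hf (.inr b) (Finset.mem_toRight.1 hb))
  rw [h1, hS.indep_samples_seeds.meas_inter h2 h4,
    Finset.prod_sum_eq_prod_toLeft_mul_prod_toRight]
  congr 1
  · exact (iIndep_iff _ _).1 hS.indep_samples.iIndep _
      fun a ha => hf (.inl a) (Finset.mem_toLeft.1 ha)
  · exact (iIndep_iff _ _).1 hS.indep_seeds.iIndep _
      fun b hb => hf (.inr b) (Finset.mem_toRight.1 hb)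

theorem indep_history_source (hS : F.Sampling P z s) {A : Set (Source m)} {i : Source m}
    (hi : i ∉ A) : Indep (history z s A) (sourceAlg z s i) P := by
  have := indep_iSup_of_disjoint (sourceAlg_le hS) (iIndep_sourceAlg hS)
    (Set.disjoint_singleton_right.2 hi)
  simpa [history] using this

end Independence

/-! ### Smooth and convex functions -/

section SmoothFunctions

variable {E : Type*} [NormedAddCommGroup E] [InnerProductSpace ℝ E] [CompleteSpace E]
  {f : E → ℝ} {L : ℝ}

theorem hasDerivAt_line (hf : Differentiable ℝ f) (x v : E) (t : ℝ) :
    HasDerivAt (fun t : ℝ => f (x + t • v)) (inner ℝ (gradient f (x + t • v)) v) t := by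
  have h1 : HasDerivAt (fun t : ℝ => x + t • v) v t := by
    simpa using ((hasDerivAt_id t).smul_const v).const_add x
  have h2 := (hf (x + t • v)).hasFDerivAt.comp_hasDerivAt t h1
  rw [inner_gradient_left]
  exact h2

/-- Along the segment from `x` to `y`, the function minus its quadratic upper bound has nonpositive
derivative, by the Lipschitz bound and Cauchy–Schwarz. -/
theorem le_quadratic_of_lipschitz_gradient (hf : Differentiable ℝ f)
    (hL : ∀ x y, ‖gradient f x - gradient f y‖ ≤ L * ‖x - y‖) (x y : E) :
    f y ≤ f x + inner ℝ (gradient f x) (y - x) + L / 2 * ‖y - x‖ ^ 2 := by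
  set v := y - x with hv
  let φ : ℝ → ℝ := fun t => f (x + t • v) - t * inner ℝ (gradient f x) v - L / 2 * t ^ 2 * ‖v‖ ^ 2
  have hφ : ∀ t, HasDerivAt φ (inner ℝ (gradient f (x + t • v)) v - inner ℝ (gradient f x) v
      - L * t * ‖v‖ ^ 2) t := by
    intro t
    have h1 := ((hasDerivAt_line hf x v t).sub ((hasDerivAt_id t).mul_const
      (inner ℝ (gradient f x) v))).sub ((((hasDerivAt_id t).pow 2).const_mul (L / 2)).mul_const
      (‖v‖ ^ 2))
    refine h1.congr_deriv ?_
    simp only [id_eq, Nat.cast_ofNat, Nat.reduceSub, pow_one]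
    ring
  have hanti : AntitoneOn φ (Set.Icc 0 1) := by
    refine antitoneOn_of_deriv_nonpos (convex_Icc 0 1)
      (fun t _ => (hφ t).continuousAt.continuousWithinAt)
      (fun t _ => (hφ t).differentiableAt.differentiableWithinAt) fun t ht => ?_
    rw [interior_Icc] at ht
    rw [(hφ t).deriv, ← inner_sub_left]
    have h1 := real_inner_le_norm (gradient f (x + t • v) - gradient f x) v
    have h2 := hL (x + t • v) x
    rw [add_sub_cancel_left, norm_smul, Real.norm_of_nonneg ht.1.le] at h2
    nlinarith [norm_nonneg v, mul_le_mul_of_nonneg_right h2 (norm_nonneg v)]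
  have h1 := hanti (Set.left_mem_Icc.2 zero_le_one) (Set.right_mem_Icc.2 zero_le_one) zero_le_one
  simp only [φ, one_smul, zero_smul, add_zero, hv, add_sub_cancel] at h1
  linarith

/-- A gradient step of length `1 / L` decreases `f` by at least `‖∇f(x)‖² / (2 L)`, and it cannot go
below the lower bound `a`. -/
theorem norm_gradient_sq_le (hf : Differentiable ℝ f) (hL0 : 0 < L)
    (hL : ∀ x y, ‖gradient f x - gradient f y‖ ≤ L * ‖x - y‖) {a : ℝ} (ha : ∀ y, a ≤ f y) (x : E) :
    ‖gradient f x‖ ^ 2 ≤ 2 * L * (f x - a) := by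
  have h1 := le_quadratic_of_lipschitz_gradient hf hL x (x - L⁻¹ • gradient f x)
  have h2 := ha (x - L⁻¹ • gradient f x)
  rw [sub_sub_cancel_left, inner_neg_right, real_inner_smul_right, real_inner_self_eq_norm_sq,
    norm_neg, norm_smul, Real.norm_of_nonneg (by positivity), mul_pow] at h1
  have h3 : f x - a ≥ (2 * L)⁻¹ * ‖gradient f x‖ ^ 2 := by
    have : L / 2 * (L⁻¹ ^ 2 * ‖gradient f x‖ ^ 2) = (2 * L)⁻¹ * ‖gradient f x‖ ^ 2 := by
      field_simp
    have h5 : L⁻¹ * ‖gradient f x‖ ^ 2 = 2 * ((2 * L)⁻¹ * ‖gradient f x‖ ^ 2) := by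
      field_simp
    linarith
  calc ‖gradient f x‖ ^ 2 = 2 * L * ((2 * L)⁻¹ * ‖gradient f x‖ ^ 2) := by field_simp
    _ ≤ _ := by gcongr

theorem gradient_eq_zero_of_isMinOn {a : E} (ha : IsMinOn f Set.univ a) : gradient f a = 0 := by
  have : IsLocalMin f a := ha.isLocalMin Filter.univ_mem
  simp [gradient, this.fderiv_eq_zero]

theorem ConvexOn.inner_gradient_le (hf : Differentiable ℝ f) (hc : ConvexOn ℝ Set.univ f)
    (x y : E) : f x - f y ≤ inner ℝ (gradient f x) (x - y) := by
  have h1 : ConvexOn ℝ Set.univ fun t : ℝ => f (x + t • (y - x)) := by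
    have h2 := hc.comp_affineMap (AffineMap.lineMap x y)
    rw [Set.preimage_univ] at h2
    have h3 : (fun t : ℝ => f (x + t • (y - x))) = f ∘ AffineMap.lineMap x y := by
      funext t
      simp [AffineMap.lineMap_apply, add_comm]
    rw [h3]
    exact h2
  have h3 := h1.le_slope_of_hasDerivAt (Set.mem_univ 0) (Set.mem_univ 1) zero_lt_one
    (hasDerivAt_line hf x (y - x) 0)
  simp only [slope, zero_smul, add_zero, one_smul, add_sub_cancel, sub_zero, inv_one, vsub_eq_sub]
    at h3
  rw [← neg_sub y x, inner_neg_right]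
  linarith

end SmoothFunctions

/-! ### The global objective and the compressor -/

section Setup

variable {d m : ℕ} {Ξ : Type u} {S : Type v} [MeasurableSpace Ξ] [MeasurableSpace S]
  {F : FedSetup d m Ξ S} {L σ q Gq : ℝ}

theorem hasGradientAt_globalLoss (hF : F.Smooth L) (x : Vec d) :
    HasGradientAt F.globalLoss (mean fun j => gradient (F.loss j) x) x := by
  have h1 : ∀ j, HasFDerivAt (F.loss j) (fderiv ℝ (F.loss j) x) x :=
    fun j => ((hF j).1 x).hasFDerivAt
  have h2 := (HasFDerivAt.fun_sum (u := Finset.univ) fun j _ => h1 j).const_mul (m : ℝ)⁻¹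
  have h3 : InnerProductSpace.toDual ℝ (Vec d) (mean fun j => gradient (F.loss j) x)
      = (m : ℝ)⁻¹ • ∑ j, fderiv ℝ (F.loss j) x := by
    ext v
    simp [mean, gradient]
  rw [hasGradientAt_iff_hasFDerivAt, h3]
  exact h2

theorem gradient_globalLoss (hF : F.Smooth L) (x : Vec d) :
    gradient F.globalLoss x = mean fun j => gradient (F.loss j) x :=
  (hasGradientAt_globalLoss hF x).gradient

theorem differentiable_globalLoss (hF : F.Smooth L) : Differentiable ℝ F.globalLoss :=
  fun x => (hasGradientAt_globalLoss hF x).differentiableAt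

theorem norm_gradient_globalLoss_sub_le (hF : F.Smooth L) (hm : 0 < m) (x y : Vec d) :
    ‖gradient F.globalLoss x - gradient F.globalLoss y‖ ≤ L * ‖x - y‖ := by
  have hm' : (0 : ℝ) < m := by exact_mod_cast hm
  rw [gradient_globalLoss hF, gradient_globalLoss hF, ← mean_sub, mean, norm_smul, norm_inv,
    Real.norm_natCast, inv_mul_le_iff₀ hm']
  calc _ ≤ ∑ j : Fin m, ‖gradient (F.loss j) x - gradient (F.loss j) y‖ := norm_sum_le _ _
    _ ≤ ∑ j : Fin m, L * ‖x - y‖ := Finset.sum_le_sum fun j _ => (hF j).2 x y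
    _ = _ := by simp

theorem continuous_gradient_loss (hF : F.Smooth L) (j : Fin m) :
    Continuous (gradient (F.loss j)) := by
  have : LipschitzWith L.toNNReal (gradient (F.loss j)) :=
    LipschitzWith.of_dist_le_mul fun x y => by
      rw [dist_eq_norm, dist_eq_norm]
      refine ((hF j).2 x y).trans ?_
      gcongr
      exact Real.le_coe_toNNReal L
  exact this.continuous

theorem comp_zero_ae (hQ : F.UnbiasedCompressor q) : ∀ᵐ s ∂F.compLaw, F.comp 0 s = 0 := by
  have h1 := hQ.variance_le 0
  have h2 := hQ.sq_integrable 0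
  simp only [sub_zero, norm_zero, ne_eq, OfNat.ofNat_ne_zero, not_false_eq_true, zero_pow,
    mul_zero] at h1 h2
  have h3 := (integral_eq_zero_iff_of_nonneg (fun s => by positivity) h2).1
    (le_antisymm h1 (integral_nonneg fun s => by positivity))
  filter_upwards [h3] with s hs
  simpa using hs

/-- The second moment of an average of compressed vectors that sum to zero, compressed with
independent seeds. -/
theorem integral_norm_mean_comp_sq (hQ : F.UnbiasedCompressor q) (x : Fin m → Vec d)
    (hx : ∑ j, x j = 0) :
    ∫ s : Fin m → S, ‖(m : ℝ)⁻¹ • ∑ j, F.comp (x j) (s j)‖ ^ 2 ∂(Measure.pi fun _ => F.compLaw)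
      = ((m : ℝ)⁻¹) ^ 2 * ∑ j, ∫ s, ‖F.comp (x j) s - x j‖ ^ 2 ∂F.compLaw := by
  have := hQ.prob
  set P := Measure.pi fun _ : Fin m => F.compLaw with hP
  have hmp : ∀ j, MeasurePreserving (fun s : Fin m → S => s j) P F.compLaw :=
    fun j => measurePreserving_eval _ j
  have hcm : ∀ y : Vec d, Measurable fun s => F.comp y s - y := fun y =>
    (hQ.measurable.comp measurable_prodMk_left).sub_const y
  have h2 : ∀ y : Vec d, MemLp (fun s => F.comp y s - y) 2 F.compLaw := fun y =>
    (memLp_two_iff_integrable_sq_norm (hcm y).aestronglyMeasurable).2 (hQ.sq_integrable y)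
  have h3 : ∀ j, MemLp (fun s : Fin m → S => F.comp (x j) (s j) - x j) 2 P :=
    fun j => (h2 (x j)).comp_measurePreserving (hmp j)
  have h4 : ∀ i j, i ≠ j → inner ℝ ((h3 i).toLp _) ((h3 j).toLp _) = 0 := by
    intro i j hij
    have hind : Indep (MeasurableSpace.comap (fun s : Fin m → S => s j) inferInstance)
        (MeasurableSpace.comap (fun s : Fin m → S => s i) inferInstance) P := by
      have := iIndepFun_pi (μ := fun _ : Fin m => F.compLaw) (X := fun _ s => s)
        (fun _ => aemeasurable_id)
      exact this.indepFun hij.symm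
    exact inner_eq_zero_of_indep (α := Unit) (X := fun _ => ())
      (h := fun _ s => F.comp (x i) s - x i)
      (measurable_pi_apply j).comap_le (measurable_pi_apply i) (hmp i).map_eq hind
      measurable_const ((hcm (x i)).comp measurable_snd)
      (fun _ => (hQ.integrable (x i)).sub (integrable_const _))
      (fun _ => by
        rw [integral_sub (hQ.integrable (x i)) (integrable_const _), hQ.unbiased]
        simp)
      ((hcm (x j)).comp (comap_measurable _)) (h3 j) (h3 i)
  have h5 : ∀ s : Fin m → S, ∑ j, F.comp (x j) (s j) = ∑ j, (F.comp (x j) (s j) - x j) := by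
    intro s
    rw [Finset.sum_sub_distrib, hx, sub_zero]
  have h6 : MemLp (fun s : Fin m → S => ∑ j, (F.comp (x j) (s j) - x j)) 2 P :=
    memLp_finsetSum _ fun j _ => h3 j
  have h8 : ∀ s : Fin m → S, ‖(m : ℝ)⁻¹ • ∑ j, F.comp (x j) (s j)‖ ^ 2
      = ((m : ℝ)⁻¹) ^ 2 * ‖∑ j, (F.comp (x j) (s j) - x j)‖ ^ 2 := by
    intro s
    rw [h5, norm_smul, mul_pow, norm_inv, Real.norm_natCast]
  simp only [h8]
  rw [integral_const_mul, ← norm_toLp_sq h6, toLp_sum _ h3 h6,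
    norm_sum_sq_of_orthogonal _ _ (fun i _ j _ hij => h4 i j hij)]
  congr 1
  refine Finset.sum_congr rfl fun j _ => ?_
  rw [norm_toLp_sq, ← (hmp j).map_eq, integral_map (measurable_pi_apply j).aemeasurable]
  exact ((hcm (x j)).norm.pow_const 2).aestronglyMeasurable

/-- With at least two clients, a bounded compression gap bounds the variance of the compressor. -/
theorem comp_variance_le_gap (hQ : F.UnbiasedCompressor q) (hG : F.CompressionGap Gq) (hm : 2 ≤ m)
    (y : Vec d) : ∫ s, ‖F.comp y s - y‖ ^ 2 ∂F.compLaw ≤ m ^ 2 * Gq := by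
  have hm' : (0 : ℝ) < m := by
    have : 0 < m := by omega
    exact_mod_cast this
  let i : Fin m := ⟨0, by omega⟩
  let i' : Fin m := ⟨1, by omega⟩
  have hne : i ≠ i' := by simp [i, i']
  -- Two clients send `y` and `-y`, all others send `0`. The average of the inputs vanishes, and
  -- `Q(0) = 0` almost surely, so nothing is subtracted in the gap: it bounds a sum of variances,
  -- one of which is that of `Q(y)`.
  let x : Fin m → Vec d := Pi.single i y + Pi.single i' (-y)
  have hx : ∑ j, x j = 0 := by simp [x, Finset.sum_add_distrib]
  have h1 := hG x
  rw [integral_norm_mean_comp_sq hQ x hx, hx, smul_zero] at h1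
  have h2 : ∫ s, ‖F.comp 0 s‖ ^ 2 ∂F.compLaw = 0 := by
    rw [integral_eq_zero_of_ae]
    filter_upwards [comp_zero_ae hQ] with s hs
    simp [hs]
  have h3 : ∫ s, ‖F.comp y s - y‖ ^ 2 ∂F.compLaw
      ≤ ∑ j, ∫ s, ‖F.comp (x j) s - x j‖ ^ 2 ∂F.compLaw := by
    have h4 := Finset.single_le_sum
      (f := fun j => ∫ s, ‖F.comp (x j) s - x j‖ ^ 2 ∂F.compLaw)
      (fun j _ => integral_nonneg fun s => by positivity) (Finset.mem_univ i)
    simpa [x, hne] using h4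
  rw [h2, sub_zero, inv_pow, inv_mul_le_iff₀ (by positivity)] at h1
  exact h3.trans h1

theorem gap_nonneg (hQ : F.UnbiasedCompressor q) (hG : F.CompressionGap Gq) :
    0 ≤ Gq := by
  have h1 := hG 0
  have h2 : ∫ s, ‖F.comp 0 s‖ ^ 2 ∂F.compLaw = 0 := by
    rw [integral_eq_zero_of_ae]
    filter_upwards [comp_zero_ae hQ] with s hs
    simp [hs]
  simp only [Pi.zero_apply, Finset.sum_const_zero, smul_zero, h2, sub_zero] at h1
  exact (integral_nonneg fun s => by positivity).trans h1

end Setup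

/-! ### Lipschitz maps acting on random vectors -/

section Superposition

variable {Ω : Type*} {mΩ : MeasurableSpace Ω} {P : Measure Ω}
  {E : Type*} [NormedAddCommGroup E] {g : E → E} {L : ℝ}

theorem mean_toLp [NormedSpace ℝ E] {m : ℕ} {f : Fin m → Ω → E} (hf : ∀ j, MemLp (f j) 2 P)
    (h : MemLp (fun ω => mean fun j => f j ω) 2 P) :
    (mean fun j => (hf j).toLp (f j)) = h.toLp _ := by
  have h1 : MemLp (fun ω => ∑ j, f j ω) 2 P := memLp_finsetSum _ fun j _ => hf j
  rw [mean, ← toLp_sum Finset.univ hf h1, ← MemLp.toLp_const_smul]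
  rfl

theorem memLp_mean [NormedSpace ℝ E] {m : ℕ} {f : Fin m → Ω → E} (hf : ∀ j, MemLp (f j) 2 P) :
    MemLp (fun ω => mean fun j => f j ω) 2 P :=
  (memLp_finsetSum _ fun j _ => hf j).const_smul _

variable [IsProbabilityMeasure P]

theorem memLp_comp_of_lipschitz (hg : ∀ x y, ‖g x - g y‖ ≤ L * ‖x - y‖) {f : Ω → E}
    (hf : MemLp f 2 P) : MemLp (fun ω => g (f ω)) 2 P := by
  have h1 : LipschitzWith L.toNNReal fun x => g x - g 0 :=
    LipschitzWith.of_dist_le_mul fun x y => by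
      rw [dist_eq_norm, dist_eq_norm, sub_sub_sub_cancel_right]
      refine (hg x y).trans ?_
      gcongr
      exact Real.le_coe_toNNReal L
  have h2 := (h1.comp_memLp (by simp) hf).add (memLp_const (g 0))
  exact h2.ae_eq (Filter.Eventually.of_forall fun ω => by simp)

/-- The superposition operator on square-integrable random vectors induced by a Lipschitz map. -/
def superpose (hg : ∀ x y, ‖g x - g y‖ ≤ L * ‖x - y‖) (X : Lp E 2 P) : Lp E 2 P :=
  (memLp_comp_of_lipschitz hg (Lp.memLp X)).toLp _

theorem superpose_toLp (hg : ∀ x y, ‖g x - g y‖ ≤ L * ‖x - y‖) {f : Ω → E} (hf : MemLp f 2 P) :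
    superpose hg (hf.toLp f) = (memLp_comp_of_lipschitz hg hf).toLp _ := by
  refine MemLp.toLp_congr _ _ ?_
  filter_upwards [hf.coeFn_toLp] with ω h
  rw [h]

theorem norm_superpose_sub_le (hg : ∀ x y, ‖g x - g y‖ ≤ L * ‖x - y‖) (X Y : Lp E 2 P) :
    ‖superpose hg X - superpose hg Y‖ ≤ L * ‖X - Y‖ := by
  refine Lp.norm_le_mul_norm_of_ae_le_mul ?_
  filter_upwards [(memLp_comp_of_lipschitz hg (Lp.memLp X)).coeFn_toLp,
    (memLp_comp_of_lipschitz hg (Lp.memLp Y)).coeFn_toLp,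
    Lp.coeFn_sub (superpose hg X) (superpose hg Y), Lp.coeFn_sub X Y] with ω h1 h2 h3 h4
  rw [h3, h4, Pi.sub_apply, Pi.sub_apply, superpose, superpose, h1, h2]
  exact hg _ _

end Superposition

/-! ### The random trajectory and its measurability -/

section Trajectories

variable {d m : ℕ} {Ξ : Type u} {S : Type v} {Ω : Type w} [MeasurableSpace Ξ] [MeasurableSpace S]
  (F : FedSetup d m Ξ S) (τ : ℕ) (η γ : ℝ) (x₀ : Vec d) (z : Fin m → ℕ → ℕ → Ω → Ξ)
  (s : Fin m → ℕ → Ω → S)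

/-- The random global model and corrections after `r` rounds. -/
def traj (r : ℕ) (ω : Ω) : Vec d × (Fin m → Vec d) :=
  F.fedcomgate τ η γ x₀ (fun j k c => z j k c ω) (fun j k => s j k ω) r

/-- The random local models of round `r`. -/
def localTraj (r : ℕ) (j : Fin m) (c : ℕ) (ω : Ω) : Vec d :=
  F.localModel η j (traj F τ η γ x₀ z s r ω).1 ((traj F τ η γ x₀ z s r ω).2 j)
    (fun c => z j r c ω) c

/-- The error of a stochastic gradient drawn in round `r`. -/
def gradNoise (r : ℕ) (j : Fin m) (c : ℕ) (ω : Ω) : Vec d :=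
  F.stochGrad j (localTraj F τ η γ x₀ z s r j c ω) (z j r c ω)
    - gradient (F.loss j) (localTraj F τ η γ x₀ z s r j c ω)

/-- The uncompressed message of a client in round `r`. -/
def update (r : ℕ) (j : Fin m) (ω : Ω) : Vec d :=
  η⁻¹ • ((traj F τ η γ x₀ z s r ω).1 - localTraj F τ η γ x₀ z s r j τ ω)

/-- The compression error of a client in round `r`. -/
def compNoise (r : ℕ) (j : Fin m) (ω : Ω) : Vec d :=
  F.comp (update F τ η γ x₀ z s r j ω) (s j r ω) - update F τ η γ x₀ z s r j ω

variable {F τ η γ x₀ z s}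

theorem localTraj_succ (r : ℕ) (j : Fin m) (c : ℕ) (ω : Ω) :
    localTraj F τ η γ x₀ z s r j (c + 1) ω = localTraj F τ η γ x₀ z s r j c ω
      - η • (gradient (F.loss j) (localTraj F τ η γ x₀ z s r j c ω)
        + gradNoise F τ η γ x₀ z s r j c ω - (traj F τ η γ x₀ z s r ω).2 j) := by
  rw [gradNoise, add_sub_cancel]
  rfl

theorem message_eq (r : ℕ) (j : Fin m) (ω : Ω) :
    F.message τ η j (traj F τ η γ x₀ z s r ω).1 ((traj F τ η γ x₀ z s r ω).2 j)
      (fun c => z j r c ω) (s j r ω)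
    = update F τ η γ x₀ z s r j ω + compNoise F τ η γ x₀ z s r j ω := by
  rw [compNoise, add_sub_cancel]
  rfl

theorem traj_succ_fst (r : ℕ) (ω : Ω) :
    (traj F τ η γ x₀ z s (r + 1) ω).1 = (traj F τ η γ x₀ z s r ω).1
      - (η * γ) • mean fun j =>
        update F τ η γ x₀ z s r j ω + compNoise F τ η γ x₀ z s r j ω := by
  simp only [← message_eq]
  rfl

theorem traj_succ_snd (r : ℕ) (j : Fin m) (ω : Ω) :
    (traj F τ η γ x₀ z s (r + 1) ω).2 j = (traj F τ η γ x₀ z s r ω).2 j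
      + (τ : ℝ)⁻¹ • (update F τ η γ x₀ z s r j ω + compNoise F τ η γ x₀ z s r j ω
        - mean fun j => update F τ η γ x₀ z s r j ω + compNoise F τ η γ x₀ z s r j ω) := by
  simp only [← message_eq]
  rfl

theorem mean_corr_eq_zero (hm : 0 < m) (r : ℕ) (ω : Ω) :
    (mean fun j => (traj F τ η γ x₀ z s r ω).2 j) = 0 := by
  induction r with
  | zero => exact mean_const hm 0
  | succ r ih =>
    simp only [traj_succ_snd]
    rw [mean_add, ih, mean_smul, mean_sub, mean_const hm, sub_self, smul_zero, add_zero]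

section Measurability

variable {𝓐 : MeasurableSpace Ω} {L σ q Gq : ℝ}

/-- The σ-algebra on `Ω` is arbitrary here and below, so that the same lemmas give plain
measurability and adaptedness to a history. -/
theorem measurable_localTraj (hV : F.BoundedVariance σ) {r : ℕ} {j : Fin m}
    (hx : Measurable (traj F τ η γ x₀ z s r)) {c : ℕ} (hz : ∀ i < c, Measurable (z j r i)) :
    Measurable (localTraj F τ η γ x₀ z s r j c) := by
  induction c with
  | zero => exact measurable_fst.comp hx
  | succ c ih =>
    have h1 := ih fun i hi => hz i (hi.trans (Nat.lt_succ_self c))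
    have h2 : Measurable fun ω =>
        F.stochGrad j (localTraj F τ η γ x₀ z s r j c ω) (z j r c ω) :=
      (hV.measurable j).comp (h1.prodMk (hz c (Nat.lt_succ_self c)))
    have h3 : Measurable fun ω => (traj F τ η γ x₀ z s r ω).2 j :=
      (measurable_pi_apply j).comp (measurable_snd.comp hx)
    exact h1.sub ((h2.sub h3).const_smul η)

theorem measurable_gradNoise (hF : F.Smooth L) (hV : F.BoundedVariance σ) {r : ℕ} {j : Fin m}
    (hx : Measurable (traj F τ η γ x₀ z s r)) {c : ℕ} (hz : ∀ i ≤ c, Measurable (z j r i)) :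
    Measurable (gradNoise F τ η γ x₀ z s r j c) := by
  have h1 := measurable_localTraj hV hx fun i (hi : i < c) => hz i hi.le
  exact ((hV.measurable j).comp (h1.prodMk (hz c le_rfl))).sub
    ((continuous_gradient_loss hF j).measurable.comp h1)

theorem measurable_update (hV : F.BoundedVariance σ) {r : ℕ} {j : Fin m}
    (hx : Measurable (traj F τ η γ x₀ z s r)) (hz : ∀ c, Measurable (z j r c)) :
    Measurable (update F τ η γ x₀ z s r j) :=
  ((measurable_fst.comp hx).sub (measurable_localTraj hV hx fun i _ => hz i)).const_smul η⁻¹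

theorem measurable_compNoise (hV : F.BoundedVariance σ) (hQ : F.UnbiasedCompressor q) {r : ℕ}
    {j : Fin m} (hx : Measurable (traj F τ η γ x₀ z s r)) (hz : ∀ c, Measurable (z j r c))
    (hs : Measurable (s j r)) : Measurable (compNoise F τ η γ x₀ z s r j) := by
  have h1 := measurable_update hV hx hz
  exact (hQ.measurable.comp (h1.prodMk hs)).sub h1

theorem measurable_mean {f : Fin m → Ω → Vec d} (hf : ∀ j, Measurable (f j)) :
    Measurable fun ω => mean fun j => f j ω :=
  (Finset.measurable_sum _ fun j _ => hf j).const_smul (m : ℝ)⁻¹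

theorem measurable_traj (hV : F.BoundedVariance σ) (hQ : F.UnbiasedCompressor q) {r : ℕ}
    (hz : ∀ j, ∀ i < r, ∀ c, Measurable (z j i c)) (hs : ∀ j, ∀ i < r, Measurable (s j i)) :
    Measurable (traj F τ η γ x₀ z s r) := by
  induction r with
  | zero => exact measurable_const
  | succ r ih =>
    have hx := ih (fun j i hi => hz j i (hi.trans (Nat.lt_succ_self r)))
      (fun j i hi => hs j i (hi.trans (Nat.lt_succ_self r)))
    have h1 : ∀ j, Measurable fun ω =>
        update F τ η γ x₀ z s r j ω + compNoise F τ η γ x₀ z s r j ω := fun j =>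
      (measurable_update hV hx (hz j r (Nat.lt_succ_self r))).add
        (measurable_compNoise hV hQ hx (hz j r (Nat.lt_succ_self r)) (hs j r (Nat.lt_succ_self r)))
    have h2 := measurable_mean h1
    have h3 : traj F τ η γ x₀ z s (r + 1) = fun ω => ((traj F τ η γ x₀ z s (r + 1) ω).1,
        fun j => (traj F τ η γ x₀ z s (r + 1) ω).2 j) := rfl
    rw [h3]
    simp only [traj_succ_fst, traj_succ_snd]
    refine Measurable.prodMk ((measurable_fst.comp hx).sub (h2.const_smul (η * γ))) ?_
    refine measurable_pi_lambda _ fun j => ?_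
    exact ((measurable_pi_apply j).comp (measurable_snd.comp hx)).add
      (((h1 j).sub h2).const_smul (τ : ℝ)⁻¹)

end Measurability

end Trajectories

/-! ### Adaptedness, noise bounds and square integrability -/

section SquareIntegrableTrajectories

variable {d m : ℕ} {Ξ : Type u} {S : Type v} {Ω : Type w} [MeasurableSpace Ξ] [MeasurableSpace S]
  {F : FedSetup d m Ξ S} {τ : ℕ} {η γ : ℝ} {x₀ : Vec d} {z : Fin m → ℕ → ℕ → Ω → Ξ}
  {s : Fin m → ℕ → Ω → S} {L σ q Gq : ℝ}

/-- The sources that may have been used when client `j` draws its sample in local step `c` of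
round `r`, including all samples of the other clients in that round. -/
def beforeSample (r : ℕ) (j : Fin m) (c : ℕ) : Set (Source m) :=
  {i | Sum.elim (fun a => a.2.1 < r ∨ a.2.1 = r ∧ (a.1 ≠ j ∨ a.2.2 < c)) (fun b => b.2 < r) i}

/-- The sources that are used before the compressor seeds of round `r`. -/
def beforeSeed (m r : ℕ) : Set (Source m) :=
  {i | Sum.elim (fun a => a.2.1 ≤ r) (fun b => b.2 < r) i}

theorem measurable_traj_beforeSample (hF : F.Standing L σ q Gq) (r : ℕ) (j : Fin m) (c : ℕ) :
    Measurable[history z s (beforeSample r j c)] (traj F τ η γ x₀ z s r) :=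
  measurable_traj hF.boundedVariance hF.unbiasedCompressor
    (fun _ _ hi _ => measurable_sample_history (Or.inl hi))
    (fun _ _ hi => measurable_seed_history hi)

theorem measurable_traj_beforeSeed (hF : F.Standing L σ q Gq) (r : ℕ) :
    Measurable[history z s (beforeSeed m r)] (traj F τ η γ x₀ z s r) :=
  measurable_traj hF.boundedVariance hF.unbiasedCompressor
    (fun _ _ hi _ => measurable_sample_history (Nat.le_of_lt hi))
    (fun _ _ hi => measurable_seed_history hi)

theorem measurable_localTraj_beforeSample (hF : F.Standing L σ q Gq) (r : ℕ) (j : Fin m) (c : ℕ) :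
    Measurable[history z s (beforeSample r j c)] (localTraj F τ η γ x₀ z s r j c) :=
  measurable_localTraj hF.boundedVariance (measurable_traj_beforeSample hF r j c)
    fun _ hi => measurable_sample_history (Or.inr ⟨rfl, Or.inr hi⟩)

/-- All samples of the other clients in the round count as past, even those of later local steps.
This is harmless since clients do not interact within a round, and it makes noise of different
clients orthogonal. -/
theorem measurable_gradNoise_beforeSample (hF : F.Standing L σ q Gq) (r : ℕ) {j j' : Fin m}
    {c c' : ℕ} (h : j' ≠ j ∨ c' < c) :
    Measurable[history z s (beforeSample r j c)] (gradNoise F τ η γ x₀ z s r j' c') :=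
  measurable_gradNoise hF.smooth hF.boundedVariance (measurable_traj_beforeSample hF r j c)
    fun _ hi => measurable_sample_history (Or.inr ⟨rfl, h.imp_right hi.trans_lt⟩)

theorem measurable_update_beforeSeed (hF : F.Standing L σ q Gq) (r : ℕ) (j : Fin m) :
    Measurable[history z s (beforeSeed m r)] (update F τ η γ x₀ z s r j) :=
  measurable_update hF.boundedVariance (measurable_traj_beforeSeed hF r)
    fun _ => measurable_sample_history (Nat.le_refl r)

variable [mΩ : MeasurableSpace Ω] {P : Measure Ω}

theorem indep_beforeSample (hS : F.Sampling P z s) (r : ℕ) (j : Fin m) (c : ℕ) :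
    Indep (history z s (beforeSample r j c)) (MeasurableSpace.comap (z j r c) inferInstance) P :=
  indep_history_source hS (i := .inl (j, r, c)) (by simp [beforeSample])

theorem indep_beforeSeed (hS : F.Sampling P z s) (r : ℕ) (j : Fin m) :
    Indep (history z s (beforeSeed m r)) (MeasurableSpace.comap (s j r) inferInstance) P :=
  indep_history_source hS (i := .inr (j, r)) (by simp [beforeSeed])

theorem measurable_stochGrad_sub (hF : F.Standing L σ q Gq) (j : Fin m) :
    Measurable (Function.uncurry fun (x : Vec d) b =>
      F.stochGrad j x b - gradient (F.loss j) x) :=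
  (hF.boundedVariance.measurable j).sub
    ((continuous_gradient_loss hF.smooth j).measurable.comp measurable_fst)

theorem measurable_comp_sub (hF : F.Standing L σ q Gq) :
    Measurable (Function.uncurry fun (x : Vec d) b => F.comp x b - x) :=
  hF.unbiasedCompressor.measurable.sub measurable_fst

variable [IsProbabilityMeasure P]

theorem lintegral_gradNoise_le (hF : F.Standing L σ q Gq) (hS : F.Sampling P z s) (r : ℕ)
    (j : Fin m) (c : ℕ) :
    ∫⁻ ω, ‖gradNoise F τ η γ x₀ z s r j c ω‖ₑ ^ 2 ∂P ≤ ENNReal.ofReal (σ ^ 2) := by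
  have h1 := lintegral_comp_of_indep (history_le hS _) (hS.measurable_sample j r c)
    (hS.law_sample j r c) (indep_beforeSample hS r j c)
    (measurable_localTraj_beforeSample (τ := τ) (η := η) (γ := γ) (x₀ := x₀) hF r j c)
    (φ := fun x b => ‖F.stochGrad j x b - gradient (F.loss j) x‖ₑ ^ 2)
    ((measurable_stochGrad_sub hF j).enorm.pow_const 2)
  refine h1.le.trans ?_
  calc _ ≤ ∫⁻ ω, ENNReal.ofReal (σ ^ 2) ∂P := lintegral_mono fun ω =>
        lintegral_enorm_sq_le_of_integral (hF.boundedVariance.sq_integrable j _)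
          (hF.boundedVariance.variance_le j _)
    _ = _ := by simp

theorem memLp_gradNoise (hF : F.Standing L σ q Gq) (hS : F.Sampling P z s) (r : ℕ)
    (j : Fin m) (c : ℕ) : MemLp (gradNoise F τ η γ x₀ z s r j c) 2 P := by
  refine memLp_two_of_lintegral_lt_top ?_
    ((lintegral_gradNoise_le hF hS r j c).trans_lt ENNReal.ofReal_lt_top)
  have h1 := measurable_gradNoise (τ := τ) (η := η) (γ := γ) (x₀ := x₀) hF.smooth
    hF.boundedVariance ((measurable_traj_beforeSample hF r j c).mono (history_le hS _) le_rfl)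
    fun i (_ : i ≤ c) => hS.measurable_sample j r i
  exact h1.aestronglyMeasurable

theorem inner_gradNoise (hF : F.Standing L σ q Gq) (hS : F.Sampling P z s) (r : ℕ)
    (j : Fin m) (c : ℕ) (hn : MemLp (gradNoise F τ η γ x₀ z s r j c) 2 P) {Y : Ω → Vec d}
    (hY : Measurable[history z s (beforeSample r j c)] Y) (hY2 : MemLp Y 2 P) :
    inner ℝ (hn.toLp _) (hY2.toLp _) = 0 := by
  have := hF.boundedVariance.prob j
  exact inner_eq_zero_of_indep (history_le hS _) (hS.measurable_sample j r c)
    (hS.law_sample j r c) (indep_beforeSample hS r j c)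
    (measurable_localTraj_beforeSample (τ := τ) (η := η) (γ := γ) (x₀ := x₀) hF r j c)
    (measurable_stochGrad_sub hF j)
    (fun x => (hF.boundedVariance.integrable j x).sub (integrable_const _))
    (fun x => by
      rw [integral_sub (hF.boundedVariance.integrable j x) (integrable_const _),
        hF.boundedVariance.unbiased]
      simp) hY hY2 hn

theorem lintegral_compNoise_le (hF : F.Standing L σ q Gq) (hS : F.Sampling P z s) (r : ℕ)
    (j : Fin m) {φ : Vec d → ℝ} (hφ : ∀ x, ∫ b, ‖F.comp x b - x‖ ^ 2 ∂F.compLaw ≤ φ x) :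
    ∫⁻ ω, ‖compNoise F τ η γ x₀ z s r j ω‖ₑ ^ 2 ∂P
      ≤ ∫⁻ ω, ENNReal.ofReal (φ (update F τ η γ x₀ z s r j ω)) ∂P := by
  have h1 := lintegral_comp_of_indep (history_le hS _) (hS.measurable_seed j r)
    (hS.law_seed j r) (indep_beforeSeed hS r j)
    (measurable_update_beforeSeed (τ := τ) (η := η) (γ := γ) (x₀ := x₀) hF r j)
    (φ := fun x b => ‖F.comp x b - x‖ₑ ^ 2) ((measurable_comp_sub hF).enorm.pow_const 2)
  refine h1.le.trans ?_
  exact lintegral_mono fun ω =>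
    lintegral_enorm_sq_le_of_integral (hF.unbiasedCompressor.sq_integrable _) (hφ _)

theorem lintegral_compNoise_le_mul (hF : F.Standing L σ q Gq) (hS : F.Sampling P z s) (hq : 0 ≤ q)
    (r : ℕ) (j : Fin m) (hu : MemLp (update F τ η γ x₀ z s r j) 2 P) :
    ∫⁻ ω, ‖compNoise F τ η γ x₀ z s r j ω‖ₑ ^ 2 ∂P
      ≤ ENNReal.ofReal (q * ‖hu.toLp _‖ ^ 2) := by
  refine (lintegral_compNoise_le hF hS r j hF.unbiasedCompressor.variance_le).trans ?_
  rw [ENNReal.ofReal_mul hq, ← lintegral_enorm_sq_eq hu,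
    ← lintegral_const_mul' _ _ ENNReal.ofReal_ne_top]
  refine lintegral_mono fun ω => ?_
  rw [ENNReal.ofReal_mul hq, ENNReal.ofReal_pow (norm_nonneg _), ofReal_norm]

theorem memLp_compNoise (hF : F.Standing L σ q Gq) (hS : F.Sampling P z s) (hq : 0 ≤ q)
    (r : ℕ) (j : Fin m) (hu : MemLp (update F τ η γ x₀ z s r j) 2 P) :
    MemLp (compNoise F τ η γ x₀ z s r j) 2 P := by
  refine memLp_two_of_lintegral_lt_top ?_
    ((lintegral_compNoise_le_mul hF hS hq r j hu).trans_lt ENNReal.ofReal_lt_top)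
  have h1 := measurable_compNoise (τ := τ) (η := η) (γ := γ) (x₀ := x₀)
    hF.boundedVariance hF.unbiasedCompressor
    ((measurable_traj_beforeSeed hF r).mono (history_le hS _) le_rfl)
    (fun i => hS.measurable_sample j r i) (hS.measurable_seed j r)
  exact h1.aestronglyMeasurable

theorem inner_compNoise (hF : F.Standing L σ q Gq) (hS : F.Sampling P z s) (r : ℕ)
    (j : Fin m) (hk : MemLp (compNoise F τ η γ x₀ z s r j) 2 P) {Y : Ω → Vec d}
    (hY : Measurable[history z s (beforeSeed m r)] Y) (hY2 : MemLp Y 2 P) :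
    inner ℝ (hk.toLp _) (hY2.toLp _) = 0 := by
  have := hF.unbiasedCompressor.prob
  exact inner_eq_zero_of_indep (history_le hS _) (hS.measurable_seed j r)
    (hS.law_seed j r) (indep_beforeSeed hS r j)
    (measurable_update_beforeSeed (τ := τ) (η := η) (γ := γ) (x₀ := x₀) hF r j)
    (measurable_comp_sub hF)
    (fun x => (hF.unbiasedCompressor.integrable x).sub (integrable_const _))
    (fun x => by
      rw [integral_sub (hF.unbiasedCompressor.integrable x) (integrable_const _),
        hF.unbiasedCompressor.unbiased]
      simp) hY hY2 hk

theorem memLp_localTraj (hF : F.Standing L σ q Gq) (hS : F.Sampling P z s) {r : ℕ} {j : Fin m}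
    (hx : MemLp (fun ω => (traj F τ η γ x₀ z s r ω).1) 2 P)
    (hδ : MemLp (fun ω => (traj F τ η γ x₀ z s r ω).2 j) 2 P) (c : ℕ) :
    MemLp (localTraj F τ η γ x₀ z s r j c) 2 P := by
  induction c with
  | zero => exact hx
  | succ c ih =>
    have h1 : localTraj F τ η γ x₀ z s r j (c + 1) = _ := funext (localTraj_succ r j c)
    rw [h1]
    exact ih.sub ((((memLp_comp_of_lipschitz (hF.smooth j).2 ih).add
      (memLp_gradNoise hF hS r j c)).sub hδ).const_smul η)

theorem memLp_update (hF : F.Standing L σ q Gq) (hS : F.Sampling P z s) {r : ℕ} {j : Fin m}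
    (hx : MemLp (fun ω => (traj F τ η γ x₀ z s r ω).1) 2 P)
    (hδ : MemLp (fun ω => (traj F τ η γ x₀ z s r ω).2 j) 2 P) :
    MemLp (update F τ η γ x₀ z s r j) 2 P :=
  (hx.sub (memLp_localTraj hF hS hx hδ τ)).const_smul η⁻¹

/-- Induction over rounds: Lipschitz gradients preserve `L²`, the gradient noise has bounded second
moment, and the compression noise is controlled by the update that is compressed. -/
theorem memLp_traj (hF : F.Standing L σ q Gq) (hS : F.Sampling P z s) (hq : 0 ≤ q) (r : ℕ) :
    MemLp (fun ω => (traj F τ η γ x₀ z s r ω).1) 2 P ∧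
      ∀ j, MemLp (fun ω => (traj F τ η γ x₀ z s r ω).2 j) 2 P := by
  induction r with
  | zero => exact ⟨memLp_const x₀, fun j => memLp_const 0⟩
  | succ r ih =>
    have h1 : ∀ j, MemLp (fun ω =>
        update F τ η γ x₀ z s r j ω + compNoise F τ η γ x₀ z s r j ω) 2 P := fun j =>
      (memLp_update hF hS ih.1 (ih.2 j)).add
        (memLp_compNoise hF hS hq r j (memLp_update hF hS ih.1 (ih.2 j)))
    have h2 := memLp_mean h1
    simp only [traj_succ_fst, traj_succ_snd]
    exact ⟨ih.1.sub (h2.const_smul (η * γ)),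
      fun j => (ih.2 j).add (((h1 j).sub h2).const_smul (τ : ℝ)⁻¹)⟩

end SquareIntegrableTrajectories

/-! ### The random rounds satisfy the abstract axioms -/

section LiftedRounds

variable {d m : ℕ} {Ξ : Type u} {S : Type v} {Ω : Type w} [MeasurableSpace Ξ] [MeasurableSpace S]
  {F : FedSetup d m Ξ S} {τ : ℕ} {η γ : ℝ} {x₀ : Vec d} {z : Fin m → ℕ → ℕ → Ω → Ξ}
  {s : Fin m → ℕ → Ω → S} {L σ q Gq : ℝ} [mΩ : MeasurableSpace Ω] {P : Measure Ω}
  [IsProbabilityMeasure P]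

theorem mean_superpose_toLp (hF : F.Smooth L) (hm : 0 < m) {X : Ω → Vec d} (hX : MemLp X 2 P) :
    (mean fun j => superpose (hF j).2 (hX.toLp X))
      = (memLp_comp_of_lipschitz (norm_gradient_globalLoss_sub_le hF hm) hX).toLp _ := by
  simp only [superpose_toLp]
  rw [mean_toLp _ (memLp_mean fun j => memLp_comp_of_lipschitz (hF j).2 hX)]
  exact MemLp.toLp_congr _ _ (Filter.Eventually.of_forall fun ω =>
    (gradient_globalLoss hF (X ω)).symm)

theorem norm_compNoise_sq_le_mul (hF : F.Standing L σ q Gq) (hS : F.Sampling P z s) (hq : 0 ≤ q)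
    (r : ℕ) (j : Fin m) (hu : MemLp (update F τ η γ x₀ z s r j) 2 P)
    (hk : MemLp (compNoise F τ η γ x₀ z s r j) 2 P) :
    ‖hk.toLp _‖ ^ 2 ≤ q * ‖hu.toLp _‖ ^ 2 :=
  norm_toLp_sq_le hk (by positivity) (lintegral_compNoise_le_mul hF hS hq r j hu)

theorem norm_compNoise_sq_le_gap (hF : F.Standing L σ q Gq) (hS : F.Sampling P z s) (hm : 2 ≤ m)
    (r : ℕ) (j : Fin m) (hk : MemLp (compNoise F τ η γ x₀ z s r j) 2 P) :
    ‖hk.toLp _‖ ^ 2 ≤ m ^ 2 * Gq := by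
  have h0 := gap_nonneg hF.unbiasedCompressor hF.compressionGap
  refine norm_toLp_sq_le hk (by positivity) ?_
  refine (lintegral_compNoise_le hF hS r j
    (comp_variance_le_gap hF.unbiasedCompressor hF.compressionGap hm)).trans ?_
  simp

/-- For one client the relative bound is used and there are no deviations from the mean. For several
clients the absolute bound from the compression gap suffices on its own. The common form serves both
cases. -/
theorem norm_mean_compNoise_sq_le {H : Type*} [NormedAddCommGroup H] [InnerProductSpace ℝ H]
    {q K : ℝ} (hm : 0 < m) (hq : 0 ≤ q) (hK : 0 ≤ K) {k u : Fin m → H}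
    (h1 : ∀ j, ‖k j‖ ^ 2 ≤ q * ‖u j‖ ^ 2) (h2 : 2 ≤ m → ∀ j, ‖k j‖ ^ 2 ≤ K) :
    ‖mean k‖ ^ 2 ≤ q / m * ‖mean u‖ ^ 2 + K ∧ mean (fun j => ‖k j - mean k‖ ^ 2) ≤ K := by
  rcases Nat.lt_or_ge m 2 with hm2 | hm2
  · obtain rfl : m = 1 := by omega
    have h3 := h1 0
    simp only [mean, Nat.cast_one, inv_one, one_smul, Fin.sum_univ_one, Fin.isValue, sub_self,
      norm_zero, div_one]
    exact ⟨by linarith, by simpa using hK⟩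
  · have h3 : (mean fun j => ‖k j‖ ^ 2) ≤ K := (mean_mono (h2 hm2)).trans_eq (mean_const hm K)
    refine ⟨((norm_mean_sq_le hm k).trans h3).trans ?_, (mean_norm_sub_mean_sq_le hm k).trans h3⟩
    have : 0 ≤ q / m * ‖mean u‖ ^ 2 := by positivity
    linarith

theorem measurable_gradient_globalLoss (hF : F.Smooth L) (hm : 0 < m) :
    Measurable (gradient F.globalLoss) := by
  have : LipschitzWith L.toNNReal (gradient F.globalLoss) :=
    LipschitzWith.of_dist_le_mul fun x y => by
      rw [dist_eq_norm, dist_eq_norm]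
      refine (norm_gradient_globalLoss_sub_le hF hm x y).trans ?_
      gcongr
      exact Real.le_coe_toNNReal L
  exact this.continuous.measurable

theorem round_toLp (hF : F.Standing L σ q Gq) (hS : F.Sampling P z s) (hm : 0 < m) (hq : 0 ≤ q)
    (xs : Vec d) {r : ℕ} (hx : MemLp (fun ω => (traj F τ η γ x₀ z s r ω).1) 2 P)
    (hx' : MemLp (fun ω => (traj F τ η γ x₀ z s (r + 1) ω).1) 2 P)
    (hδ : ∀ j, MemLp (fun ω => (traj F τ η γ x₀ z s r ω).2 j) 2 P)
    (hδ' : ∀ j, MemLp (fun ω => (traj F τ η γ x₀ z s (r + 1) ω).2 j) 2 P)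
    (hW : ∀ j c, MemLp (localTraj F τ η γ x₀ z s r j c) 2 P)
    (hn : ∀ j c, MemLp (gradNoise F τ η γ x₀ z s r j c) 2 P)
    (hk : ∀ j, MemLp (compNoise F τ η γ x₀ z s r j) 2 P) :
    Round (fun j => superpose (P := P) (hF.smooth j).2) τ η γ σ q (m ^ 2 * Gq)
      ((memLp_const xs).toLp _) (hx.toLp _) (hx'.toLp _) (fun j => (hδ j).toLp _)
      (fun j => (hδ' j).toLp _) (fun j c => (hW j c).toLp _) (fun j c => (hn j c).toLp _)
      (fun j => (hk j).toLp _) := by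
  have hu : ∀ j, MemLp (update F τ η γ x₀ z s r j) 2 P := fun j => memLp_update hF hS hx (hδ j)
  have hgrad := measurable_gradient_globalLoss hF.smooth hm
  have hmsg : ∀ j, η⁻¹ • (hx.toLp _ - (hW j τ).toLp _)
      = (hu j).toLp _ := fun j => by
    rw [← MemLp.toLp_sub, ← MemLp.toLp_const_smul]
    rfl
  have hmsg' : (mean fun j => η⁻¹ • (hx.toLp _ - (hW j τ).toLp _))
      = (memLp_mean hu).toLp _ := by
    simp only [hmsg]
    exact mean_toLp hu _
  have hsum : ∀ j, MemLp (fun ω => update F τ η γ x₀ z s r j ω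
      + compNoise F τ η γ x₀ z s r j ω) 2 P := fun j => (hu j).add (hk j)
  have hmsgk : ∀ j, η⁻¹ • (hx.toLp _ - (hW j τ).toLp _)
      + (hk j).toLp _ = (hsum j).toLp _ := fun j => by
    rw [hmsg, ← MemLp.toLp_add]
    rfl
  have hmsgk' : (mean fun j => η⁻¹ • (hx.toLp _ - (hW j τ).toLp _)
      + (hk j).toLp _) = (memLp_mean hsum).toLp _ := by
    simp only [hmsgk]
    exact mean_toLp hsum _
  have hK : 0 ≤ m ^ 2 * Gq := by
    have := gap_nonneg hF.unbiasedCompressor hF.compressionGap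
    positivity
  have hcomp := norm_mean_compNoise_sq_le hm hq hK
    (fun j => norm_compNoise_sq_le_mul hF hS hq r j (hu j) (hk j))
    (fun hm2 j => norm_compNoise_sq_le_gap hF hS hm2 r j (hk j))
  have horth : ∀ j c j' c', (j' ≠ j ∨ c' < c) →
      inner ℝ ((hn j c).toLp _) ((hn j' c').toLp _) = 0 := fun j c j' c' h =>
    inner_gradNoise hF hS r j c (hn j c) (measurable_gradNoise_beforeSample hF r h) (hn j' c')
  constructor
  · intro j
    rfl
  · intro j c
    rw [superpose_toLp, ← MemLp.toLp_add, ← MemLp.toLp_sub, ← MemLp.toLp_const_smul,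
      ← MemLp.toLp_sub]
    exact MemLp.toLp_congr _ _ (Filter.Eventually.of_forall fun ω => localTraj_succ r j c ω)
  · rw [hmsgk', ← MemLp.toLp_const_smul, ← MemLp.toLp_sub]
    exact MemLp.toLp_congr _ _ (Filter.Eventually.of_forall fun ω => traj_succ_fst r ω)
  · intro j
    rw [hmsgk', hmsgk, ← MemLp.toLp_sub, ← MemLp.toLp_const_smul, ← MemLp.toLp_add]
    exact MemLp.toLp_congr _ _ (Filter.Eventually.of_forall fun ω => traj_succ_snd r j ω)
  · have h0 : MemLp (0 : Ω → Vec d) 2 P := MemLp.zero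
    exact (mean_toLp hδ (memLp_mean hδ)).trans ((MemLp.toLp_congr _ h0
      (Filter.Eventually.of_forall fun ω => mean_corr_eq_zero hm r ω)).trans (MemLp.toLp_zero h0))
  · intro j c
    exact norm_toLp_sq_le _ (by positivity) (lintegral_gradNoise_le hF hS r j c)
  · intro j c j' c' hne
    -- Of two distinct samples of a round, at least one belongs to the past of the other: samples of
    -- different clients are past to each other, and those of one client are ordered by local step.
    by_cases hj : j' = j
    · subst hj
      rcases lt_trichotomy c c' with h | h | h
      · rw [real_inner_comm]
        exact horth _ _ _ _ (Or.inr h)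
      · exact absurd (by rw [h]) hne
      · exact horth _ _ _ _ (Or.inr h)
    · exact horth _ _ _ _ (Or.inl hj)
  · intro j c
    rw [mean_superpose_toLp hF.smooth hm]
    exact inner_gradNoise hF hS r j c (hn j c)
      (hgrad.comp (measurable_fst.comp (measurable_traj_beforeSample hF r j c))) _
  · intro j c
    rw [← MemLp.toLp_sub]
    exact inner_gradNoise hF hS r j c (hn j c)
      ((measurable_fst.comp (measurable_traj_beforeSample hF r j c)).sub measurable_const) _
  · intro j
    rw [mean_superpose_toLp hF.smooth hm]
    exact inner_compNoise hF hS r j (hk j)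
      (hgrad.comp (measurable_fst.comp (measurable_traj_beforeSeed hF r))) _
  · intro j
    rw [← MemLp.toLp_sub]
    exact inner_compNoise hF hS r j (hk j)
      ((measurable_fst.comp (measurable_traj_beforeSeed hF r)).sub measurable_const) _
  · rw [hmsg']
    refine Round.inner_mean_comp fun j => inner_compNoise hF hS r j (hk j) ?_ _
    exact measurable_mean fun j => measurable_update_beforeSeed hF r j
  · simp only [hmsg]
    exact hcomp.1
  · exact hcomp.2

/-- The expected objective, as a functional on square-integrable random vectors. -/
def expLoss (F : FedSetup d m Ξ S) (P : Measure Ω) (X : Lp (Vec d) 2 P) : ℝ :=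
  ∫ ω, F.globalLoss (X ω) ∂P

omit [IsProbabilityMeasure P] in
theorem expLoss_toLp {X : Ω → Vec d} (hX : MemLp X 2 P) :
    expLoss F P (hX.toLp X) = ∫ ω, F.globalLoss (X ω) ∂P := by
  refine integral_congr_ae ?_
  filter_upwards [hX.coeFn_toLp] with ω h
  rw [h]

variable {xs : Vec d}

theorem globalLoss_sub_le (hF : F.Smooth L) (hm : 0 < m)
    (hxs : IsMinOn F.globalLoss Set.univ xs) (x : Vec d) :
    F.globalLoss x - F.globalLoss xs ≤ L / 2 * ‖x - xs‖ ^ 2 := by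
  have h1 := le_quadratic_of_lipschitz_gradient (differentiable_globalLoss hF)
    (norm_gradient_globalLoss_sub_le hF hm) xs x
  rw [gradient_eq_zero_of_isMinOn hxs, inner_zero_left] at h1
  linarith

/-- The objective gap lies between `0` and `(L / 2) ‖x - xs‖²`, so square integrability of the model
is enough. -/
theorem integrable_globalLoss (hF : F.Smooth L) (hm : 0 < m)
    (hxs : IsMinOn F.globalLoss Set.univ xs) {X : Ω → Vec d} (hX : MemLp X 2 P) :
    Integrable (fun ω => F.globalLoss (X ω)) P := by
  have h1 : Integrable (fun ω => L / 2 * ‖X ω - xs‖ ^ 2) P :=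
    ((memLp_two_iff_integrable_sq_norm (hX.1.sub aestronglyMeasurable_const)).1
      (hX.sub (memLp_const xs))).const_mul _
  have h2 : Integrable (fun ω => F.globalLoss (X ω) - F.globalLoss xs) P := by
    refine h1.mono' ?_ (Filter.Eventually.of_forall fun ω => ?_)
    · exact ((differentiable_globalLoss hF).continuous.comp_aestronglyMeasurable hX.1).sub
        aestronglyMeasurable_const
    · rw [Real.norm_of_nonneg (sub_nonneg.2 (hxs (Set.mem_univ (X ω))))]
      exact globalLoss_sub_le hF hm hxs _
  refine (h2.add (integrable_const (F.globalLoss xs))).congr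
    (Filter.Eventually.of_forall fun ω => ?_)
  simp

theorem mean_superpose (hF : F.Smooth L) (hm : 0 < m) (X : Lp (Vec d) 2 P) :
    (mean fun j => superpose (hF j).2 X)
      = (memLp_comp_of_lipschitz (norm_gradient_globalLoss_sub_le hF hm) (Lp.memLp X)).toLp _ := by
  have := mean_superpose_toLp hF hm (Lp.memLp X)
  rwa [Lp.toLp_coeFn] at this

theorem le_expLoss (hF : F.Smooth L) (hm : 0 < m) (hxs : IsMinOn F.globalLoss Set.univ xs)
    (X : Lp (Vec d) 2 P) : F.globalLoss xs ≤ expLoss F P X := by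
  have h1 : ∫ _, F.globalLoss xs ∂P ≤ expLoss F P X :=
    integral_mono (integrable_const _) (integrable_globalLoss hF hm hxs (Lp.memLp X))
      fun ω => hxs (Set.mem_univ (X ω))
  simpa using h1

/-- The pointwise inequality is integrated. The expected objective thus inherits smoothness with the
same `L`, with the superposed gradient as its gradient; the PL and convexity inequalities below pass
to it in the same way. -/
theorem expLoss_le_quadratic (hF : F.Smooth L) (hm : 0 < m)
    (hxs : IsMinOn F.globalLoss Set.univ xs) (X Y : Lp (Vec d) 2 P) :
    expLoss F P Y ≤ expLoss F P X + inner ℝ (mean fun j => superpose (hF j).2 X) (Y - X)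
      + L / 2 * ‖Y - X‖ ^ 2 := by
  have hX := Lp.memLp X
  have hY := Lp.memLp Y
  have hYX : Y - X = (hY.sub hX).toLp _ := by
    rw [MemLp.toLp_sub hY hX, Lp.toLp_coeFn, Lp.toLp_coeFn]
  have hg := memLp_comp_of_lipschitz (norm_gradient_globalLoss_sub_le hF hm) hX
  have i1 := integrable_globalLoss hF hm hxs hX
  have i2 := integrable_inner_of_memLp hg (hY.sub hX)
  have i3 : Integrable (fun ω => L / 2 * ‖(⇑Y - ⇑X) ω‖ ^ 2) P :=
    ((memLp_two_iff_integrable_sq_norm (hY.sub hX).1).1 (hY.sub hX)).const_mul _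
  have i12 : Integrable (fun ω => F.globalLoss (X ω)
      + inner ℝ (gradient F.globalLoss (X ω)) ((⇑Y - ⇑X) ω)) P := i1.add i2
  rw [mean_superpose hF hm, hYX, inner_toLp, norm_toLp_sq, expLoss, expLoss, ← integral_const_mul,
    ← integral_add i1 i2, ← integral_add i12 i3]
  refine integral_mono (integrable_globalLoss hF hm hxs hY) (i12.add i3) fun ω => ?_
  exact le_quadratic_of_lipschitz_gradient (differentiable_globalLoss hF)
    (norm_gradient_globalLoss_sub_le hF hm) (X ω) (Y ω)

theorem expLoss_PL (hF : F.Smooth L) (hm : 0 < m) (hxs : IsMinOn F.globalLoss Set.univ xs) {μ : ℝ}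
    (hPL : F.PL μ xs) (X : Lp (Vec d) 2 P) :
    μ * (expLoss F P X - F.globalLoss xs)
      ≤ 1 / 2 * ‖mean fun j => superpose (hF j).2 X‖ ^ 2 := by
  have hX := Lp.memLp X
  have hg := memLp_comp_of_lipschitz (norm_gradient_globalLoss_sub_le hF hm) hX
  have i1 := integrable_globalLoss hF hm hxs hX
  have h1 : ∫ ω, μ * (F.globalLoss (X ω) - F.globalLoss xs) ∂P
      ≤ ∫ ω, 1 / 2 * ‖gradient F.globalLoss (X ω)‖ ^ 2 ∂P :=
    integral_mono ((i1.sub (integrable_const _)).const_mul _)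
      (((memLp_two_iff_integrable_sq_norm hg.1).1 hg).const_mul _) fun ω => hPL (X ω)
  rw [integral_const_mul, integral_const_mul, integral_sub i1 (integrable_const _)] at h1
  rw [mean_superpose hF hm, norm_toLp_sq, expLoss]
  simpa using h1

theorem norm_mean_superpose_sq_le (hF : F.Smooth L) (hm : 0 < m) (hL : 0 < L)
    (hxs : IsMinOn F.globalLoss Set.univ xs) (X : Lp (Vec d) 2 P) :
    ‖mean fun j => superpose (hF j).2 X‖ ^ 2 ≤ 2 * L * (expLoss F P X - F.globalLoss xs) := by
  have hX := Lp.memLp X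
  have hg := memLp_comp_of_lipschitz (norm_gradient_globalLoss_sub_le hF hm) hX
  have i1 := integrable_globalLoss hF hm hxs hX
  have h1 : ∫ ω, ‖gradient F.globalLoss (X ω)‖ ^ 2 ∂P
      ≤ ∫ ω, 2 * L * (F.globalLoss (X ω) - F.globalLoss xs) ∂P :=
    integral_mono ((memLp_two_iff_integrable_sq_norm hg.1).1 hg)
      ((i1.sub (integrable_const _)).const_mul _) fun ω =>
        norm_gradient_sq_le (differentiable_globalLoss hF) hL
          (norm_gradient_globalLoss_sub_le hF hm) (fun y => hxs (Set.mem_univ y)) (X ω)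
  rw [integral_const_mul, integral_sub i1 (integrable_const _)] at h1
  rw [mean_superpose hF hm, norm_toLp_sq, expLoss]
  simpa using h1

theorem expLoss_sub_le_inner (hF : F.Smooth L) (hm : 0 < m)
    (hxs : IsMinOn F.globalLoss Set.univ xs) (hc : ConvexOn ℝ Set.univ F.globalLoss)
    (X : Lp (Vec d) 2 P) :
    expLoss F P X - F.globalLoss xs ≤ inner ℝ (mean fun j => superpose (hF j).2 X)
      (X - (memLp_const xs).toLp _) := by
  have hX := Lp.memLp X
  have hd : MemLp (fun ω => X ω - xs) 2 P := hX.sub (memLp_const xs)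
  have hg := memLp_comp_of_lipschitz (norm_gradient_globalLoss_sub_le hF hm) hX
  have i1 := integrable_globalLoss hF hm hxs hX
  have hXx : X - (memLp_const xs).toLp _ = hd.toLp _ := by
    have h1 := MemLp.toLp_sub hX (memLp_const xs)
    rw [Lp.toLp_coeFn] at h1
    exact h1.symm
  have h1 : ∫ ω, (F.globalLoss (X ω) - F.globalLoss xs) ∂P
      ≤ ∫ ω, inner ℝ (gradient F.globalLoss (X ω)) (X ω - xs) ∂P :=
    integral_mono (i1.sub (integrable_const _)) (integrable_inner_of_memLp hg hd) fun ω =>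
      ConvexOn.inner_gradient_le (differentiable_globalLoss hF) hc (X ω) xs
  rw [integral_sub i1 (integrable_const _)] at h1
  rw [hXx, mean_superpose hF hm, inner_toLp, expLoss]
  simpa using h1

theorem trackErr_toLp_const (hF : F.Smooth L) (hm : 0 < m) (x : Vec d) :
    trackErr (fun j => superpose (P := P) (hF j).2) ((memLp_const x).toLp _) 0
      = F.dissimilarity x := by
  have h1 : ∀ j, ‖superpose (P := P) (hF j).2 ((memLp_const x).toLp _)
      - (mean fun i => superpose (hF i).2 ((memLp_const x).toLp _)) - 0‖ ^ 2
      = ‖gradient (F.loss j) x - gradient F.globalLoss x‖ ^ 2 := by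
    intro j
    rw [mean_superpose_toLp hF hm, superpose_toLp, sub_zero, ← MemLp.toLp_sub, norm_toLp_sq]
    simp
  simp only [trackErr, Pi.zero_apply, h1]
  rfl

end LiftedRounds

/-! ### Guarantees for the expected values -/

section Guarantees

variable {d m : ℕ} {Ξ : Type u} {S : Type v} {Ω : Type w} [MeasurableSpace Ξ] [MeasurableSpace S]
  [mΩ : MeasurableSpace Ω] {F : FedSetup d m Ξ S} {P : Measure Ω} [IsProbabilityMeasure P]
  {τ : ℕ} {η γ : ℝ} {x₀ xs : Vec d} {z : Fin m → ℕ → ℕ → Ω → Ξ} {s : Fin m → ℕ → Ω → S}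
  {L σ q Gq : ℝ} (hF : F.Standing L σ q Gq) (hS : F.Sampling P z s)
  (hxs : IsMinOn F.globalLoss Set.univ xs)
  (hm : 0 < m) (hτ : 0 < τ) (hη : 0 < η) (hγ : 0 < γ) (hq : 0 ≤ q) (hL : 0 < L)
  (hLs : L * (η * γ * τ) * (1 + q / m) ≤ 3 / 5) (hA : 6 * (η * τ * L) ^ 2 ≤ 1 / (1000 * m))
  {B : ℝ} (hB : F.dissimilarity x₀ ≤ B)

include hF hS hq in
theorem memLp_globalModel (r : ℕ) : MemLp (F.globalModel τ η γ x₀ z s r) 2 P :=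
  (memLp_traj hF hS hq r).1

include hF hS hm hq hxs in
theorem integrable_globalLoss_globalModel (r : ℕ) :
    Integrable (fun ω => F.globalLoss (F.globalModel τ η γ x₀ z s r ω) - F.globalLoss xs) P :=
  (integrable_globalLoss hF.smooth hm hxs (memLp_globalModel hF hS hq r)).sub (integrable_const _)

include hF hS hm hq in
theorem integrable_norm_gradient_sq_globalModel (r : ℕ) :
    Integrable (fun ω => ‖gradient F.globalLoss (F.globalModel τ η γ x₀ z s r ω)‖ ^ 2) P := by
  have h1 := memLp_comp_of_lipschitz (norm_gradient_globalLoss_sub_le hF.smooth hm)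
    (memLp_globalModel (τ := τ) (η := η) (γ := γ) (x₀ := x₀) hF hS hq r)
  exact (memLp_two_iff_integrable_sq_norm h1.1).1 h1

include hF hS hm hq in
/-- The rounds of FedCOMGATE in the Hilbert space of square-integrable random vectors. -/
theorem exists_rounds (τ : ℕ) (η γ : ℝ) (x₀ xs : Vec d) :
    ∃ (δ : ℕ → Fin m → Lp (Vec d) 2 P) (W n : ℕ → Fin m → ℕ → Lp (Vec d) 2 P)
      (k : ℕ → Fin m → Lp (Vec d) 2 P), δ 0 = 0 ∧
      ∀ r, Round (fun j => superpose (P := P) (hF.smooth j).2) τ η γ σ q (m ^ 2 * Gq)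
        ((memLp_const xs).toLp _)
        ((memLp_globalModel (τ := τ) (η := η) (γ := γ) (x₀ := x₀) hF hS hq r).toLp _)
        ((memLp_globalModel (τ := τ) (η := η) (γ := γ) (x₀ := x₀) hF hS hq
          (r + 1)).toLp _) (δ r) (δ (r + 1)) (W r) (n r) (k r) := by
  have hx := fun r => (memLp_traj (τ := τ) (η := η) (γ := γ) (x₀ := x₀) hF hS hq r).1
  have hδ := fun r => (memLp_traj (τ := τ) (η := η) (γ := γ) (x₀ := x₀) hF hS hq r).2
  have hk := fun r j => memLp_compNoise hF hS hq r j (memLp_update hF hS (hx r) (hδ r j))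
  have hW := fun r j c => memLp_localTraj hF hS (hx r) (hδ r j) c
  have hn := fun r j c => memLp_gradNoise (τ := τ) (η := η) (γ := γ) (x₀ := x₀) hF hS r j c
  refine ⟨fun r j => (hδ r j).toLp _, fun r j c => (hW r j c).toLp _,
    fun r j c => (hn r j c).toLp _, fun r j => (hk r j).toLp _, ?_, fun r =>
    round_toLp hF hS hm hq xs (hx r) (hx (r + 1)) (hδ r) (hδ (r + 1)) (hW r) (hn r) (hk r)⟩
  funext j
  exact MemLp.toLp_zero (hδ 0 j)

include hF hS in
theorem expLoss_globalModel (hq : 0 ≤ q) (hm : 0 < m) (hxs : IsMinOn F.globalLoss Set.univ xs)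
    (r : ℕ) :
    ∫ ω, (F.globalLoss (F.globalModel τ η γ x₀ z s r ω) - F.globalLoss xs) ∂P
      = expLoss F P ((memLp_globalModel (τ := τ) (η := η) (γ := γ) (x₀ := x₀) hF hS hq r).toLp _)
        - F.globalLoss xs := by
  rw [expLoss_toLp, integral_sub
    (integrable_globalLoss hF.smooth hm hxs (memLp_globalModel hF hS hq r)) (integrable_const _)]
  simp

include hF hS in
theorem expLoss_globalModel_zero (hq : 0 ≤ q) :
    expLoss F P ((memLp_globalModel (τ := τ) (η := η) (γ := γ) (x₀ := x₀) hF hS hq 0).toLp _)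
      = F.globalLoss x₀ := by
  rw [expLoss_toLp]
  simp [FedSetup.globalModel, FedSetup.fedcomgate]

include hF hS hxs hm hτ hη hγ hq hL hLs hA hB

theorem integral_mean_grad_sq_le {R : ℕ} (hR : 0 < R) :
    ∫ ω, 1 / (R : ℝ) * ∑ r ∈ Finset.range R,
        ‖gradient F.globalLoss (F.globalModel τ η γ x₀ z s r ω)‖ ^ 2 ∂P
      ≤ 4 * (F.globalLoss x₀ - F.globalLoss xs) / (η * γ * τ * R) + B / (10 * R)
        + 8 * (σ ^ 2 / (m * τ) + m ^ 2 * Gq / τ ^ 2) := by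
  obtain ⟨δ, W, n, k, hδ, h⟩ := exists_rounds hF hS hm hq τ η γ x₀ xs
  have hGq := gap_nonneg hF.unbiasedCompressor hF.compressionGap
  have h1 := mean_grad_sq_le_of_run h hm hτ hη hγ hq (by positivity) hL hLs
    (fun j => norm_superpose_sub_le (hF.smooth j).2) hA (expLoss_le_quadratic hF.smooth hm hxs)
    (le_expLoss hF.smooth hm hxs) hδ hR
    ((trackErr_toLp_const hF.smooth hm x₀).trans_le hB)
  rw [expLoss_globalModel_zero hF hS hq] at h1
  refine le_trans (le_of_eq ?_) h1
  rw [integral_const_mul, integral_finsetSum _ fun r _ =>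
    integrable_norm_gradient_sq_globalModel hF hS hm hq r]
  congr 1
  refine Finset.sum_congr rfl fun r _ => ?_
  rw [mean_superpose_toLp hF.smooth hm, norm_toLp_sq]

theorem integral_globalLoss_le_of_PL {μ : ℝ} (hμ : 0 < μ) (hμL : μ ≤ L) (hPL : F.PL μ xs)
    (R : ℕ) :
    ∫ ω, (F.globalLoss (F.globalModel τ η γ x₀ z s R ω) - F.globalLoss xs) ∂P
      ≤ Real.exp (-(R * (η * γ * τ * μ / 2))) * (F.globalLoss x₀ - F.globalLoss xs + B / L)
        + 4 / μ * (σ ^ 2 / (m * τ) + m ^ 2 * Gq / τ ^ 2) := by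
  obtain ⟨δ, W, n, k, hδ, h⟩ := exists_rounds hF hS hm hq τ η γ x₀ xs
  have hGq := gap_nonneg hF.unbiasedCompressor hF.compressionGap
  have h1 := objective_le_of_run_PL h hm hτ hη hγ hq (by positivity) hL hLs
    (fun j => norm_superpose_sub_le (hF.smooth j).2) hA (expLoss_le_quadratic hF.smooth hm hxs)
    (le_expLoss hF.smooth hm hxs) hδ hμ hμL (expLoss_PL hF.smooth hm hxs hPL)
    ((trackErr_toLp_const hF.smooth hm x₀).trans_le hB) R
  rwa [expLoss_globalModel_zero hF hS hq, ← expLoss_globalModel hF hS hq hm hxs] at h1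

theorem integral_globalLoss_le_of_convex (hc : ConvexOn ℝ Set.univ F.globalLoss) {D θ b : ℝ}
    (hb : 0 < b) (hbA : 6 * (η * τ * L) ^ 2 * (b + 2 / L) ≤ 1 / (1000 * L)) {R : ℕ}
    (hRb : R * (η * γ * τ / b) ≤ 1 / 2) (hD : 0 < D)
    (hD' : 2 * (‖x₀ - xs‖ ^ 2 + B / L ^ 2
      + R * (2 * (η * γ * τ) / L * (σ ^ 2 / τ + m ^ 2 * Gq / τ ^ 2))) ≤ D)
    (hθ : 0 < θ)
    (hp : 2 * (η * γ * τ) * (σ ^ 2 / (m * τ) + m ^ 2 * Gq / τ ^ 2) ≤ θ)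
    (hpD : 64 * D * (σ ^ 2 / (m * τ) + m ^ 2 * Gq / τ ^ 2) ≤ θ ^ 2)
    (hR : 16 * D ≤ θ * (η * γ * τ * R)) :
    ∫ ω, (F.globalLoss (F.globalModel τ η γ x₀ z s R ω) - F.globalLoss xs) ∂P ≤ 2 * θ := by
  obtain ⟨δ, W, n, k, hδ, h⟩ := exists_rounds hF hS hm hq τ η γ x₀ xs
  have hGq := gap_nonneg hF.unbiasedCompressor hF.compressionGap
  have h0 : ‖(memLp_globalModel (τ := τ) (η := η) (γ := γ) (x₀ := x₀) hF hS hq 0).toLp _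
      - (memLp_const xs).toLp _‖ ^ 2 = ‖x₀ - xs‖ ^ 2 := by
    rw [← MemLp.toLp_sub, norm_toLp_sq]
    simp [FedSetup.globalModel, FedSetup.fedcomgate]
  have h1 := objective_le_of_run_convex h hm hτ hη hγ hq (by positivity) hL hLs
    (fun j => norm_superpose_sub_le (hF.smooth j).2) hA (expLoss_le_quadratic hF.smooth hm hxs)
    (le_expLoss hF.smooth hm hxs) hδ (expLoss_sub_le_inner hF.smooth hm hxs hc)
    (norm_mean_superpose_sq_le hF.smooth hm hL hxs)
    ((trackErr_toLp_const hF.smooth hm x₀).trans_le hB) hb hbA hRb hD (by rw [h0]; exact hD')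
    hθ hp hpD hR
  rwa [← expLoss_globalModel hF hS hq hm hxs] at h1

end Guarantees

/-! ### Regularization and strong convexity -/

section Regularization

variable {d m : ℕ} {Ξ : Type u} {S : Type v} {Ω : Type w} [MeasurableSpace Ξ] [MeasurableSpace S]
  [mΩ : MeasurableSpace Ω] {F : FedSetup d m Ξ S} {P : Measure Ω}
  {x₀ xs : Vec d} {z : Fin m → ℕ → ℕ → Ω → Ξ} {s : Fin m → ℕ → Ω → S}
  {L σ q Gq φ : ℝ}

theorem hasGradientAt_add_sq {E : Type*} [NormedAddCommGroup E] [InnerProductSpace ℝ E]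
    [CompleteSpace E] {f : E → ℝ} (hf : Differentiable ℝ f) (φ : ℝ) (x : E) :
    HasGradientAt (fun x => f x + φ / 2 * ‖x‖ ^ 2) (gradient f x + φ • x) x := by
  rw [hasGradientAt_iff_hasFDerivAt]
  have h1 := (hf x).hasFDerivAt.add ((hasStrictFDerivAt_norm_sq x).hasFDerivAt.const_mul (φ / 2))
  refine h1.congr_fderiv ?_
  ext v
  simp [gradient]
  ring

theorem gradient_regularize_loss (hF : F.Smooth L) (j : Fin m) (x : Vec d) :
    gradient ((F.regularize φ).loss j) x = gradient (F.loss j) x + φ • x :=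
  (hasGradientAt_add_sq (hF j).1 φ x).gradient

theorem smooth_regularize (hF : F.Smooth L) (hφ : 0 ≤ φ) : (F.regularize φ).Smooth (L + φ) := by
  refine fun j => ⟨fun x => (hasGradientAt_add_sq (hF j).1 φ x).differentiableAt, fun x y => ?_⟩
  rw [gradient_regularize_loss hF, gradient_regularize_loss hF, add_sub_add_comm, ← smul_sub,
    add_mul]
  refine (norm_add_le _ _).trans (add_le_add ((hF j).2 x y) ?_)
  rw [norm_smul, Real.norm_of_nonneg hφ]

theorem standing_regularize (hF : F.Standing L σ q Gq) (hφ : 0 ≤ φ) :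
    (F.regularize φ).Standing (L + φ) σ q Gq := by
  have hsub : ∀ j x b, (F.regularize φ).stochGrad j x b - gradient ((F.regularize φ).loss j) x
      = F.stochGrad j x b - gradient (F.loss j) x := by
    intro j x b
    rw [gradient_regularize_loss hF.smooth]
    exact add_sub_add_right_eq_sub _ _ _
  have hV := hF.boundedVariance
  have hQ := hF.unbiasedCompressor
  refine ⟨smooth_regularize hF.smooth hφ, ⟨hV.prob, ?_, ?_, ?_, ?_, ?_⟩, ⟨hQ.prob, hQ.measurable,
    hQ.integrable, hQ.unbiased, hQ.sq_integrable, hQ.variance_le⟩, hF.compressionGap⟩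
  · intro j
    exact (hV.measurable j).add (measurable_fst.const_smul φ)
  · intro j x
    have := hV.prob j
    exact (hV.integrable j x).add (integrable_const (φ • x))
  · intro j x
    have := hV.prob j
    rw [gradient_regularize_loss hF.smooth, ← hV.unbiased]
    have h1 := integral_add (hV.integrable j x) (integrable_const (φ • x))
    exact h1.trans (by simp)
  · intro j x
    simp only [hsub]
    exact hV.sq_integrable j x
  · intro j x
    simp only [hsub]
    exact hV.variance_le j x

theorem sampling_regularize (hS : F.Sampling P z s) : (F.regularize φ).Sampling P z s :=
  ⟨hS.measurable_sample, hS.measurable_seed, hS.law_sample, hS.law_seed, hS.indep_samples,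
    hS.indep_seeds, hS.indep_samples_seeds⟩

theorem globalLoss_regularize (hm : 0 < m) (x : Vec d) :
    (F.regularize φ).globalLoss x = F.globalLoss x + φ / 2 * ‖x‖ ^ 2 := by
  have hm' : (m : ℝ) ≠ 0 := by positivity
  simp only [FedSetup.globalLoss, FedSetup.regularize, Finset.sum_add_distrib, Finset.sum_const,
    Finset.card_univ, Fintype.card_fin, nsmul_eq_mul, mul_add]
  congr 1
  rw [← mul_assoc, inv_mul_cancel₀ hm', one_mul]

theorem dissimilarity_regularize (hF : F.Smooth L) (hφ : 0 ≤ φ) (hm : 0 < m) (x : Vec d) :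
    (F.regularize φ).dissimilarity x = F.dissimilarity x := by
  simp only [FedSetup.dissimilarity, gradient_globalLoss (smooth_regularize hF hφ),
    gradient_globalLoss hF, gradient_regularize_loss hF]
  rw [mean_add, mean_const hm]
  simp only [add_sub_add_right_eq_sub]

theorem convexOn_regularize (hm : 0 < m) (hφ : 0 ≤ φ) (hc : ConvexOn ℝ Set.univ F.globalLoss) :
    ConvexOn ℝ Set.univ (F.regularize φ).globalLoss := by
  have h1 : (F.regularize φ).globalLoss = fun x => F.globalLoss x + (φ / 2) • ‖x‖ ^ 2 :=
    funext fun x => globalLoss_regularize hm x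
  rw [h1]
  refine hc.add (ConvexOn.smul (by positivity) ?_)
  exact (convexOn_univ_norm (E := Vec d)).pow (fun _ _ => norm_nonneg _) 2

/-- The regularized objective has a minimizer that is no longer than a given minimizer of the
objective, and almost as good. -/
theorem exists_isMinOn_regularize (hF : F.Smooth L) (hm : 0 < m) (hφ : 0 ≤ φ)
    (hxs : IsMinOn F.globalLoss Set.univ xs) :
    ∃ y, IsMinOn (F.regularize φ).globalLoss Set.univ y ∧ ‖y‖ ≤ ‖xs‖ ∧
      (F.regularize φ).globalLoss y ≤ F.globalLoss xs + φ / 2 * ‖xs‖ ^ 2 := by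
  rcases hφ.eq_or_lt with rfl | hφ
  · refine ⟨xs, ?_, le_rfl, ?_⟩
    · intro x _
      have := hxs (Set.mem_univ x)
      simpa [globalLoss_regularize hm] using this
    · rw [globalLoss_regularize hm]
  · have hcont : Continuous (F.regularize φ).globalLoss :=
      (differentiable_globalLoss (smooth_regularize hF hφ.le)).continuous
    -- The objective is bounded below by its minimum, so the added quadratic makes the sum coercive
    -- and a minimizer exists.
    have hlim : Filter.Tendsto (F.regularize φ).globalLoss (Filter.cocompact (Vec d))
        Filter.atTop := by
      have h1 : Filter.Tendsto (fun x : Vec d => F.globalLoss xs + φ / 2 * ‖x‖ ^ 2)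
          (Filter.cocompact (Vec d)) Filter.atTop :=
        Filter.tendsto_atTop_add_const_left _ _ (((Filter.tendsto_pow_atTop two_ne_zero).comp
          (tendsto_norm_cocompact_atTop (E := Vec d))).const_mul_atTop (by positivity))
      refine Filter.tendsto_atTop_mono (fun x => ?_) h1
      rw [globalLoss_regularize hm]
      have : F.globalLoss xs ≤ F.globalLoss x := hxs (Set.mem_univ x)
      linarith
    obtain ⟨y, hy⟩ := hcont.exists_forall_le hlim
    have h2 := hy xs
    rw [globalLoss_regularize hm, globalLoss_regularize hm] at h2
    have h3 : F.globalLoss xs ≤ F.globalLoss y := hxs (Set.mem_univ y)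
    refine ⟨y, fun x _ => hy x, ?_, ?_⟩
    · have h4 : φ / 2 * ‖y‖ ^ 2 ≤ φ / 2 * ‖xs‖ ^ 2 := by linarith
      have h5 : ‖y‖ ^ 2 ≤ ‖xs‖ ^ 2 := le_of_mul_le_mul_left h4 (by positivity)
      exact (sq_le_sq₀ (norm_nonneg _) (norm_nonneg _)).1 h5
    · rw [globalLoss_regularize hm]
      exact h2

/-- The strong convexity lower bound at `x`, evaluated at `xs`, is minimized over the displacement
`xs - x` by Young's inequality with weight `1 / μ`. -/
theorem PL_of_strongConvex {μ : ℝ} (hμ : 0 < μ) (h : F.StrongConvex μ) : F.PL μ xs := by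
  intro x
  have h1 := h xs x
  have h2 := inner_le_weighted (-gradient F.globalLoss x) (xs - x) (t := μ⁻¹) (by positivity)
  rw [inner_neg_left, norm_neg, inv_inv] at h2
  have h3 : μ * (F.globalLoss x - F.globalLoss xs)
      ≤ μ * (1 / 2 * (μ⁻¹ * ‖gradient F.globalLoss x‖ ^ 2)) := by
    gcongr
    linarith
  refine h3.trans_eq ?_
  field_simp

end Regularization

/-! ### Choice of parameters and thresholds -/

section Parameters

theorem exists_threshold {p : ℝ → Prop} (h : ∀ᶠ ε in nhdsWithin (0 : ℝ) (Set.Ioi 0), p ε) :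
    ∃ ε₀ : ℝ, 0 < ε₀ ∧ ∀ ε, 0 < ε → ε ≤ ε₀ → p ε := by
  obtain ⟨c, hc, h⟩ := mem_nhdsGT_iff_exists_Ioc_subset.1 h
  exact ⟨c, hc, fun ε h1 h2 => h ⟨h1, h2⟩⟩

theorem eventually_le_of_pos {c : ℝ} (hc : 0 < c) :
    ∀ᶠ ε in nhdsWithin (0 : ℝ) (Set.Ioi 0), ε ≤ c :=
  nhdsWithin_le_nhds (Iic_mem_nhds hc)

theorem eventually_le_log_inv (c : ℝ) :
    ∀ᶠ ε in nhdsWithin (0 : ℝ) (Set.Ioi 0), c ≤ Real.log (1 / ε) := by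
  simp only [one_div]
  exact (Real.tendsto_log_atTop.comp tendsto_inv_nhdsGT_zero).eventually_ge_atTop c

/-- `R = ⌈a / ε log (1 / ε)⌉` is of smaller order than `1 / ε²`. -/
theorem eventually_ceil_mul_sq_le {a c : ℝ} (ha : 0 ≤ a) (hc : 0 < c) :
    ∀ᶠ ε in nhdsWithin (0 : ℝ) (Set.Ioi 0),
      (⌈a / ε * Real.log (1 / ε)⌉₊ : ℝ) * ε ^ 2 ≤ c := by
  have hlog : Filter.Tendsto (fun ε => Real.log ε * ε) (nhdsWithin (0 : ℝ) (Set.Ioi 0))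
      (nhds 0) := by
    simpa only [Real.rpow_one] using tendsto_log_mul_rpow_nhdsGT_zero zero_lt_one
  have h0 : Filter.Tendsto (fun ε : ℝ => a * -(Real.log ε * ε) + ε ^ 2)
      (nhdsWithin (0 : ℝ) (Set.Ioi 0)) (nhds (a * -0 + 0 ^ 2)) := by
    refine (hlog.neg.const_mul a).add ?_
    exact ((continuous_id.pow 2).tendsto (0 : ℝ)).mono_left nhdsWithin_le_nhds
  have h1 : ∀ᶠ ε in nhdsWithin (0 : ℝ) (Set.Ioi 0), a * -(Real.log ε * ε) + ε ^ 2 < c :=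
    h0.eventually_lt_const (by simpa using hc)
  filter_upwards [h1, self_mem_nhdsWithin, eventually_le_log_inv 0] with ε h1 h2 h3
  have h2' : 0 < ε := h2
  have h4 : (⌈a / ε * Real.log (1 / ε)⌉₊ : ℝ) ≤ a / ε * Real.log (1 / ε) + 1 :=
    (Nat.ceil_lt_add_one (by positivity)).le
  calc (⌈a / ε * Real.log (1 / ε)⌉₊ : ℝ) * ε ^ 2
      ≤ (a / ε * Real.log (1 / ε) + 1) * ε ^ 2 := by gcongr
    _ = a * -(Real.log ε * ε) + ε ^ 2 := by
        rw [one_div, Real.log_inv]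
        field_simp
    _ ≤ c := h1.le

/-- The threshold is fixed before an instance shows that `Gq` is nonnegative. Dividing by `|b| + 1`
is safe whatever the sign, and also when `b = 0`. -/
theorem mul_le_of_le_div_add_one {a b c ε : ℝ} (hb : 0 ≤ b) (h : ε ≤ c / (a * (|b| + 1)))
    (ha : 0 < a) (hε : 0 < ε) : a * b * ε ≤ c := by
  rw [le_div_iff₀ (by positivity)] at h
  rw [abs_of_nonneg hb] at h
  nlinarith [mul_pos ha hε]

/-- The stochastic noise level in terms of the accuracy `e`. -/
theorem noise_le {m T C e V G : ℝ} (hm : 0 < m) (hT : 0 < T) (hC : 0 < C)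
    (hV : 0 ≤ V) (hG : 0 ≤ G) (h : C ≤ T * m * e) :
    V / (m * T) ≤ V * e / C ∧ m ^ 2 * G / T ^ 2 ≤ m ^ 4 * G * e ^ 2 / C ^ 2 := by
  constructor
  · rw [div_le_div_iff₀ (by positivity) hC]
    nlinarith
  · rw [div_le_div_iff₀ (by positivity) (by positivity)]
    have h1 : C ^ 2 ≤ (T * m * e) ^ 2 := pow_le_pow_left₀ hC.le h 2
    calc m ^ 2 * G * C ^ 2 ≤ m ^ 2 * G * (T * m * e) ^ 2 := by gcongr
      _ = m ^ 4 * G * e ^ 2 * T ^ 2 := by ring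

theorem le_ceil_mul {a b : ℝ} (hb : 0 < b) : a ≤ (⌈a * (1 / b)⌉₊ : ℝ) * b := by
  have := Nat.le_ceil (a * (1 / b))
  rwa [mul_one_div, div_le_iff₀ hb, ← mul_one_div] at this

theorem ceil_mul_le {a b : ℝ} (ha : 0 ≤ a) (hb : 0 < b) :
    (⌈a * (1 / b)⌉₊ : ℝ) * b ≤ a + b := by
  have := (Nat.ceil_lt_add_one (a := a * (1 / b)) (by positivity)).le
  calc (⌈a * (1 / b)⌉₊ : ℝ) * b ≤ (a * (1 / b) + 1) * b := by gcongr
    _ = a + b := by field_simp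

/-- A step size `η τ` is small compared to `1 / L` when the server step `γ` is large. -/
theorem local_step_le {L η γ T X c : ℝ} (hX : L * (η * γ * T) = X) (hc : 0 < c)
    (hγc : c ≤ γ ^ 2) : (η * T * L) ^ 2 ≤ X ^ 2 / c := by
  rw [le_div_iff₀ hc]
  calc (η * T * L) ^ 2 * c ≤ (η * T * L) ^ 2 * γ ^ 2 := by gcongr
    _ = X ^ 2 := by rw [← hX]; ring

end Parameters

/-! ### The nonconvex case -/

section Nonconvex

set_option maxHeartbeats 1000000 in
theorem nonconvex_guarantee {d m : ℕ} {Ξ : Type u} {S : Type v} {Ω : Type w}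
    [MeasurableSpace Ξ] [MeasurableSpace S] [MeasurableSpace Ω] {F : FedSetup d m Ξ S}
    {P : Measure Ω} [IsProbabilityMeasure P] {R τ : ℕ} {η γ ε : ℝ} {x₀ xs : Vec d}
    {z : Fin m → ℕ → ℕ → Ω → Ξ} {s : Fin m → ℕ → Ω → S} {L σ q Gq F₀ H C : ℝ}
    (hF : F.Standing L σ q Gq) (hS : F.Sampling P z s)
    (hxs : IsMinOn F.globalLoss Set.univ xs) (hm : 0 < m) (hq : 0 ≤ q) (hL : 0 < L)
    (hF₀ : F.globalLoss x₀ - F.globalLoss xs ≤ F₀) (hH : F.dissimilarity x₀ ≤ H)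
    (hε : 0 < ε) (hC : 32 * (σ ^ 2 + |F₀| * L + |H| + 1) ≤ C)
    (hε1 : ε ≤ C / m) (hε2 : ε ≤ C ^ 2 / (32 * m ^ 4 * (|Gq| + 1)))
    (hR : R = ⌈12000 * C * ((q + 1) / ε)⌉₊) (hτ : τ = ⌈C * (1 / (m * ε))⌉₊) (hγ : m ≤ γ)
    (hη : η = 1 / (L * γ) * Real.sqrt (m / (R * τ * (q + 1)))) :
    ∫ ω, 1 / (R : ℝ) * ∑ r ∈ Finset.range R,
        ‖gradient F.globalLoss (F.globalModel τ η γ x₀ z s r ω)‖ ^ 2 ∂P ≤ ε := by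
  have hm' : (1 : ℝ) ≤ m := by exact_mod_cast hm
  have hm0 : (0 : ℝ) < m := by linarith
  have hC0 : 0 < C := lt_of_lt_of_le (by positivity) hC
  have hγ0 : 0 < γ := by linarith
  have hGq := gap_nonneg hF.unbiasedCompressor hF.compressionGap
  have hT1 : C ≤ τ * m * ε := by
    have := le_ceil_mul (a := C) (b := m * ε) (by positivity)
    rw [← hτ] at this
    linarith
  have hT2 : τ * m * ε ≤ 2 * C := by
    have := ceil_mul_le (a := C) (b := m * ε) hC0.le (by positivity)
    rw [← hτ] at this
    rw [le_div_iff₀ hm0] at hε1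
    linarith
  have hR1 : 12000 * C * (q + 1) ≤ R * ε := by
    have h1 := Nat.le_ceil (12000 * C * ((q + 1) / ε))
    rw [← hR, ← mul_div_assoc, div_le_iff₀ hε] at h1
    exact h1
  have hτ0 : (0 : ℝ) < τ := by
    rw [mul_assoc] at hT1
    exact (mul_pos_iff_of_pos_right (mul_pos hm0 hε)).1 (hC0.trans_le hT1)
  have hR0 : (0 : ℝ) < R :=
    (mul_pos_iff_of_pos_right hε).1 (lt_of_lt_of_le (by positivity) hR1)
  have hη0 : 0 < η := by rw [hη]; positivity
  set X := L * (η * γ * τ) with hX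
  have hX0 : 0 < X := by positivity
  -- The normalized step `X = L s` does not depend on `γ`. With `τ m ε` between `C` and `2 C`, this
  -- identity determines its size in terms of `R`.
  have hXsq : X ^ 2 * (R * (q + 1)) = τ * m := by
    have h1 : X = τ * Real.sqrt (m / (R * τ * (q + 1))) := by
      rw [hX, hη]
      field_simp
    rw [h1, mul_pow, Real.sq_sqrt (by positivity)]
    field_simp
  -- The constant `12000` is calibrated here: `τ m ε ≤ 2 C` and `R ε ≥ 12000 C (q + 1)` give `1 /
  -- 6000`, and `6 / 6000` is the `1 / 1000` required in `hA`.
  have hXq : (X * (q + 1)) ^ 2 ≤ 1 / 6000 := by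
    have h1 : X ^ 2 * (q + 1) * (12000 * C * (q + 1)) ≤ 2 * C :=
      calc X ^ 2 * (q + 1) * (12000 * C * (q + 1)) ≤ X ^ 2 * (q + 1) * (R * ε) := by gcongr
        _ = τ * m * ε := by rw [← hXsq]; ring
        _ ≤ 2 * C := hT2
    have h2 : C * (6000 * (X * (q + 1)) ^ 2) ≤ C * 1 := by linarith
    have := le_of_mul_le_mul_left h2 hC0
    linarith
  have hX1 : X ^ 2 ≤ 1 / 6000 := by
    refine le_trans ?_ hXq
    gcongr
    exact le_mul_of_one_le_right hX0.le (by linarith)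
  have hXR : 100 * C ≤ X * R * ε := by
    refine (sq_le_sq₀ (by positivity) (by positivity)).1 ?_
    have h1 : (X * R * ε) ^ 2 * (q + 1) = (τ * m * ε) * (R * ε) := by
      rw [← hXsq]; ring
    have h2 : C * (12000 * C * (q + 1)) ≤ (τ * m * ε) * (R * ε) := by gcongr
    have h3 : 12000 * C ^ 2 * (q + 1) ≤ (X * R * ε) ^ 2 * (q + 1) := by linarith
    have h4 := le_of_mul_le_mul_right h3 (by positivity)
    linarith [sq_nonneg C]
  have hLs : X * (1 + q / m) ≤ 3 / 5 := by
    have h1 : X * (1 + q / m) ≤ X * (q + 1) :=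
      mul_le_mul_of_nonneg_left (by linarith [div_le_self hq hm']) hX0.le
    exact h1.trans ((sq_le_sq₀ (by positivity) (by norm_num)).1 (hXq.trans (by norm_num)))
  have hA : 6 * (η * τ * L) ^ 2 ≤ 1 / (1000 * m) := by
    have h1 := local_step_le hX.symm hm0 (hγ.trans (le_self_pow₀ (hm'.trans hγ) two_ne_zero))
    have h2 : 6 * (X ^ 2 / m) ≤ 6 * ((1 / 6000) / m) := by gcongr
    refine ((mul_le_mul_of_nonneg_left h1 (by norm_num)).trans h2).trans_eq ?_
    field_simp
    norm_num
  have main := integral_mean_grad_sq_le hF hS hxs hm (by exact_mod_cast hτ0) hη0 hγ0 hq hL hLs hA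
    hH (R := R) (by exact_mod_cast hR0)
  obtain ⟨hn1, hn2⟩ := noise_le hm0 hτ0 hC0 (sq_nonneg σ) hGq hT1
  -- The four contributions (initial gap, initial dissimilarity, gradient noise, compression)
  -- receive `ε / 4` each.
  have t1 : 4 * (F.globalLoss x₀ - F.globalLoss xs) / (η * γ * τ * R) ≤ ε / 4 := by
    rw [div_le_iff₀ (by positivity)]
    have h1 : 4 * L * |F₀| ≤ 1 / 4 * (X * R * ε) := by
      have : |F₀| * L ≤ C := by
        linarith [sq_nonneg σ, abs_nonneg H, mul_nonneg (abs_nonneg F₀) hL.le]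
      linarith
    have h2 : F.globalLoss x₀ - F.globalLoss xs ≤ |F₀| := hF₀.trans (le_abs_self _)
    have h3 : L * (4 * (F.globalLoss x₀ - F.globalLoss xs))
        ≤ L * (ε / 4 * (η * γ * τ * R)) := by
      calc L * (4 * (F.globalLoss x₀ - F.globalLoss xs)) ≤ L * (4 * |F₀|) := by gcongr
        _ ≤ 1 / 4 * (X * R * ε) := by linarith
        _ = L * (ε / 4 * (η * γ * τ * R)) := by rw [hX]; ring
    exact le_of_mul_le_mul_left h3 hL
  have t2 : H / (10 * R) ≤ ε / 4 := by
    rw [div_le_iff₀ (by positivity)]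
    have h1 : H ≤ C := by
      linarith [sq_nonneg σ, abs_nonneg H, le_abs_self H, mul_nonneg (abs_nonneg F₀) hL.le]
    linarith [mul_nonneg hC0.le hq]
  have t3 : 8 * (σ ^ 2 * ε / C) ≤ ε / 4 := by
    rw [← mul_div_assoc, div_le_iff₀ hC0]
    have h1 : 32 * σ ^ 2 ≤ C := by
      linarith [abs_nonneg H, mul_nonneg (abs_nonneg F₀) hL.le]
    linarith [mul_le_mul_of_nonneg_left h1 hε.le]
  have t4 : 8 * (m ^ 4 * Gq * ε ^ 2 / C ^ 2) ≤ ε / 4 := by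
    rw [← mul_div_assoc, div_le_iff₀ (by positivity)]
    have h1 := mul_le_of_le_div_add_one hGq hε2 (by positivity) hε
    linarith [mul_le_mul_of_nonneg_left h1 hε.le]
  linarith

end Nonconvex

/-! ### The PL and strongly convex case -/

section PL

/-- The degenerate case `μ > L`: smoothness and PL give `2 μ (f - f*) ≤ ‖∇f‖² ≤ 2 L (f - f*)`, so
the gap vanishes everywhere and there is nothing to optimize. -/
theorem globalLoss_le_of_PL {d m : ℕ} {Ξ : Type u} {S : Type v}
    [MeasurableSpace Ξ] [MeasurableSpace S] {F : FedSetup d m Ξ S} {xs : Vec d} {L μ : ℝ}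
    (hF : F.Smooth L) (hm : 0 < m) (hL : 0 < L) (hxs : IsMinOn F.globalLoss Set.univ xs)
    (hPL : F.PL μ xs) (hμ : L < μ) (x : Vec d) : F.globalLoss x - F.globalLoss xs ≤ 0 := by
  have h1 := hPL x
  have h2 := norm_gradient_sq_le (differentiable_globalLoss hF) hL
    (norm_gradient_globalLoss_sub_le hF hm) (fun y => hxs (Set.mem_univ y)) x
  by_contra! h3
  linarith [mul_lt_mul_of_pos_right hμ h3]

set_option maxHeartbeats 1000000 in
theorem PL_guarantee {d m : ℕ} {Ξ : Type u} {S : Type v} {Ω : Type w}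
    [MeasurableSpace Ξ] [MeasurableSpace S] [MeasurableSpace Ω] {F : FedSetup d m Ξ S}
    {P : Measure Ω} [IsProbabilityMeasure P] {R τ : ℕ} {η γ ε : ℝ} {x₀ xs : Vec d}
    {z : Fin m → ℕ → ℕ → Ω → Ξ} {s : Fin m → ℕ → Ω → S} {L μ σ q Gq F₀ H C : ℝ}
    (hF : F.Standing L σ q Gq) (hS : F.Sampling P z s)
    (hxs : IsMinOn F.globalLoss Set.univ xs) (hm : 0 < m) (hq : 0 ≤ q) (hL : 0 < L)
    (hμ : 0 < μ) (hPL : F.PL μ xs)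
    (hF₀ : F.globalLoss x₀ - F.globalLoss xs ≤ F₀) (hH : F.dissimilarity x₀ ≤ H)
    (hε : 0 < ε) (hC : 16 * σ ^ 2 / μ + 1 ≤ C)
    (hε1 : ε ≤ C / (1500 * m)) (hε2 : ε ≤ μ * C ^ 2 / (16 * m ^ 4 * (|Gq| + 1)))
    (hε3 : ε ≤ 1 / (2 * (|F₀| + |H| / L + 1)))
    (hR : R = ⌈8 * ((q + 1) * (L / μ) * Real.log (1 / ε))⌉₊) (hτ : τ = ⌈C * (1 / (m * ε))⌉₊)
    (hγ : Real.sqrt (m * τ) ≤ γ)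
    (hη : η = 1 / (2 * L * (q / m + 1) * τ * γ) ∨ η = 1 / (2 * L * (q + 1) * τ * γ)) :
    ∫ ω, (F.globalLoss (F.globalModel τ η γ x₀ z s R ω) - F.globalLoss xs) ∂P ≤ ε := by
  rcases lt_or_ge L μ with hLμ | hμL
  · refine (integral_nonpos fun ω => ?_).trans hε.le
    exact globalLoss_le_of_PL hF.smooth hm hL hxs hPL hLμ _
  have hm' : (1 : ℝ) ≤ m := by exact_mod_cast hm
  have hm0 : (0 : ℝ) < m := by linarith
  have hC0 : 0 < C := lt_of_lt_of_le (by positivity) hC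
  have hGq := gap_nonneg hF.unbiasedCompressor hF.compressionGap
  have hT1 : C ≤ τ * m * ε := by
    have := le_ceil_mul (a := C) (b := m * ε) (by positivity)
    rw [← hτ] at this
    linarith
  have hT2 : (1500 : ℝ) ≤ τ := by
    rw [le_div_iff₀ (by positivity)] at hε1
    have h1 : 1500 * (m * ε) ≤ τ * (m * ε) := by linarith
    exact le_of_mul_le_mul_right h1 (by positivity)
  have hτ0 : (0 : ℝ) < τ := by linarith
  have hγ0 : 0 < γ := lt_of_lt_of_le (by positivity) hγ
  have hγ2 : m * τ ≤ γ ^ 2 := by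
    rw [← Real.sq_sqrt (by positivity : (0 : ℝ) ≤ m * τ)]
    gcongr
  set X := L * (η * γ * τ) with hX
  have hqm := div_le_self hq hm'
  -- The normalized step is `1 / (2 (q / m + 1))` or `1 / (2 (q + 1))`. Both are small enough for
  -- stability and large enough for the rate, and only these two inequalities are used from here on.
  obtain ⟨hη0, hLs, hXq⟩ : 0 < η ∧ X * (1 + q / m) ≤ 1 / 2 ∧ 1 / 2 ≤ X * (q + 1) := by
    rcases hη with hη | hη
    · refine ⟨by rw [hη]; positivity, ?_, ?_⟩
      · rw [hX, hη]
        field_simp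
        linarith
      · have h1 : X = 1 / (2 * (q / m + 1)) := by
          rw [hX, hη]
          field_simp
        rw [h1, div_mul_eq_mul_div, div_le_div_iff₀ (by norm_num) (by positivity)]
        linarith
    · have h1 : X = 1 / (2 * (q + 1)) := by
        rw [hX, hη]
        field_simp
      refine ⟨by rw [hη]; positivity, ?_, ?_⟩
      · rw [h1, div_mul_eq_mul_div, div_le_div_iff₀ (by positivity) (by norm_num)]
        linarith
      · rw [h1]
        field_simp
        norm_num
  have hX0 : 0 < X := by positivity
  have hX1 : X ≤ 1 / 2 := by
    refine le_trans ?_ hLs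
    linarith [mul_nonneg hX0.le (by positivity : (0 : ℝ) ≤ q / m)]
  have hA : 6 * (η * τ * L) ^ 2 ≤ 1 / (1000 * m) := by
    have h1 := local_step_le hX.symm (by positivity : (0 : ℝ) < m * τ) hγ2
    have h2 : 6 * (X ^ 2 / (m * τ)) ≤ 6 * ((1 / 2) ^ 2 / (m * 1500)) := by gcongr
    refine ((mul_le_mul_of_nonneg_left h1 (by norm_num)).trans h2).trans_eq ?_
    field_simp
    norm_num
  have main := integral_globalLoss_le_of_PL hF hS hxs hm (by exact_mod_cast hτ0) hη0 hγ0 hq hL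
    (hLs.trans (by norm_num)) hA hH hμ hμL hPL R
  obtain ⟨hn1, hn2⟩ := noise_le hm0 hτ0 hC0 (sq_nonneg σ) hGq hT1
  -- The exponent is at least `4 X (q + 1) log (1 / ε) ≥ 2 log (1 / ε)`, where the `8` in `R` is
  -- used. One factor `ε` is left over to absorb the initial potential, so that `C₁` can be
  -- absolute.
  have hexp : Real.exp (-(R * (η * γ * τ * μ / 2))) ≤ ε ^ 2 := by
    rw [← Real.exp_log (by positivity : 0 < ε ^ 2), Real.exp_le_exp, Real.log_pow]
    have h1 := Nat.le_ceil (8 * ((q + 1) * (L / μ) * Real.log (1 / ε)))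
    rw [← hR, one_div, Real.log_inv] at h1
    have h2 : η * γ * τ * μ / 2 = X * (μ / (2 * L)) := by
      rw [hX]
      field_simp
    rw [h2]
    rcases le_or_gt 0 (-Real.log ε) with h0 | h0
    · have h3 : 8 * ((q + 1) * (L / μ) * -Real.log ε) * (X * (μ / (2 * L)))
          ≤ R * (X * (μ / (2 * L))) := by gcongr
      have h4 : 8 * ((q + 1) * (L / μ) * -Real.log ε) * (X * (μ / (2 * L)))
          = 4 * (X * (q + 1)) * -Real.log ε := by
        field_simp
        ring
      have h5 : 4 * (1 / 2) * -Real.log ε ≤ 4 * (X * (q + 1)) * -Real.log ε := by gcongr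
      push_cast
      linarith
    · have h3 : 0 ≤ R * (X * (μ / (2 * L))) := by positivity
      push_cast
      linarith
  have t1 : Real.exp (-(R * (η * γ * τ * μ / 2))) * (F.globalLoss x₀ - F.globalLoss xs + H / L)
      ≤ ε / 2 := by
    have h1 : F.globalLoss x₀ - F.globalLoss xs + H / L ≤ |F₀| + |H| / L + 1 := by
      have h2 : H / L ≤ |H| / L := by gcongr; exact le_abs_self H
      linarith [le_abs_self F₀]
    have h0 : 0 < |F₀| + |H| / L + 1 := by positivity
    calc Real.exp (-(R * (η * γ * τ * μ / 2))) * (F.globalLoss x₀ - F.globalLoss xs + H / L)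
        ≤ Real.exp (-(R * (η * γ * τ * μ / 2))) * (|F₀| + |H| / L + 1) := by gcongr
      _ ≤ ε ^ 2 * (|F₀| + |H| / L + 1) := by gcongr
      _ ≤ ε / 2 := by
          rw [le_div_iff₀ (by positivity)] at hε3
          linarith [mul_le_mul_of_nonneg_left hε3 hε.le]
  have t3 : 4 / μ * (σ ^ 2 * ε / C) ≤ ε / 4 := by
    have h1 : 16 * σ ^ 2 / μ ≤ C := by linarith
    rw [div_le_iff₀ hμ] at h1
    rw [div_mul_div_comm, div_le_iff₀ (by positivity)]
    linarith [mul_le_mul_of_nonneg_left h1 hε.le]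
  have t4 : 4 / μ * (m ^ 4 * Gq * ε ^ 2 / C ^ 2) ≤ ε / 4 := by
    rw [div_mul_div_comm, div_le_iff₀ (by positivity)]
    have h1 := mul_le_of_le_div_add_one hGq hε2 (by positivity) hε
    linarith [mul_le_mul_of_nonneg_left h1 hε.le]
  have t5 : 4 / μ * (σ ^ 2 / (m * τ) + m ^ 2 * Gq / τ ^ 2)
      ≤ 4 / μ * (σ ^ 2 * ε / C + m ^ 4 * Gq * ε ^ 2 / C ^ 2) := by gcongr
  rw [mul_add] at t5
  linarith

end PL

/-! ### The convex case, plain and regularized -/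

section Convex

set_option maxHeartbeats 1000000 in
theorem convex_guarantee {d m : ℕ} {Ξ : Type u} {S : Type v} {Ω : Type w}
    [MeasurableSpace Ξ] [MeasurableSpace S] [MeasurableSpace Ω] {F : FedSetup d m Ξ S}
    {P : Measure Ω} [IsProbabilityMeasure P] {R τ : ℕ} {η γ φ ε : ℝ} {x₀ xs : Vec d}
    {z : Fin m → ℕ → ℕ → Ω → Ξ} {s : Fin m → ℕ → Ω → S} {L σ q Gq B H C D : ℝ}
    (hF : F.Standing L σ q Gq) (hS : F.Sampling P z s)
    (hxs : IsMinOn F.globalLoss Set.univ xs) (hm : 0 < m) (hq : 0 ≤ q) (hL : 0 < L)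
    (hc : ConvexOn ℝ Set.univ F.globalLoss) (hx₀B : ‖x₀‖ ≤ B) (hxsB : ‖xs‖ ≤ B)
    (hH : F.dissimilarity x₀ ≤ H)
    (hε : 0 < ε) (hD : D = 2 * (4 * B ^ 2 + |H| / L ^ 2 + 1))
    (hC : C = 1 + B ^ 4 + 2048 * D * σ ^ 2)
    (hε1 : ε ≤ 1) (hε2 : ε ≤ 1 / (8000 * m)) (hε3 : ε ≤ L / 10)
    (hε4 : ε ≤ L / (4 * (σ ^ 2 + m ^ 4 * |Gq| + 1)))
    (hε5 : ε ≤ 1 / (2048 * D * m ^ 4 * (|Gq| + 1)))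
    (hRε1 : R * ε ^ 2 ≤ 1 / 4800)
    (hRε2 : R * ε ^ 2 ≤ L ^ 2 / (σ ^ 2 * m + m ^ 4 * |Gq| + 1))
    (hlog : 128 * D ≤ Real.log (1 / ε))
    (hR : R = ⌈L * (1 + q) / ε * Real.log (1 / ε)⌉₊) (hτ : τ = ⌈C * (1 / (m * ε ^ 2))⌉₊)
    (hγ : Real.sqrt (m * τ) ≤ γ) (hη : η = 1 / (2 * L * (q + 1) * τ * γ))
    (hφ : φ = 0 ∨ φ = 1 / Real.sqrt (m * τ)) :
    Integrable (fun ω =>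
      F.globalLoss ((F.regularize φ).globalModel τ η γ x₀ z s R ω) - F.globalLoss xs) P ∧
    ∫ ω, (F.globalLoss ((F.regularize φ).globalModel τ η γ x₀ z s R ω)
      - F.globalLoss xs) ∂P ≤ ε := by
  have hm' : (1 : ℝ) ≤ m := by exact_mod_cast hm
  have hm0 : (0 : ℝ) < m := by linarith
  have hB0 : 0 ≤ B := (norm_nonneg _).trans hx₀B
  have hD0 : 0 < D := by rw [hD]; positivity
  have hC1 : 1 ≤ C := by
    rw [hC]
    have : 0 ≤ B ^ 4 + 2048 * D * σ ^ 2 := by positivity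
    linarith
  have hC0 : 0 < C := by linarith
  have hGq := gap_nonneg hF.unbiasedCompressor hF.compressionGap
  rw [abs_of_nonneg hGq] at hε4 hRε2
  have hT1 : C ≤ τ * m * ε ^ 2 := by
    have := le_ceil_mul (a := C) (b := m * ε ^ 2) (by positivity)
    rw [← hτ] at this
    linarith
  have hT2 : (8000 : ℝ) ≤ τ := by
    rw [le_div_iff₀ (by positivity)] at hε2
    have h0 : 8000 * (m * ε ^ 2) ≤ 1 := by linarith [mul_le_mul_of_nonneg_left hε2 hε.le]
    have h1 : 8000 * (m * ε ^ 2) ≤ τ * (m * ε ^ 2) := by linarith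
    exact le_of_mul_le_mul_right h1 (by positivity)
  have hτ0 : (0 : ℝ) < τ := by linarith
  have hγ0 : 0 < γ := lt_of_lt_of_le (by positivity) hγ
  have hγ2 : m * τ ≤ γ ^ 2 := by
    rw [← Real.sq_sqrt (by positivity : (0 : ℝ) ≤ m * τ)]
    gcongr
  have hη0 : 0 < η := by rw [hη]; positivity
  have hφ0 : 0 ≤ φ := by rcases hφ with rfl | rfl <;> positivity
  -- Since `φ² ≤ 1 / (m τ) ≤ ε² / C`, the summand `1` of `C` gives `φ ≤ ε` and the summand `B ^ 4`
  -- gives `φ B² ≤ ε`. The value `φ = 0` is covered by the same estimates.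
  have hφ1 : φ ^ 2 * C ≤ ε ^ 2 := by
    have h1 : φ ^ 2 * (m * τ) ≤ 1 := by
      rcases hφ with rfl | rfl
      · simp
      · rw [div_pow, Real.sq_sqrt (by positivity), one_pow, one_div,
          inv_mul_cancel₀ (by positivity)]
    calc φ ^ 2 * C ≤ φ ^ 2 * (τ * m * ε ^ 2) := by gcongr
      _ = φ ^ 2 * (m * τ) * ε ^ 2 := by ring
      _ ≤ 1 * ε ^ 2 := by gcongr
      _ = ε ^ 2 := one_mul _
  have hφε : φ ≤ ε := by
    refine (sq_le_sq₀ hφ0 hε.le).1 (le_trans ?_ hφ1)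
    exact le_mul_of_one_le_right (sq_nonneg φ) hC1
  have hφB : φ * B ^ 2 ≤ ε := by
    refine (sq_le_sq₀ (by positivity) hε.le).1 (le_trans ?_ hφ1)
    have h1 : B ^ 4 ≤ C := by
      rw [hC]
      have : 0 ≤ 2048 * D * σ ^ 2 := by positivity
      linarith
    calc (φ * B ^ 2) ^ 2 = φ ^ 2 * B ^ 4 := by ring
      _ ≤ φ ^ 2 * C := by gcongr
  obtain ⟨y, hy, hyxs, hyf⟩ := exists_isMinOn_regularize hF.smooth hm hφ0 hxs
  have hFφ := standing_regularize hF hφ0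
  have hSφ : (F.regularize φ).Sampling P z s := sampling_regularize hS
  have hmem := memLp_globalModel (τ := τ) (η := η) (γ := γ) (x₀ := x₀) hFφ hSφ hq R
  have hint : Integrable (fun ω =>
      F.globalLoss ((F.regularize φ).globalModel τ η γ x₀ z s R ω) - F.globalLoss xs) P :=
    (integrable_globalLoss hF.smooth hm hxs hmem).sub (integrable_const _)
  refine ⟨hint, ?_⟩
  have hp : η * γ * τ = 1 / (2 * L * (q + 1)) := by
    rw [hη]
    field_simp
  set M := L + φ with hM
  have hM1 : L ≤ M := by linarith
  -- The step size is tuned to `L` while the regularized objective is only `(L + φ)`-smooth; the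
  -- slack between `1 / 2` and `3 / 5` in the step condition covers the difference.
  have hM2 : M ≤ 11 / 10 * L := by linarith
  have hM0 : 0 < M := by linarith
  have hp0 : 0 < η * γ * τ := by positivity
  have hpL : η * γ * τ ≤ 1 / (2 * L) := by
    rw [hp]
    exact one_div_le_one_div_of_le (by positivity)
      (le_mul_of_one_le_right (by positivity) (by linarith))
  set X := M * (η * γ * τ) with hX
  have hX0 : 0 < X := by positivity
  have hXq : X * (q + 1) ≤ 11 / 20 := by
    have h1 : X * (q + 1) = M / (2 * L) := by
      rw [hX, hp]
      field_simp
    rw [h1, div_le_iff₀ (by positivity)]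
    linarith
  have hX1 : X ≤ 11 / 20 := (le_mul_of_one_le_right hX0.le (by linarith)).trans hXq
  have hqm := div_le_self hq hm'
  have hLs : X * (1 + q / m) ≤ 3 / 5 := by
    have h1 : X * (1 + q / m) ≤ X * (q + 1) :=
      mul_le_mul_of_nonneg_left (by linarith) hX0.le
    linarith
  have hA0 : 6 * (η * τ * M) ^ 2 ≤ 2 / (m * τ) := by
    have h1 := local_step_le hX.symm (by positivity : (0 : ℝ) < m * τ) hγ2
    have h2 : 6 * (X ^ 2 / (m * τ)) ≤ 6 * ((11 / 20) ^ 2 / (m * τ)) := by gcongr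
    refine ((mul_le_mul_of_nonneg_left h1 (by norm_num)).trans h2).trans ?_
    rw [← mul_div_assoc]
    gcongr
    norm_num
  have hA : 6 * (η * τ * M) ^ 2 ≤ 1 / (1000 * m) := by
    refine hA0.trans ?_
    rw [div_le_div_iff₀ (by positivity) (by positivity)]
    linarith [mul_le_mul_of_nonneg_left hT2 hm0.le]
  have hmτ : (8000 : ℝ) ≤ m * τ := hT2.trans (le_mul_of_one_le_left hτ0.le hm')
  -- The Young weight is `b = m τ / (4000 M)`. As `A ≤ 2 / (m τ)` and `m τ ≥ 8000`, the two summands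
  -- contribute at most `1 / (2000 M)` each.
  have hbA : 6 * (η * τ * M) ^ 2 * (m * τ / (4000 * M) + 2 / M) ≤ 1 / (1000 * M) := by
    calc 6 * (η * τ * M) ^ 2 * (m * τ / (4000 * M) + 2 / M)
        ≤ 2 / (m * τ) * (m * τ / (4000 * M) + 2 / M) := by gcongr
      _ = (1 / 2000 + 4 / (m * τ)) / M := by
          field_simp
          ring
      _ ≤ (1 / 2000 + 4 / 8000) / M := by gcongr
      _ = 1 / (1000 * M) := by
          field_simp
          norm_num
  have hR0 : (0 : ℝ) ≤ R := by positivity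
  have hT3 : 1 ≤ m * τ * ε ^ 2 := by linarith
  -- With `b` of order `m τ`, the total growth exponent is of order `R ε²`, which is small because
  -- `R` is only of order `log (1 / ε) / ε`.
  have hRb : R * (η * γ * τ / (m * τ / (4000 * M))) ≤ 1 / 2 := by
    have h1 : R * (η * γ * τ / (m * τ / (4000 * M))) = 4000 * X * R / (m * τ) := by
      rw [hX]
      field_simp
    rw [h1, div_le_iff₀ (by positivity)]
    have h2 : R * 1 ≤ R * (m * τ * ε ^ 2) := by gcongr
    have h3 : m * τ * (R * ε ^ 2) ≤ m * τ * (1 / 4800) := by gcongr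
    have h4 : 4000 * X * R ≤ 4000 * (11 / 20) * R := by gcongr
    linarith
  have hHL : H / M ^ 2 ≤ |H| / L ^ 2 := by
    gcongr
    exact le_abs_self H
  have hxy : ‖x₀ - y‖ ^ 2 ≤ 4 * B ^ 2 := by
    have h1 : ‖x₀ - y‖ ≤ 2 * B := (norm_sub_le _ _).trans (by linarith)
    calc ‖x₀ - y‖ ^ 2 ≤ (2 * B) ^ 2 := by gcongr
      _ = 4 * B ^ 2 := by ring
  have hτinv : 1 / (τ : ℝ) ≤ m * ε ^ 2 := by
    rw [div_le_iff₀ hτ0]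
    linarith
  have hG1 : m ^ 2 * Gq / τ ^ 2 ≤ m ^ 4 * Gq * ε ^ 2 := by
    calc m ^ 2 * Gq / τ ^ 2 = m ^ 2 * Gq * (1 / τ) * (1 / τ) := by ring
      _ ≤ m ^ 2 * Gq * (m * ε ^ 2) * 1 := by
          gcongr
          rw [div_le_one hτ0]
          linarith
      _ = m ^ 3 * (Gq * ε ^ 2) := by ring
      _ ≤ m ^ 4 * (Gq * ε ^ 2) := by
          gcongr
          norm_num
      _ = m ^ 4 * Gq * ε ^ 2 := by ring
  have hS1 : σ ^ 2 / τ ≤ σ ^ 2 * (m * ε ^ 2) := by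
    rw [div_eq_mul_one_div]
    gcongr
  obtain ⟨hn1, hn2⟩ := noise_le hm0 hτ0 hC0 (sq_nonneg σ) hGq hT1
  have hnoise : R * (2 * (η * γ * τ) / M * (σ ^ 2 / τ + m ^ 2 * Gq / τ ^ 2)) ≤ 1 := by
    have h1 : 2 * (η * γ * τ) / M ≤ 1 / L ^ 2 := by
      calc 2 * (η * γ * τ) / M ≤ 2 * (1 / (2 * L)) / L := by gcongr
        _ = 1 / L ^ 2 := by field_simp
    rw [le_div_iff₀ (by positivity)] at hRε2
    calc R * (2 * (η * γ * τ) / M * (σ ^ 2 / τ + m ^ 2 * Gq / τ ^ 2))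
        ≤ R * (1 / L ^ 2 * (σ ^ 2 * (m * ε ^ 2) + m ^ 4 * Gq * ε ^ 2)) := by gcongr
      _ = R * ε ^ 2 * (σ ^ 2 * m + m ^ 4 * Gq) / L ^ 2 := by ring
      _ ≤ 1 := by
          rw [div_le_one (by positivity)]
          have : 0 ≤ R * ε ^ 2 := by positivity
          linarith
  -- The choice `θ = ε / 4` spends `ε / 2` on the regularized objective and leaves `ε / 2` for the
  -- bias. The minimizer `y` is no longer than `xs`, so `4 B²` in `D` bounds the initial squared
  -- distance; the summand `1` in `D` covers the accumulated noise.
  have main := integral_globalLoss_le_of_convex hFφ hSφ hy hm (by exact_mod_cast hτ0) hη0 hγ0 hq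
    hM0 hLs hA ((dissimilarity_regularize hF.smooth hφ0 hm x₀).trans_le hH)
    (convexOn_regularize hm hφ0 hc) (D := D) (θ := ε / 4) (b := m * τ / (4000 * M))
    (by positivity) hbA (R := R) hRb hD0 (by rw [hD]; linarith) (by positivity)
    (by
      rw [le_div_iff₀ (by positivity)] at hε4
      have h1 : σ ^ 2 / (m * τ) ≤ σ ^ 2 * ε ^ 2 := by
        rw [div_le_iff₀ (by positivity)]
        linarith [mul_le_mul_of_nonneg_left hT3 (sq_nonneg σ)]
      calc 2 * (η * γ * τ) * (σ ^ 2 / (m * τ) + m ^ 2 * Gq / τ ^ 2)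
          ≤ 2 * (1 / (2 * L)) * (σ ^ 2 * ε ^ 2 + m ^ 4 * Gq * ε ^ 2) := by gcongr
        _ = ε * (ε * (σ ^ 2 + m ^ 4 * Gq)) / L := by
            field_simp
        _ ≤ ε / 4 := by
            rw [div_le_iff₀ hL]
            linarith [mul_le_mul_of_nonneg_left hε4 hε.le, mul_pos hε hε])
    (by
      have h1 : 64 * D * (σ ^ 2 * ε ^ 2 / C) ≤ ε ^ 2 / 32 := by
        rw [← mul_div_assoc, div_le_iff₀ hC0]
        have h2 : 2048 * D * σ ^ 2 ≤ C := by
          rw [hC]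
          have : 0 ≤ B ^ 4 := by positivity
          linarith
        linarith [mul_le_mul_of_nonneg_left h2 (sq_nonneg ε)]
      have h3 : 64 * D * (m ^ 4 * Gq * (ε ^ 2) ^ 2 / C ^ 2) ≤ ε ^ 2 / 32 := by
        have h4 := mul_le_of_le_div_add_one hGq hε5 (by positivity) hε
        have h5 : m ^ 4 * Gq * (ε ^ 2) ^ 2 / C ^ 2 ≤ m ^ 4 * Gq * (ε ^ 2) ^ 2 := by
          exact div_le_self (by positivity) (one_le_pow₀ hC1)
        have h6 : 2048 * D * m ^ 4 * Gq * ε * ε ≤ 1 * 1 := by gcongr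
        calc 64 * D * (m ^ 4 * Gq * (ε ^ 2) ^ 2 / C ^ 2)
            ≤ 64 * D * (m ^ 4 * Gq * (ε ^ 2) ^ 2) := by gcongr
          _ = 2048 * D * m ^ 4 * Gq * ε * ε * ε ^ 2 / 32 := by ring
          _ ≤ 1 * 1 * ε ^ 2 / 32 := by gcongr
          _ = ε ^ 2 / 32 := by ring
      calc 64 * D * (σ ^ 2 / (m * τ) + m ^ 2 * Gq / τ ^ 2)
          ≤ 64 * D * (σ ^ 2 * ε ^ 2 / C + m ^ 4 * Gq * (ε ^ 2) ^ 2 / C ^ 2) := by gcongr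
        _ ≤ (ε / 4) ^ 2 := by
            rw [mul_add]
            linarith)
    (by
      -- Here `s R ≥ log (1 / ε) / (2 ε)`, so the required number of rounds is reached as soon as
      -- `log (1 / ε) ≥ 128 D`.
      have h1 := Nat.le_ceil (L * (1 + q) / ε * Real.log (1 / ε))
      rw [← hR] at h1
      rw [hp]
      calc 16 * D ≤ Real.log (1 / ε) / 8 := by linarith
        _ = ε / 4 * (1 / (2 * L * (q + 1)) * (L * (1 + q) / ε * Real.log (1 / ε))) := by
            field_simp
            ring
        _ ≤ ε / 4 * (1 / (2 * L * (q + 1)) * R) := by gcongr)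
  have hint' := integrable_globalLoss_globalModel (τ := τ) (η := η) (γ := γ) (x₀ := x₀) hFφ hSφ hy
    hm hq R
  have hxs2 : φ / 2 * ‖xs‖ ^ 2 ≤ ε / 2 := by
    have : φ * ‖xs‖ ^ 2 ≤ φ * B ^ 2 := by gcongr
    linarith
  -- Pointwise, dropping the nonnegative regularizer at the model and using the near-optimality of
  -- `y` costs only `(φ / 2) ‖xs‖²`.
  have hle : ∫ ω, (F.globalLoss ((F.regularize φ).globalModel τ η γ x₀ z s R ω)
      - F.globalLoss xs) ∂P
      ≤ ∫ ω, ((F.regularize φ).globalLoss ((F.regularize φ).globalModel τ η γ x₀ z s R ω)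
      - (F.regularize φ).globalLoss y + ε / 2) ∂P := by
    refine integral_mono hint (hint'.add (integrable_const _)) fun ω => ?_
    have h1 := globalLoss_regularize (F := F) (φ := φ) hm
      ((F.regularize φ).globalModel τ η γ x₀ z s R ω)
    have h2 : 0 ≤ φ / 2 * ‖(F.regularize φ).globalModel τ η γ x₀ z s R ω‖ ^ 2 := by positivity
    dsimp only
    linarith
  rw [integral_add hint' (integrable_const _)] at hle
  simp only [integral_const, probReal_univ, one_smul] at hle
  linarith

end Convex

end FedComgate

end

/-! ### Choice of the constants and assembly -/

open FedComgate in
theorem theorem2 :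
    -- nonconvex objectives
    (∀ L σ F₀ H : ℝ, 0 < L → 0 ≤ σ →
      ∃ C₁ C₂ : ℝ, 0 < C₁ ∧ 0 < C₂ ∧
      ∀ (m : ℕ) (q Gq : ℝ), 0 < m → 0 ≤ q →
      ∃ ε₀ : ℝ, 0 < ε₀ ∧ ∀ ε : ℝ, 0 < ε → ε ≤ ε₀ →
      ∀ (R τ : ℕ) (γ η : ℝ),
        R = ⌈C₁ * ((q + 1) / ε)⌉₊ →
        τ = ⌈C₂ * (1 / (m * ε))⌉₊ →
        (m : ℝ) ≤ γ →
        η = 1 / (L * γ) * Real.sqrt (m / (R * τ * (q + 1))) →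
      ∀ (d : ℕ) (Ξ : Type u) (S : Type v) (Ω : Type w)
        [MeasurableSpace Ξ] [MeasurableSpace S] [MeasurableSpace Ω]
        (F : FedSetup d m Ξ S) (P : Measure Ω) [IsProbabilityMeasure P]
        (z : Fin m → ℕ → ℕ → Ω → Ξ) (s : Fin m → ℕ → Ω → S) (x₀ xs : Vec d),
        F.Standing L σ q Gq → F.Sampling P z s →
        IsMinOn F.globalLoss Set.univ xs →
        F.globalLoss x₀ - F.globalLoss xs ≤ F₀ → F.dissimilarity x₀ ≤ H →
        Integrable (fun ω => 1 / (R : ℝ) * ∑ r ∈ Finset.range R,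
          ‖gradient F.globalLoss (F.globalModel τ η γ x₀ z s r ω)‖ ^ 2) P ∧
        ∫ ω, 1 / (R : ℝ) * ∑ r ∈ Finset.range R,
          ‖gradient F.globalLoss (F.globalModel τ η γ x₀ z s r ω)‖ ^ 2 ∂P ≤ ε) ∧
    -- strongly convex or PL objectives
    (∃ C₁ : ℝ, 0 < C₁ ∧ ∀ L μ σ F₀ H : ℝ, 0 < L → 0 < μ → 0 ≤ σ →
      ∃ C₂ : ℝ, 0 < C₂ ∧
      ∀ (m : ℕ) (q Gq : ℝ), 0 < m → 0 ≤ q →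
      ∃ ε₀ : ℝ, 0 < ε₀ ∧ ∀ ε : ℝ, 0 < ε → ε ≤ ε₀ →
      ∀ (R τ : ℕ) (γ η : ℝ),
        R = ⌈C₁ * ((q + 1) * (L / μ) * Real.log (1 / ε))⌉₊ →
        τ = ⌈C₂ * (1 / (m * ε))⌉₊ →
        Real.sqrt (m * τ) ≤ γ →
        (η = 1 / (2 * L * (q / m + 1) * τ * γ) ∨ η = 1 / (2 * L * (q + 1) * τ * γ)) →
      ∀ (d : ℕ) (Ξ : Type u) (S : Type v) (Ω : Type w)
        [MeasurableSpace Ξ] [MeasurableSpace S] [MeasurableSpace Ω]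
        (F : FedSetup d m Ξ S) (P : Measure Ω) [IsProbabilityMeasure P]
        (z : Fin m → ℕ → ℕ → Ω → Ξ) (s : Fin m → ℕ → Ω → S) (x₀ xs : Vec d),
        F.Standing L σ q Gq → F.Sampling P z s →
        IsMinOn F.globalLoss Set.univ xs →
        (F.PL μ xs ∨ F.StrongConvex μ) →
        F.globalLoss x₀ - F.globalLoss xs ≤ F₀ → F.dissimilarity x₀ ≤ H →
        Integrable (fun ω =>
          F.globalLoss (F.globalModel τ η γ x₀ z s R ω) - F.globalLoss xs) P ∧
        ∫ ω, (F.globalLoss (F.globalModel τ η γ x₀ z s R ω) - F.globalLoss xs) ∂P ≤ ε) ∧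
    -- convex objectives: the algorithm run on `f`, and on `f` regularized with `φ = 1 / √(m τ)`
    (∃ C₁ : ℝ, 0 < C₁ ∧ ∀ L σ B H : ℝ, 0 < L → 0 ≤ σ →
      ∃ C₂ : ℝ, 0 < C₂ ∧
      ∀ (m : ℕ) (q Gq : ℝ), 0 < m → 0 ≤ q →
      ∃ ε₀ : ℝ, 0 < ε₀ ∧ ∀ ε : ℝ, 0 < ε → ε ≤ ε₀ →
      ∀ (R τ : ℕ) (γ η φ : ℝ),
        R = ⌈C₁ * (L * (1 + q) / ε * Real.log (1 / ε))⌉₊ →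
        τ = ⌈C₂ * (1 / (m * ε ^ 2))⌉₊ →
        Real.sqrt (m * τ) ≤ γ →
        η = 1 / (2 * L * (q + 1) * τ * γ) →
        (φ = 0 ∨ φ = 1 / Real.sqrt (m * τ)) →
      ∀ (d : ℕ) (Ξ : Type u) (S : Type v) (Ω : Type w)
        [MeasurableSpace Ξ] [MeasurableSpace S] [MeasurableSpace Ω]
        (F : FedSetup d m Ξ S) (P : Measure Ω) [IsProbabilityMeasure P]
        (z : Fin m → ℕ → ℕ → Ω → Ξ) (s : Fin m → ℕ → Ω → S) (x₀ xs : Vec d),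
        F.Standing L σ q Gq → F.Sampling P z s →
        IsMinOn F.globalLoss Set.univ xs →
        ConvexOn ℝ Set.univ F.globalLoss →
        ‖x₀‖ ≤ B → ‖xs‖ ≤ B → F.dissimilarity x₀ ≤ H →
        Integrable (fun ω =>
          F.globalLoss ((F.regularize φ).globalModel τ η γ x₀ z s R ω) - F.globalLoss xs) P ∧
        ∫ ω, (F.globalLoss ((F.regularize φ).globalModel τ η γ x₀ z s R ω)
          - F.globalLoss xs) ∂P ≤ ε) := by
  refine ⟨?_, ?_, ?_⟩
  · intro L σ F₀ H hL hσ
    have hC : 0 < 32 * (σ ^ 2 + |F₀| * L + |H| + 1) := by positivity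
    refine ⟨12000 * (32 * (σ ^ 2 + |F₀| * L + |H| + 1)), 32 * (σ ^ 2 + |F₀| * L + |H| + 1),
      by positivity, hC, fun m q Gq hm hq => ?_⟩
    have hm0 : (0 : ℝ) < m := by exact_mod_cast hm
    obtain ⟨ε₀, hε₀, h⟩ := exists_threshold
      ((eventually_le_of_pos (div_pos hC hm0)).and (eventually_le_of_pos
        (by positivity : 0 < (32 * (σ ^ 2 + |F₀| * L + |H| + 1)) ^ 2
          / (32 * m ^ 4 * (|Gq| + 1)))))
    refine ⟨ε₀, hε₀, ?_⟩
    intro ε hε hεε₀ R τ γ η hR hτ hγ hη d Ξ S Ω _ _ _ F P _ z s x₀ xs hF hS hxs hF₀ hH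
    obtain ⟨h1, h2⟩ := h ε hε hεε₀
    refine ⟨(integrable_finsetSum _ fun r _ =>
      integrable_norm_gradient_sq_globalModel hF hS hm hq r).const_mul _, ?_⟩
    exact nonconvex_guarantee hF hS hxs hm hq hL hF₀ hH hε le_rfl h1 h2 hR hτ hγ hη
  · refine ⟨8, by norm_num, fun L μ σ F₀ H hL hμ hσ => ?_⟩
    have hC : 0 < 16 * σ ^ 2 / μ + 1 := by positivity
    refine ⟨16 * σ ^ 2 / μ + 1, hC, fun m q Gq hm hq => ?_⟩
    have hm0 : (0 : ℝ) < m := by exact_mod_cast hm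
    obtain ⟨ε₀, hε₀, h⟩ := exists_threshold
      ((eventually_le_of_pos (by positivity : 0 < (16 * σ ^ 2 / μ + 1) / (1500 * m))).and
        ((eventually_le_of_pos (by positivity :
          0 < μ * (16 * σ ^ 2 / μ + 1) ^ 2 / (16 * m ^ 4 * (|Gq| + 1)))).and
        (eventually_le_of_pos (by positivity : 0 < 1 / (2 * (|F₀| + |H| / L + 1))))))
    refine ⟨ε₀, hε₀, ?_⟩
    intro ε hε hεε₀ R τ γ η hR hτ hγ hη d Ξ S Ω _ _ _ F P _ z s x₀ xs hF hS hxs hPL hF₀ hH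
    obtain ⟨h1, h2, h3⟩ := h ε hε hεε₀
    have hPL' : F.PL μ xs := hPL.elim id (PL_of_strongConvex hμ)
    refine ⟨integrable_globalLoss_globalModel hF hS hxs hm hq R, ?_⟩
    exact PL_guarantee hF hS hxs hm hq hL hμ hPL' hF₀ hH hε le_rfl h1 h2 h3 hR hτ hγ hη
  -- No large `C₁` is needed: the dependence on `B`, `H` and `L` sits in `D`, which `log (1 / ε)`
  -- dominates below the threshold.
  · refine ⟨1, one_pos, fun L σ B H hL hσ => ?_⟩
    obtain ⟨D, hD⟩ : ∃ D, D = 2 * (4 * B ^ 2 + |H| / L ^ 2 + 1) := ⟨_, rfl⟩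
    have hD0 : 0 < D := by rw [hD]; positivity
    obtain ⟨C, hC⟩ : ∃ C, C = 1 + B ^ 4 + 2048 * D * σ ^ 2 := ⟨_, rfl⟩
    have hC0 : 0 < C := by rw [hC]; positivity
    refine ⟨C, hC0, fun m q Gq hm hq => ?_⟩
    have hm0 : (0 : ℝ) < m := by exact_mod_cast hm
    have hLq : 0 ≤ L * (1 + q) := by positivity
    obtain ⟨ε₀, hε₀, h⟩ := exists_threshold
      ((eventually_le_of_pos one_pos).and
      ((eventually_le_of_pos (by positivity : 0 < 1 / (8000 * (m : ℝ)))).and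
      ((eventually_le_of_pos (by positivity : 0 < L / 10)).and
      ((eventually_le_of_pos (by positivity : 0 < L / (4 * (σ ^ 2 + m ^ 4 * |Gq| + 1)))).and
      ((eventually_le_of_pos (by positivity : 0 < 1 / (2048 * D * m ^ 4 * (|Gq| + 1)))).and
      ((eventually_ceil_mul_sq_le hLq (by norm_num : (0 : ℝ) < 1 / 4800)).and
      ((eventually_ceil_mul_sq_le hLq (by positivity :
        0 < L ^ 2 / (σ ^ 2 * m + m ^ 4 * |Gq| + 1))).and
      (eventually_le_log_inv (128 * D)))))))))
    refine ⟨ε₀, hε₀, ?_⟩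
    intro ε hε hεε₀ R τ γ η φ hR hτ hγ hη hφ d Ξ S Ω _ _ _ F P _ z s x₀ xs hF hS hxs hc hx₀ hxsB hH
    rw [one_mul] at hR
    obtain ⟨h1, h2, h3, h4, h5, h6, h7, h8⟩ := h ε hε hεε₀
    rw [← hR] at h6 h7
    exact convex_guarantee hF hS hxs hm hq hL hc hx₀ hxsB hH hε hD hC h1 h2 h3 h4 h5 h6 h7 h8 hR
      hτ hγ hη hφ
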